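/- **Conventions.** Let $G$ be a (discrete) group with unit $e$. A *Fell bundle* $\mathcal B=\{B_t\}_{t\in G}$ over $G$ (a $C^*$-algebraic bundle over $G$) consists of complex Banach spaces $B_t$, bilinear maps $B_s\times B_t\to B_{st}$, $(a,b)\mapsto ab$, and conjugate-linear maps $B_t\to B_{t^{-1}}$, $a\mapsto a^*$, such that $(ab)c=a(bc)$, $a^{**}=a$, $(ab)^*=b^*a^*$, $\|ab\|\le\|a\|\|b\|$, $\|a^*a\|=\|a\|^2$, and $a^*a$ is a positive element of the $C^*$-algebra $B_e$. A *W\*-Fell bundle* is a Fell bundle $\mathcal M=\{M_t\}_{t\in G}$ whose fibres are dual Banach spaces and such that $M_t\to M_{t^{-1}}$, $b\mapsto b^*$, and $M_t\to M_{st}$, $b\mapsto ab$ ($a\in M_s$), are $w^*$-continuous. The *enveloping W\*-Fell bundle* of $\mathcal B$ is $\mathcal B''=\{B_t''\}_{t\in G}$, the bundle of Banach space biduals with the canonical ($w^*$-continuous) extensions of the operations of $\mathcal B$, i.e. Arens products and second adjoints of the involutions. The bidual $A''$ of a $C^*$-algebra $A$ is considered with its usual W*-algebra structure; the bidual $\alpha''$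 of an action $\alpha$ of $G$ on $A$ is the action on $A''$ by the second adjoints of the $\alpha_t$. **Kernels.** A kernel of finite support of $\mathcal B$ is a function $k$ on $G\times G$ with $k(s,t)\in B_{st^{-1}}$ which vanishes outside a finite set. These form a $*$-algebra $\mathbb k_c(\mathcal B)$ with $(h*k)(r,s)=\sum_{t}h(r,t)k(t,s)$ and $k^*(r,s)=k(s,r)^*$. The $C^*$-algebra of kernels $\mathbb k(\mathcal B)$ is the enveloping $C^*$-algebra of the completion of $\mathbb k_c(\mathcal B)$ for the norm $\|k\|_2=\big(\sum_{s,t}\|k(s,t)\|^2\big)^{1/2}$. The canonical action $\beta$ of $G$ on $\mathbb k(\mathcal B)$ is determined by $\beta_t(k)(r,s)=k(rt,st)$ for $k\in\mathbb k_c(\mathcal B)$. **The W\*-algebra of kernels.** Let $\mathcal M$ be a W*-Fell bundle over $G$. Let $\ell^2_{w^*}(\mathcal M)$ be the space of sections $\xi$ of $\mathcal M$ for which the finite sums $\sum_{t\in F}\xi(t)^*\xi(t)$ are bounded in $M_e$, with the inner product $\langle\xi,\eta\rangle=\sum_{t}\xi(t)^*\eta(t)$ ($w^*$-convergent in $M_e$),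 and let $\mathcal L(\ell^2_{w^*}(\mathcal M))$ be the W*-algebra of its adjointable operators. For $k\in\mathbb k_c(\mathcal M)$ put $(\pi(k)\xi)(s)=\sum_{t}k(s,t)\xi(t)$ and $\pi^\beta(k)=\big(\pi(\beta_t^{-1}(k))\big)_{t\in G}\in\ell^\infty(G,\mathcal L(\ell^2_{w^*}(\mathcal M)))$; $\pi^\beta$ extends to a $*$-homomorphism on $\mathbb k(\mathcal M)$. The W*-algebra of kernels $\mathbb k_{w^*}(\mathcal M)$ is the $w^*$-closure of $\pi^\beta(\mathbb k(\mathcal M))$ in $\ell^\infty(G,\mathcal L(\ell^2_{w^*}(\mathcal M)))$ (equivalently, of $\pi^\beta(\mathbb k_c(\mathcal M))$), and the canonical W*-action $\beta^{w^*}$ of $G$ on $\mathbb k_{w^*}(\mathcal M)$ is the restriction of the translation action $\gamma_s(f)(t)=f(s^{-1}t)$. **Theorem.** Let $\mathcal B$ be a Fell bundle over a group $G$. Then $\mathcal B''$ is a W*-Fell bundle, and the canonical W*-action $\beta^{w^*}$ of $G$ on $\mathbb k_{w^*}(\mathcal B'')$ is isomorphic, as a W*-action, to the bidual $\beta''$ of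 the canonical action $\beta$ of $G$ on $\mathbb k(\mathcal B)$: there is a $*$-isomorphism $\Phi\colon\mathbb k(\mathcal B)''\to\mathbb k_{w^*}(\mathcal B'')$ which is a homeomorphism for the $w^*$-topologies and satisfies $\Phi\circ\beta''_s=\beta^{w^*}_s\circ\Phi$ for all $s\in G$. In particular, $\mathbb k_{w^*}(\mathcal B'')\cong\mathbb k(\mathcal B)''$. -/

import Mathlib

open scoped ENNReal ComplexConjugate Topology

set_option linter.unusedSectionVars false

noncomputable section

namespace Fell

universe u v

/-- The multiplication `B_s × B_t → B_{st}` and the involution `B_s → B_{s⁻¹}` of a bundle over a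
group. To avoid casts between fibres, the target index is any `u` with a proof of `s * t = u`
(resp. `s⁻¹ = t`). -/
class FellOps {G : Type v} [Group G] (B : G → Type u) where
  mul : ∀ {s t u : G}, s * t = u → B s → B t → B u
  inv : ∀ {s t : G}, s⁻¹ = t → B s → B t

open FellOps

section FellBundle

variable {G : Type v} [Group G] (B : G → Type u) [∀ t, NormedAddCommGroup (B t)]
  [∀ t, NormedSpace ℂ (B t)]

/-- A Fell bundle (C*-algebraic bundle) over the discrete group `G` with fibres `B t`. -/
class FellBundle [FellOps B] : Prop where
  complete : ∀ t, CompleteSpace (B t)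
  mul_add : ∀ {s t u : G} (h : s * t = u) (a : B s) (b c : B t),
    mul h a (b + c) = mul h a b + mul h a c
  add_mul : ∀ {s t u : G} (h : s * t = u) (a b : B s) (c : B t),
    mul h (a + b) c = mul h a c + mul h b c
  smul_mul : ∀ {s t u : G} (h : s * t = u) (z : ℂ) (a : B s) (b : B t),
    mul h (z • a) b = z • mul h a b
  mul_smul : ∀ {s t u : G} (h : s * t = u) (z : ℂ) (a : B s) (b : B t),
    mul h a (z • b) = z • mul h a b
  mul_assoc : ∀ {r s t rs st u : G} (h₁ : r * s = rs) (h₂ : rs * t = u) (h₃ : s * t = st)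
    (h₄ : r * st = u) (a : B r) (b : B s) (c : B t),
    mul h₂ (mul h₁ a b) c = mul h₄ a (mul h₃ b c)
  inv_add : ∀ {s t : G} (h : s⁻¹ = t) (a b : B s), inv h (a + b) = inv h a + inv h b
  inv_smul : ∀ {s t : G} (h : s⁻¹ = t) (z : ℂ) (a : B s), inv h (z • a) = conj z • inv h a
  inv_inv : ∀ {s t : G} (h : s⁻¹ = t) (h' : t⁻¹ = s) (a : B s), inv h' (inv h a) = a
  inv_mul : ∀ {s t u s' t' u' : G} (h : s * t = u) (hs : s⁻¹ = s') (ht : t⁻¹ = t') (hu : u⁻¹ = u')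
    (h' : t' * s' = u') (a : B s) (b : B t), inv hu (mul h a b) = mul h' (inv ht b) (inv hs a)
  norm_mul_le : ∀ {s t u : G} (h : s * t = u) (a : B s) (b : B t), ‖mul h a b‖ ≤ ‖a‖ * ‖b‖
  norm_inv_mul_self : ∀ {s t u : G} (h : s⁻¹ = t) (h' : t * s = u) (a : B s),
    ‖mul h' (inv h a) a‖ = ‖a‖ ^ 2
  /-- `a* a` is a positive element of the unit fibre -/
  inv_mul_self_pos : ∀ {s t : G} (h : s⁻¹ = t) (h' : t * s = 1) (a : B s),
    ∃ c : B 1, mul h' (inv h a) a = mul (one_mul 1) (inv inv_one c) c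

end FellBundle

section Basic

variable {G : Type v} [Group G] {B : G → Type u} [∀ t, NormedAddCommGroup (B t)]
  [∀ t, NormedSpace ℂ (B t)] [FellOps B] [FellBundle B]

open FellBundle

lemma norm_le_norm_inv {s t : G} (h : s⁻¹ = t) (a : B s) : ‖a‖ ≤ ‖inv h a‖ := by
  have h1 := norm_inv_mul_self h rfl a
  have h2 := FellBundle.norm_mul_le (rfl : t * s = t * s) (inv h a) a
  by_cases h0 : ‖a‖ = 0
  · rw [h0]; positivity
  · have : 0 < ‖a‖ := lt_of_le_of_ne (norm_nonneg _) (Ne.symm h0)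
    nlinarith

@[simp] lemma norm_inv {s t : G} (h : s⁻¹ = t) (a : B s) : ‖inv h a‖ = ‖a‖ := by
  refine le_antisymm ?_ (norm_le_norm_inv h a)
  have h' : t⁻¹ = s := by rw [← h, _root_.inv_inv]
  simpa [FellBundle.inv_inv h h' a] using norm_le_norm_inv h' (inv h a)

/-- The multiplication as a bounded bilinear map. -/
def mulL {s t u : G} (h : s * t = u) : B s →L[ℂ] B t →L[ℂ] B u :=
  LinearMap.mkContinuous₂ (LinearMap.mk₂ ℂ (mul h) (FellBundle.add_mul h) (FellBundle.smul_mul h)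
    (FellBundle.mul_add h) (FellBundle.mul_smul h)) 1 fun a b => by
      simpa using FellBundle.norm_mul_le h a b

@[simp] lemma mulL_apply {s t u : G} (h : s * t = u) (a : B s) (b : B t) :
    mulL h a b = mul h a b := rfl

/-- The involution as a bounded conjugate-linear map. -/
def invL {s t : G} (h : s⁻¹ = t) : B s →L⋆[ℂ] B t :=
  LinearMap.mkContinuous
    { toFun := inv h, map_add' := FellBundle.inv_add h, map_smul' := FellBundle.inv_smul h } 1
    fun a => by simp

@[simp] lemma invL_apply {s t : G} (h : s⁻¹ = t) (a : B s) : invL h a = inv h a := rfl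

lemma mul_sum {ι : Type*} {s t u : G} (h : s * t = u) (a : B s) (F : Finset ι) (b : ι → B t) :
    mul h a (∑ i ∈ F, b i) = ∑ i ∈ F, mul h a (b i) := map_sum (mulL h a) b F

lemma sum_mul {ι : Type*} {s t u : G} (h : s * t = u) (F : Finset ι) (a : ι → B s) (b : B t) :
    mul h (∑ i ∈ F, a i) b = ∑ i ∈ F, mul h (a i) b := map_sum ((mulL h).flip b) a F

lemma inv_sum {ι : Type*} {s t : G} (h : s⁻¹ = t) (F : Finset ι) (a : ι → B s) :
    inv h (∑ i ∈ F, a i) = ∑ i ∈ F, inv h (a i) := map_sum (invL h) a F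

@[simp] lemma mul_zero' {s t u : G} (h : s * t = u) (a : B s) : mul h a (0 : B t) = 0 :=
  map_zero (mulL h a)

@[simp] lemma zero_mul' {s t u : G} (h : s * t = u) (b : B t) : mul h (0 : B s) b = 0 :=
  map_zero ((mulL h).flip b)

@[simp] lemma inv_zero' {s t : G} (h : s⁻¹ = t) : inv h (0 : B s) = 0 := map_zero (invL h)

lemma mul_sub' {s t u : G} (h : s * t = u) (a : B s) (b c : B t) :
    mul h a (b - c) = mul h a b - mul h a c := map_sub (mulL h a) b c

end Basic

/-! ### The unit fibre -/

section UnitFibre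

variable {G : Type v} [Group G] (B : G → Type u)

/-- The fibre over the unit of the group, as a C*-algebra. -/
def UnitFibre : Type u := B 1

variable [∀ t, NormedAddCommGroup (B t)] [∀ t, NormedSpace ℂ (B t)] [FellOps B] [FellBundle B]

instance : NormedAddCommGroup (UnitFibre B) := inferInstanceAs (NormedAddCommGroup (B 1))
instance : NormedSpace ℂ (UnitFibre B) := inferInstanceAs (NormedSpace ℂ (B 1))
instance : Mul (UnitFibre B) := ⟨fun a b => mul (B := B) (one_mul (1 : G)) a b⟩
instance : Star (UnitFibre B) := ⟨fun a => inv (B := B) (inv_one (G := G)) a⟩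

instance : NonUnitalCStarAlgebra (UnitFibre B) where
  __ := (inferInstance : NormedAddCommGroup (UnitFibre B))
  __ := (inferInstance : NormedSpace ℂ (UnitFibre B))
  dist_eq := dist_eq_norm_neg_add
  left_distrib := FellBundle.mul_add (B := B) _
  right_distrib := FellBundle.add_mul (B := B) _
  zero_mul := zero_mul' (B := B) _
  mul_zero := mul_zero' (B := B) _
  mul_assoc := FellBundle.mul_assoc (B := B) _ _ _ _
  norm_mul_le := FellBundle.norm_mul_le (B := B) _
  star_involutive := FellBundle.inv_inv (B := B) _ _
  star_mul := FellBundle.inv_mul (B := B) _ _ _ _ _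
  star_add := FellBundle.inv_add (B := B) _
  complete := (FellBundle.complete (B := B) 1).complete
  norm_mul_self_le a := by
    have := FellBundle.norm_inv_mul_self (B := B) inv_one (one_mul (1 : G)) a
    exact (sq ‖a‖ ▸ this.ge)
  smul_assoc := FellBundle.smul_mul (B := B) _
  smul_comm z a b := (FellBundle.mul_smul (B := B) (one_mul (1 : G)) z a b).symm
  star_smul := FellBundle.inv_smul (B := B) _

end UnitFibre

/-! ### Kernels of finite support -/

section Kernels

variable {G : Type v} [Group G] (B : G → Type u) [∀ t, NormedAddCommGroup (B t)]
  [∀ t, NormedSpace ℂ (B t)]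

/-- The kernels `k(s,t) ∈ B_{st⁻¹}` of finite support. -/
def finKernels : Submodule ℂ (∀ s t : G, B (s * t⁻¹)) where
  carrier := {k | {p : G × G | k p.1 p.2 ≠ 0}.Finite}
  zero_mem' := by simp
  add_mem' {k l} hk hl := (hk.union hl).subset fun p hp => by
    by_contra h
    simp only [Set.mem_union, Set.mem_ofPred_eq, not_or, not_not] at h
    exact hp (by simp [h.1, h.2])
  smul_mem' z k hk := hk.subset fun p hp h => hp (by simp [h])

/-- The type of kernels of finite support. -/
def FinKernel : Type (max u v) := finKernels B

instance : AddCommGroup (FinKernel B) := inferInstanceAs (AddCommGroup (finKernels B))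
instance : Module ℂ (FinKernel B) := inferInstanceAs (Module ℂ (finKernels B))

end Kernels

namespace FinKernel

section

variable {G : Type v} [Group G] {B : G → Type u} [∀ t, NormedAddCommGroup (B t)]
  [∀ t, NormedSpace ℂ (B t)]

/-- The entry `k(s,t)`, viewed in the fibre over any `u` with `s t⁻¹ = u`. -/
def entry (k : FinKernel B) {s t u : G} (h : s * t⁻¹ = u) : B u := h ▸ k.1 s t

lemma entry_rfl (k : FinKernel B) (s t : G) : k.entry (rfl : s * t⁻¹ = _) = k.1 s t := rfl

lemma ext' {k l : FinKernel B} (h : ∀ s t : G, k.entry (rfl : s * t⁻¹ = _) = l.entry rfl) :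
    k = l := Subtype.ext (funext fun s => funext fun t => h s t)

@[simp] lemma entry_add (k l : FinKernel B) {s t u : G} (h : s * t⁻¹ = u) :
    (k + l).entry h = k.entry h + l.entry h := by subst h; rfl

@[simp] lemma entry_zero {s t u : G} (h : s * t⁻¹ = u) :
    (0 : FinKernel B).entry h = 0 := by subst h; rfl

@[simp] lemma entry_smul (z : ℂ) (k : FinKernel B) {s t u : G} (h : s * t⁻¹ = u) :
    (z • k).entry h = z • k.entry h := by subst h; rfl

lemma entry_eq_zero_iff (k : FinKernel B) {s t u : G} (h : s * t⁻¹ = u) :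
    k.entry h = 0 ↔ k.1 s t = 0 := by subst h; rfl

/-- A finite set `F` with `k` supported in `F × F`. -/
def supp (k : FinKernel B) : Finset G := by
  classical
  exact k.2.toFinset.image Prod.fst ∪ k.2.toFinset.image Prod.snd

lemma left_mem_supp {k : FinKernel B} {s t u : G} (h : s * t⁻¹ = u) (hk : k.entry h ≠ 0) :
    s ∈ k.supp := by
  classical
  rw [Ne, entry_eq_zero_iff] at hk
  exact Finset.mem_union_left _
    (Finset.mem_image.2 ⟨(s, t), (Set.Finite.mem_toFinset _).2 hk, rfl⟩)

lemma right_mem_supp {k : FinKernel B} {s t u : G} (h : s * t⁻¹ = u) (hk : k.entry h ≠ 0) :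
    t ∈ k.supp := by
  classical
  rw [Ne, entry_eq_zero_iff] at hk
  exact Finset.mem_union_right _
    (Finset.mem_image.2 ⟨(s, t), (Set.Finite.mem_toFinset _).2 hk, rfl⟩)

lemma entry_left (k : FinKernel B) {s t u : G} (h : s * t⁻¹ = u) (hs : s ∉ k.supp) :
    k.entry h = 0 := by_contra fun hk => hs (left_mem_supp h hk)

lemma supp_subset {k : FinKernel B} {F : Finset G}
    (hF : ∀ s t : G, k.entry (rfl : s * t⁻¹ = _) ≠ 0 → s ∈ F ∧ t ∈ F) : k.supp ⊆ F := by
  classical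
  refine Finset.union_subset ?_ ?_ <;> refine Finset.image_subset_iff.2 fun p hp => ?_
  · exact (hF p.1 p.2 ((Set.Finite.mem_toFinset _).1 hp)).1
  · exact (hF p.1 p.2 ((Set.Finite.mem_toFinset _).1 hp)).2

lemma entry_congr (k : FinKernel B) {s t s' t' u : G} (hs : s = s') (ht : t = t')
    (h : s * t⁻¹ = u) (h' : s' * t'⁻¹ = u) : k.entry h = k.entry h' := by
  subst hs ht; rfl

/-- Build a kernel supported in `F × F`. -/
def mk' (k : ∀ s t : G, B (s * t⁻¹)) (F : Finset G) (hF : ∀ s t, k s t ≠ 0 → s ∈ F ∧ t ∈ F) :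
    FinKernel B :=
  ⟨k, ((F ×ˢ F).finite_toSet).subset fun p hp => by simpa using hF p.1 p.2 hp⟩

/-- The translate `β_r(k)(s,t) = k(sr,tr)`. -/
def shift (r : G) (k : FinKernel B) : FinKernel B := by
  classical
  exact mk' (fun s t => k.entry (s := s * r) (t := t * r) (by group))
    (k.supp.image (· * r⁻¹)) fun s t h => by
      constructor
      · exact Finset.mem_image.2 ⟨s * r, left_mem_supp _ h, by group⟩
      · exact Finset.mem_image.2 ⟨t * r, right_mem_supp _ h, by group⟩

lemma entry_shift (r : G) (k : FinKernel B) {s t u : G} (h : s * t⁻¹ = u)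
    (h' : (s * r) * (t * r)⁻¹ = u) : (shift r k).entry h = k.entry h' := by
  subst h; rfl

end

section

variable {G : Type v} [Group G] {B : G → Type u} [∀ t, NormedAddCommGroup (B t)]
  [∀ t, NormedSpace ℂ (B t)] [FellOps B] [FellBundle B]

lemma mul_aux (r t s : G) : r * t⁻¹ * (t * s⁻¹) = r * s⁻¹ := by group

lemma star_aux (s t : G) : (t * s⁻¹)⁻¹ = s * t⁻¹ := by group

/-- The product `(h * k)(r,s) = ∑ₜ h(r,t) k(t,s)`. -/
instance : Mul (FinKernel B) where
  mul h k := by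
    classical
    exact mk' (fun r s => ∑ᶠ t, FellOps.mul (mul_aux r t s) (h.1 r t) (k.1 t s)) (h.supp ∪ k.supp)
      fun r s hrs => by
        have hex : ∃ t, FellOps.mul (mul_aux r t s) (h.1 r t) (k.1 t s) ≠ 0 := by
          by_contra! hn
          exact hrs ((finsum_congr hn).trans finsum_zero)
        obtain ⟨t, ht⟩ := hex
        have h1 : h.entry (rfl : r * t⁻¹ = _) ≠ 0 := fun h0 => ht (by
          rw [entry_rfl] at h0; rw [h0, zero_mul'])
        have h2 : k.entry (rfl : t * s⁻¹ = _) ≠ 0 := fun h0 => ht (by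
          rw [entry_rfl] at h0; rw [h0, mul_zero'])
        exact ⟨Finset.mem_union_left _ (left_mem_supp _ h1),
          Finset.mem_union_right _ (right_mem_supp _ h2)⟩

/-- The involution `k*(r,s) = k(s,r)*`. -/
instance : Star (FinKernel B) where
  star k := mk' (fun r s => FellOps.inv (star_aux r s) (k.1 s r)) k.supp fun r s hrs => by
    have h1 : k.entry (rfl : s * r⁻¹ = _) ≠ 0 := fun h0 => hrs (by
      rw [entry_rfl] at h0; rw [h0, inv_zero'])
    exact ⟨right_mem_supp _ h1, left_mem_supp _ h1⟩

lemma entry_mul_finsum (h k : FinKernel B) {r s u : G} (hu : r * s⁻¹ = u) :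
    (h * k).entry hu = ∑ᶠ t, FellOps.mul (hu ▸ mul_aux r t s) (h.1 r t) (k.1 t s) := by
  subst hu; rfl

lemma entry_mul (h k : FinKernel B) {r s u : G} (hu : r * s⁻¹ = u) (F : Finset G)
    (hF : h.supp ⊆ F ∨ k.supp ⊆ F) :
    (h * k).entry hu = ∑ t ∈ F, FellOps.mul (hu ▸ mul_aux r t s)
      (h.entry (rfl : r * t⁻¹ = _)) (k.entry (rfl : t * s⁻¹ = _)) := by
  rw [entry_mul_finsum]
  refine finsum_eq_sum_of_support_subset _ fun t ht => ?_
  rcases hF with hF | hF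
  · exact hF (right_mem_supp (rfl : r * t⁻¹ = _) fun h0 => ht (by
      rw [entry_rfl] at h0; simp [h0]))
  · exact hF (left_mem_supp (rfl : t * s⁻¹ = _) fun h0 => ht (by
      rw [entry_rfl] at h0; simp [h0]))

lemma entry_star (k : FinKernel B) {r s u : G} (h : r * s⁻¹ = u) :
    (star k).entry h = FellOps.inv (h ▸ star_aux r s) (k.entry (rfl : s * r⁻¹ = _)) := by
  subst h; rfl

lemma mul_entry_congr (h k : FinKernel B) {r t s r' t' s' a b a' b' u : G} (hr : r = r')
    (ht : t = t') (hs : s = s') (h1 : r * t⁻¹ = a)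
    (h2 : t * s⁻¹ = b) (h1' : r' * t'⁻¹ = a') (h2' : t' * s'⁻¹ = b') (hu : a * b = u)
    (hu' : a' * b' = u) :
    FellOps.mul hu (h.entry h1) (k.entry h2) = FellOps.mul hu' (h.entry h1') (k.entry h2') := by
  subst hr ht hs h1 h2 h1' h2'; rfl

lemma inv_entry_congr (k : FinKernel B) {s t a a' u : G} (h1 : s * t⁻¹ = a)
    (h1' : s * t⁻¹ = a') (hu : a⁻¹ = u) (hu' : a'⁻¹ = u) :
    FellOps.inv hu (k.entry h1) = FellOps.inv hu' (k.entry h1') := by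
  subst h1 h1'; rfl

instance : NonUnitalRing (FinKernel B) where
  left_distrib a b c := by
    classical
    refine ext' fun r s => ?_
    rw [entry_add, entry_mul _ _ _ a.supp (.inl le_rfl), entry_mul _ _ _ a.supp (.inl le_rfl),
      entry_mul _ _ _ a.supp (.inl le_rfl), ← Finset.sum_add_distrib]
    simp [FellBundle.mul_add]
  right_distrib a b c := by
    refine ext' fun r s => ?_
    rw [entry_add, entry_mul _ _ _ c.supp (.inr le_rfl), entry_mul _ _ _ c.supp (.inr le_rfl),
      entry_mul _ _ _ c.supp (.inr le_rfl), ← Finset.sum_add_distrib]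
    simp [FellBundle.add_mul]
  zero_mul a := by
    refine ext' fun r s => ?_
    rw [entry_mul _ _ _ a.supp (.inr le_rfl)]
    simp
  mul_zero a := by
    refine ext' fun r s => ?_
    rw [entry_mul _ _ _ a.supp (.inl le_rfl)]
    simp
  mul_assoc a b c := by
    refine ext' fun r s => ?_
    rw [entry_mul _ _ _ c.supp (.inr le_rfl), entry_mul _ _ _ a.supp (.inl le_rfl)]
    simp_rw [entry_mul a b _ a.supp (.inl le_rfl), entry_mul b c _ c.supp (.inr le_rfl),
      sum_mul, mul_sum]
    rw [Finset.sum_comm]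
    refine Finset.sum_congr rfl fun t _ => Finset.sum_congr rfl fun t' _ => ?_
    exact FellBundle.mul_assoc _ _ _ _ _ _ _

instance : StarRing (FinKernel B) where
  star_involutive k := ext' fun r s => by
    rw [entry_star, entry_star]
    exact FellBundle.inv_inv _ _ _
  star_mul a b := ext' fun r s => by
    rw [entry_star, entry_mul a b _ a.supp (.inl le_rfl),
      entry_mul (star b) (star a) _ a.supp (.inr ?_), inv_sum]
    · refine Finset.sum_congr rfl fun t _ => ?_
      rw [entry_star, entry_star]
      exact FellBundle.inv_mul _ _ _ _ _ _ _
    · refine supp_subset fun x y hxy => ?_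
      rw [entry_star] at hxy
      have h1 : a.entry (rfl : y * x⁻¹ = _) ≠ 0 := fun h0 => hxy (by rw [h0, inv_zero'])
      exact ⟨right_mem_supp _ h1, left_mem_supp _ h1⟩
  star_add a b := ext' fun r s => by
    simp [entry_star, FellBundle.inv_add]

instance : IsScalarTower ℂ (FinKernel B) (FinKernel B) where
  smul_assoc z a b := ext' fun r s => by
    rw [smul_eq_mul, smul_eq_mul, entry_smul, entry_mul _ _ _ b.supp (.inr le_rfl),
      entry_mul _ _ _ b.supp (.inr le_rfl), Finset.smul_sum]
    simp [FellBundle.smul_mul]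

instance : SMulCommClass ℂ (FinKernel B) (FinKernel B) where
  smul_comm z a b := ext' fun r s => by
    rw [smul_eq_mul, smul_eq_mul, entry_smul, entry_mul _ _ _ a.supp (.inl le_rfl),
      entry_mul _ _ _ a.supp (.inl le_rfl), Finset.smul_sum]
    simp [FellBundle.mul_smul]

instance : StarModule ℂ (FinKernel B) where
  star_smul z a := ext' fun r s => by
    simp [entry_star, FellBundle.inv_smul]

variable (B) in
/-- The canonical action `β_t(k)(r,s) = k(rt,st)` on kernels of finite support. -/
def shiftHom : G →* (FinKernel B →⋆ₙₐ[ℂ] FinKernel B) where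
  toFun g :=
    { toFun := shift g
      map_smul' := fun z k => ext' fun r s => by
        simp only [MonoidHom.id_apply, entry_smul, entry_shift g _ _ (show (r * g) * (s * g)⁻¹ = r * s⁻¹ by group)]
      map_zero' := ext' fun r s => by
        rw [entry_shift g _ _ (by group), entry_zero, entry_zero]
      map_add' := fun k l => ext' fun r s => by
        simp only [entry_add, entry_shift g _ _ (show (r * g) * (s * g)⁻¹ = r * s⁻¹ by group)]
      map_mul' := fun k l => by
        classical
        refine ext' fun r s => ?_
        rw [entry_shift g _ _ (show (r * g) * (s * g)⁻¹ = r * s⁻¹ by group),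
          entry_mul _ _ _ k.supp (.inl le_rfl),
          entry_mul _ _ _ (k.supp.map (Equiv.mulRight g⁻¹).toEmbedding) (.inl ?_), Finset.sum_map]
        · refine Finset.sum_congr rfl fun t _ => ?_
          simp only [Equiv.coe_toEmbedding, Equiv.coe_mulRight]
          rw [entry_shift g k _ (show (r * g) * (t * g⁻¹ * g)⁻¹ = r * (t * g⁻¹)⁻¹ by group),
            entry_shift g l _ (show (t * g⁻¹ * g) * (s * g)⁻¹ = t * g⁻¹ * s⁻¹ by group)]
          exact mul_entry_congr _ _ rfl (by group) rfl _ _ _ _ _ _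
        · refine supp_subset fun x y hxy => ?_
          rw [entry_shift g k _ (show (x * g) * (y * g)⁻¹ = x * y⁻¹ by group)] at hxy
          exact ⟨Finset.mem_map.2 ⟨x * g, left_mem_supp _ hxy, by simp⟩,
            Finset.mem_map.2 ⟨y * g, right_mem_supp _ hxy, by simp⟩⟩
      map_star' := fun k => ext' fun r s => by
        rw [entry_shift g _ _ (show (r * g) * (s * g)⁻¹ = r * s⁻¹ by group), entry_star, entry_star,
          entry_shift g k _ (show (s * g) * (r * g)⁻¹ = s * r⁻¹ by group)]
        exact inv_entry_congr _ _ _ _ _ }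
  map_one' := NonUnitalStarAlgHom.ext fun k => ext' fun r s => by
    change (shift 1 k).entry rfl = k.entry rfl
    rw [entry_shift 1 k _ (by group)]
    exact entry_congr _ (by group) (by group) _ _
  map_mul' g g' := NonUnitalStarAlgHom.ext fun k => ext' fun r s => by
    change (shift (g * g') k).entry rfl = (shift g (shift g' k)).entry rfl
    rw [entry_shift (g * g') k _ (by group),
      entry_shift g _ _ (show (r * g) * (s * g)⁻¹ = r * s⁻¹ by group),
      entry_shift g' _ _ (show (r * g * g') * (s * g * g')⁻¹ = r * s⁻¹ by group)]
    exact entry_congr _ (by group) (by group) _ _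

end

end FinKernel

/-! ### Biduals: Arens products -/

section Arens

variable {X Y Z : Type*} [NormedAddCommGroup X] [NormedSpace ℂ X] [NormedAddCommGroup Y]
  [NormedSpace ℂ Y] [NormedAddCommGroup Z] [NormedSpace ℂ Z]

/-- For `m : X × Y → Z` bounded bilinear and `Ψ ∈ Y''`, the map `Z' → X'`,
`φ ↦ (x ↦ Ψ(φ(m(x, ·))))`. -/
def arensAux (m : X →L[ℂ] Y →L[ℂ] Z) (Ψ : StrongDual ℂ (StrongDual ℂ Y)) :
    StrongDual ℂ Z →L[ℂ] StrongDual ℂ X :=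
  (ContinuousLinearMap.compL ℂ X (StrongDual ℂ Y) ℂ Ψ).comp
    (((ContinuousLinearMap.compL ℂ X (Y →L[ℂ] Z) (StrongDual ℂ Y)).flip m).comp
      (ContinuousLinearMap.compL ℂ Y Z ℂ))

lemma arensAux_apply (m : X →L[ℂ] Y →L[ℂ] Z) (Ψ : StrongDual ℂ (StrongDual ℂ Y))
    (φ : StrongDual ℂ Z) (x : X) : arensAux m Ψ φ x = Ψ (φ.comp (m x)) := rfl

/-- The Arens extension `X'' × Y'' → Z''` of a bounded bilinear map `m : X × Y → Z`:
`(Φ Ψ)(φ) = Φ(x ↦ Ψ(y ↦ φ(m(x,y))))`. -/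
def arens (m : X →L[ℂ] Y →L[ℂ] Z) (Φ : StrongDual ℂ (StrongDual ℂ X))
    (Ψ : StrongDual ℂ (StrongDual ℂ Y)) : StrongDual ℂ (StrongDual ℂ Z) :=
  Φ.comp (arensAux m Ψ)

/-- For `σ : X → Y` bounded and conjugate-linear, the map `Y' → X'`, `φ ↦ (x ↦ conj φ(σ x))`. -/
def conjDual (σ : X →L⋆[ℂ] Y) (φ : StrongDual ℂ Y) : StrongDual ℂ X :=
  ((starL ℂ : ℂ ≃L⋆[ℂ] ℂ) : ℂ →L⋆[ℂ] ℂ).comp (φ.comp σ)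

@[simp] lemma conjDual_apply (σ : X →L⋆[ℂ] Y) (φ : StrongDual ℂ Y) (x : X) :
    conjDual σ φ x = conj (φ (σ x)) := rfl

/-- `conjDual` as a bounded conjugate-linear map. -/
def conjDualL (σ : X →L⋆[ℂ] Y) : StrongDual ℂ Y →L⋆[ℂ] StrongDual ℂ X :=
  LinearMap.mkContinuous
    { toFun := conjDual σ
      map_add' := fun φ ψ => by ext x; simp
      map_smul' := fun z φ => by ext x; simp } ‖σ‖ fun φ => by
    refine ContinuousLinearMap.opNorm_le_bound _ (by positivity) fun x => ?_
    simp only [LinearMap.coe_mk, AddHom.coe_mk, conjDual_apply, RCLike.norm_conj]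
    calc ‖φ (σ x)‖ ≤ ‖φ‖ * ‖σ x‖ := φ.le_opNorm _
      _ ≤ ‖φ‖ * (‖σ‖ * ‖x‖) := by gcongr; exact σ.le_opNorm _
      _ = ‖σ‖ * ‖φ‖ * ‖x‖ := by ring

@[simp] lemma conjDualL_apply (σ : X →L⋆[ℂ] Y) (φ : StrongDual ℂ Y) (x : X) :
    conjDualL σ φ x = conj (φ (σ x)) := rfl

/-- The weak*-continuous extension `X'' → Y''` of a bounded conjugate-linear map `σ : X → Y`:
`(Φ^σ)(φ) = conj Φ(x ↦ conj φ(σ x))`. -/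
def bidualInv (σ : X →L⋆[ℂ] Y) (Φ : StrongDual ℂ (StrongDual ℂ X)) :
    StrongDual ℂ (StrongDual ℂ Y) := conjDual (conjDualL σ) Φ

end Arens

/-! ### The enveloping W*-algebra (bidual) of a C*-algebra -/

section EnvelopingWStar

/-- The bidual `A''` of a C*-algebra, with the weak* topology. -/
def EnvelopingWStar (A : Type*) [NonUnitalCStarAlgebra A] : Type _ := WeakDual ℂ (StrongDual ℂ A)

namespace EnvelopingWStar

variable {A : Type*} [NonUnitalCStarAlgebra A]

instance : AddCommGroup (EnvelopingWStar A) :=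
  inferInstanceAs (AddCommGroup (WeakDual ℂ (StrongDual ℂ A)))
instance : Module ℂ (EnvelopingWStar A) :=
  inferInstanceAs (Module ℂ (WeakDual ℂ (StrongDual ℂ A)))
instance : TopologicalSpace (EnvelopingWStar A) :=
  inferInstanceAs (TopologicalSpace (WeakDual ℂ (StrongDual ℂ A)))

/-- The identification of `A''` with the Banach space bidual. -/
def toBidual : EnvelopingWStar A ≃ₗ[ℂ] StrongDual ℂ (StrongDual ℂ A) := WeakDual.toStrongDual

@[ext] lemma ext {x y : EnvelopingWStar A} (h : ∀ φ, toBidual x φ = toBidual y φ) : x = y :=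
  toBidual.injective (ContinuousLinearMap.ext h)

/-- The product of `A''` is the Arens product. -/
instance : Mul (EnvelopingWStar A) :=
  ⟨fun x y => toBidual.symm (arens (ContinuousLinearMap.mul ℂ A) (toBidual x) (toBidual y))⟩

/-- The involution of `A''` is the weak*-continuous extension of that of `A`. -/
instance : Star (EnvelopingWStar A) :=
  ⟨fun x => toBidual.symm (bidualInv ((starL ℂ : A ≃L⋆[ℂ] A) : A →L⋆[ℂ] A) (toBidual x))⟩

lemma mul_apply (x y : EnvelopingWStar A) (φ : StrongDual ℂ A) :
    toBidual (x * y) φ = toBidual x (arensAux (ContinuousLinearMap.mul ℂ A) (toBidual y) φ) := rfl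

lemma star_apply (x : EnvelopingWStar A) (φ : StrongDual ℂ A) :
    toBidual (star x) φ =
      conj (toBidual x (conjDualL ((starL ℂ : A ≃L⋆[ℂ] A) : A →L⋆[ℂ] A) φ)) := rfl

instance : NonUnitalRing (EnvelopingWStar A) where
  left_distrib x y z := by
    ext φ
    rw [map_add, add_apply, mul_apply, mul_apply, mul_apply, ← map_add]
    rfl
  right_distrib x y z := by ext φ; simp [mul_apply]
  zero_mul x := by ext φ; simp [mul_apply]
  mul_zero x := by
    ext φ
    have : arensAux (ContinuousLinearMap.mul ℂ A) (0 : StrongDual ℂ (StrongDual ℂ A)) φ = 0 := by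
      ext a; simp [arensAux_apply]
    simp [mul_apply, this]
  mul_assoc x y z := by
    ext φ
    simp only [mul_apply]
    congr 1
    ext a
    simp only [arensAux_apply, mul_apply]
    congr 1
    ext b
    simp only [arensAux_apply, ContinuousLinearMap.comp_apply]
    congr 1
    ext c
    simp [mul_assoc]

/-- A *-endomorphism of a C*-algebra as a bounded operator. -/
def homCLM (α : A →⋆ₙₐ[ℂ] A) : A →L[ℂ] A :=
  LinearMap.mkContinuous { toFun := α, map_add' := map_add α, map_smul' := map_smul α } 1
    fun a => by simpa using NonUnitalStarAlgHom.norm_apply_le α a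

@[simp] lemma homCLM_apply (α : A →⋆ₙₐ[ℂ] A) (a : A) : homCLM α a = α a := rfl

/-- The bidual (weak*-continuous extension) `α''` of a *-endomorphism `α` of `A`. -/
def map (α : A →⋆ₙₐ[ℂ] A) : EnvelopingWStar A →⋆ₙₐ[ℂ] EnvelopingWStar A where
  toFun x := toBidual.symm
    ((toBidual x).comp ((ContinuousLinearMap.compL ℂ A A ℂ).flip (homCLM α)))
  map_smul' z x := by ext φ; simp
  map_zero' := by ext φ; simp
  map_add' x y := by ext φ; simp
  map_mul' x y := by
    ext φ
    simp only [mul_apply, LinearEquiv.apply_symm_apply, ContinuousLinearMap.comp_apply]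
    congr 1
    ext a
    simp only [arensAux_apply, ContinuousLinearMap.comp_apply, ContinuousLinearMap.flip_apply,
      ContinuousLinearMap.compL_apply, homCLM_apply]
    congr 1
    ext b
    simp
  map_star' x := by
    ext φ
    simp only [star_apply, LinearEquiv.apply_symm_apply, ContinuousLinearMap.comp_apply]
    congr 2
    ext a
    simp [map_star]

lemma map_apply (α : A →⋆ₙₐ[ℂ] A) (x : EnvelopingWStar A) (φ : StrongDual ℂ A) :
    toBidual (map α x) φ = toBidual x (φ.comp (homCLM α)) := rfl

/-- The bidual `α''` of an action `α` of a group on a C*-algebra. -/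
def bidualAction {G : Type*} [Group G] (α : G →* (A →⋆ₙₐ[ℂ] A)) :
    G →* (EnvelopingWStar A →⋆ₙₐ[ℂ] EnvelopingWStar A) where
  toFun g := map (α g)
  map_one' := by
    rw [map_one]
    refine NonUnitalStarAlgHom.ext fun x => ext fun φ => ?_
    rw [map_apply]; rfl
  map_mul' g h := by
    rw [map_mul]
    refine NonUnitalStarAlgHom.ext fun x => ext fun φ => ?_
    rw [map_apply]; rfl

end EnvelopingWStar

end EnvelopingWStar

/-! ### The C*-algebra of kernels -/

section MaxSeminorm

variable {A : Type*} [NonUnitalRing A] [StarRing A] [Module ℂ A]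

/-- The C*-seminorms on a *-algebra `A` that are dominated by `N`. -/
def cstarSeminorms (N : A → ℝ) : Set (Seminorm ℂ A) :=
  {p | (∀ a b, p (a * b) ≤ p a * p b) ∧ (∀ a, p (star a * a) = p a ^ 2) ∧ ∀ a, p a ≤ N a}

/-- The greatest C*-seminorm dominated by `N`. -/
def maxCStarSeminorm (N : A → ℝ) : Seminorm ℂ A := sSup (cstarSeminorms N)

lemma maxCStarSeminorm_apply (N : A → ℝ) (a : A) :
    maxCStarSeminorm N a = ⨆ p : cstarSeminorms N, (p : Seminorm ℂ A) a := by
  have hb : BddAbove (cstarSeminorms N) := by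
    rw [Seminorm.bddAbove_iff]
    refine ⟨N, ?_⟩
    rintro _ ⟨p, hp, rfl⟩ a
    exact hp.2.2 a
  rw [maxCStarSeminorm, Seminorm.coe_sSup_eq hb, iSup_apply]

lemma bddAbove_cstarSeminorms (N : A → ℝ) (a : A) :
    BddAbove (Set.range fun p : cstarSeminorms N => (p : Seminorm ℂ A) a) :=
  ⟨N a, by rintro _ ⟨p, rfl⟩; exact p.2.2.2 a⟩

lemma le_maxCStarSeminorm {N : A → ℝ} {p : Seminorm ℂ A} (hp : p ∈ cstarSeminorms N) (a : A) :
    p a ≤ maxCStarSeminorm N a := by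
  rw [maxCStarSeminorm_apply]
  exact le_ciSup (bddAbove_cstarSeminorms N a) ⟨p, hp⟩

lemma maxCStarSeminorm_le {N : A → ℝ} {a : A} {c : ℝ} (hc : 0 ≤ c)
    (h : ∀ p ∈ cstarSeminorms N, p a ≤ c) : maxCStarSeminorm N a ≤ c := by
  rw [maxCStarSeminorm_apply]
  exact Real.iSup_le (fun p => h p p.2) hc

lemma maxCStarSeminorm_mul_le (N : A → ℝ) (a b : A) :
    maxCStarSeminorm N (a * b) ≤ maxCStarSeminorm N a * maxCStarSeminorm N b :=
  maxCStarSeminorm_le (by positivity) fun p hp => (hp.1 a b).trans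
    (mul_le_mul (le_maxCStarSeminorm hp a) (le_maxCStarSeminorm hp b) (apply_nonneg p b)
      (apply_nonneg _ a))

lemma maxCStarSeminorm_star_le (N : A → ℝ) (a : A) :
    maxCStarSeminorm N (star a) ≤ maxCStarSeminorm N a := by
  refine maxCStarSeminorm_le (by positivity) fun p hp => le_trans ?_ (le_maxCStarSeminorm hp a)
  have h1 := hp.2.1 (star a)
  have h2 := hp.1 (star (star a)) (star a)
  rw [h1, star_star] at h2
  have h3 := apply_nonneg p (star a)
  have h4 := apply_nonneg p a
  by_contra! h
  nlinarith

lemma sq_maxCStarSeminorm_le (N : A → ℝ) (a : A) :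
    maxCStarSeminorm N a * maxCStarSeminorm N a ≤ maxCStarSeminorm N (star a * a) := by
  have : maxCStarSeminorm N a ≤ Real.sqrt (maxCStarSeminorm N (star a * a)) := by
    refine maxCStarSeminorm_le (by positivity) fun p hp => Real.le_sqrt_of_sq_le ?_
    rw [← hp.2.1 a]
    exact le_maxCStarSeminorm hp _
  calc _ ≤ Real.sqrt (maxCStarSeminorm N (star a * a)) *
        Real.sqrt (maxCStarSeminorm N (star a * a)) := by
          gcongr
    _ = _ := Real.mul_self_sqrt (by positivity)

end MaxSeminorm

namespace FinKernel

section

variable {G : Type v} [Group G] {B : G → Type u} [∀ t, NormedAddCommGroup (B t)]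
  [∀ t, NormedSpace ℂ (B t)]

/-- `‖k‖₂ = (∑ ‖k(s,t)‖²)^{1/2}`. -/
def norm2 (k : FinKernel B) : ℝ := Real.sqrt (∑ᶠ p : G × G, ‖k.1 p.1 p.2‖ ^ 2)

lemma norm_entry (k : FinKernel B) {s t u : G} (h : s * t⁻¹ = u) : ‖k.entry h‖ = ‖k.1 s t‖ := by
  subst h; rfl

lemma norm2_shift (g : G) (k : FinKernel B) : norm2 (shift g k) = norm2 k := by
  unfold norm2
  congr 1
  rw [← finsum_comp_equiv ((Equiv.mulRight g).prodCongr (Equiv.mulRight g))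
    (f := fun p : G × G => ‖k.1 p.1 p.2‖ ^ 2)]
  refine finsum_congr fun p => ?_
  have h := norm_entry (shift g k) (rfl : p.1 * p.2⁻¹ = _)
  rw [entry_shift g k _ (show (p.1 * g) * (p.2 * g)⁻¹ = p.1 * p.2⁻¹ by group), norm_entry] at h
  exact congrArg (· ^ 2) h.symm

end

variable {G : Type v} [Group G] {B : G → Type u} [∀ t, NormedAddCommGroup (B t)]
  [∀ t, NormedSpace ℂ (B t)] [FellOps B] [FellBundle B]

variable (B) in
/-- The universal C*-seminorm on kernels of finite support: the restriction of the norm of the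
enveloping C*-algebra of the completion for `‖·‖₂`. -/
def univSeminorm : Seminorm ℂ (FinKernel B) := maxCStarSeminorm norm2

instance : SeminormedAddCommGroup (FinKernel B) :=
  (univSeminorm B).toAddGroupSeminorm.toSeminormedAddCommGroup

lemma norm_def (k : FinKernel B) : ‖k‖ = univSeminorm B k := rfl

instance : NormedSpace ℂ (FinKernel B) where
  norm_smul_le z k := by rw [norm_def, norm_def, map_smul_eq_mul]

lemma norm_mul_le' (k l : FinKernel B) : ‖k * l‖ ≤ ‖k‖ * ‖l‖ := maxCStarSeminorm_mul_le _ k l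

lemma norm_star_le' (k : FinKernel B) : ‖star k‖ ≤ ‖k‖ := maxCStarSeminorm_star_le _ k

lemma norm_sq_le' (k : FinKernel B) : ‖k‖ * ‖k‖ ≤ ‖star k * k‖ := sq_maxCStarSeminorm_le _ k

lemma norm_shiftHom_le (g : G) (k : FinKernel B) : ‖shiftHom B g k‖ ≤ ‖k‖ := by
  refine maxCStarSeminorm_le (norm_nonneg k) fun p hp => ?_
  let q : Seminorm ℂ (FinKernel B) := p.comp
    ({ toFun := shiftHom B g
       map_add' := map_add _
       map_smul' := fun z k => map_smul (shiftHom B g) z k } :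
      FinKernel B →ₗ[ℂ] FinKernel B)
  have hq : q ∈ cstarSeminorms norm2 := by
    refine ⟨fun a b => ?_, fun a => ?_, fun a => ?_⟩
    · change p (shiftHom B g (a * b)) ≤ _
      rw [map_mul]; exact hp.1 _ _
    · change p (shiftHom B g (star a * a)) = _
      rw [map_mul, map_star]; exact hp.2.1 _
    · exact (hp.2.2 _).trans (norm2_shift g a).le
  exact le_maxCStarSeminorm hq k

lemma continuous_mul' : Continuous fun p : FinKernel B × FinKernel B => p.1 * p.2 := by
  let m : FinKernel B →L[ℂ] FinKernel B →L[ℂ] FinKernel B :=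
    LinearMap.mkContinuous₂ (LinearMap.mul ℂ (FinKernel B)) 1 fun a b => by
      simpa using norm_mul_le' a b
  exact m.continuous₂

lemma lipschitz_star : LipschitzWith 1 (star : FinKernel B → FinKernel B) :=
  LipschitzWith.of_dist_le_mul fun a b => by
    rw [dist_eq_norm, dist_eq_norm, ← star_sub]; simpa using norm_star_le' (a - b)

lemma lipschitz_shiftHom (g : G) : LipschitzWith 1 (shiftHom B g) :=
  LipschitzWith.of_dist_le_mul fun a b => by
    rw [dist_eq_norm, dist_eq_norm, ← map_sub]; simpa using norm_shiftHom_le g (a - b)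

end FinKernel

section KernelAlgebra

open UniformSpace FinKernel

variable {G : Type v} [Group G] (B : G → Type u) [∀ t, NormedAddCommGroup (B t)]
  [∀ t, NormedSpace ℂ (B t)] [FellOps B] [FellBundle B]

/-- The C*-algebra of kernels `𝕜(B)`: the (Hausdorff) completion of the *-algebra of kernels of
finite support for the universal C*-seminorm. -/
def KernelAlgebra : Type (max u v) := Completion (FinKernel B)

namespace KernelAlgebra

instance : NormedAddCommGroup (KernelAlgebra B) :=
  inferInstanceAs (NormedAddCommGroup (Completion (FinKernel B)))
instance : NormedSpace ℂ (KernelAlgebra B) :=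
  inferInstanceAs (NormedSpace ℂ (Completion (FinKernel B)))
instance : CompleteSpace (KernelAlgebra B) :=
  inferInstanceAs (CompleteSpace (Completion (FinKernel B)))

variable {B}

/-- The canonical map of kernels of finite support into `𝕜(B)`. -/
def of (k : FinKernel B) : KernelAlgebra B := (k : Completion (FinKernel B))

lemma of_add (k l : FinKernel B) : of (k + l) = of k + of l := Completion.coe_add k l
lemma of_zero : of (0 : FinKernel B) = 0 := rfl
lemma of_smul (z : ℂ) (k : FinKernel B) : of (z • k) = z • of k := Completion.coe_smul z k
lemma norm_of (k : FinKernel B) : ‖of k‖ = ‖k‖ := Completion.norm_coe k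

lemma continuous_of : Continuous (of : FinKernel B → KernelAlgebra B) :=
  Completion.continuous_coe _

lemma ind {p : KernelAlgebra B → Prop} (a : KernelAlgebra B) (hp : IsClosed {a | p a})
    (ih : ∀ k, p (of k)) : p a := Completion.induction_on a hp ih

lemma ind₂ {p : KernelAlgebra B → KernelAlgebra B → Prop} (a b : KernelAlgebra B)
    (hp : IsClosed {x : KernelAlgebra B × KernelAlgebra B | p x.1 x.2})
    (ih : ∀ k l, p (of k) (of l)) : p a b := Completion.induction_on₂ a b hp ih

lemma ind₃ {p : KernelAlgebra B → KernelAlgebra B → KernelAlgebra B → Prop}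
    (a b c : KernelAlgebra B)
    (hp : IsClosed {x : KernelAlgebra B × KernelAlgebra B × KernelAlgebra B | p x.1 x.2.1 x.2.2})
    (ih : ∀ k l m, p (of k) (of l) (of m)) : p a b c := Completion.induction_on₃ a b c hp ih

instance : Mul (KernelAlgebra B) :=
  ⟨Function.curry <| ((Completion.isDenseInducing_coe (α := FinKernel B)).prodMap
    (Completion.isDenseInducing_coe (α := FinKernel B))).extend
      (of ∘ Function.uncurry (· * ·))⟩

instance : Star (KernelAlgebra B) := ⟨Completion.map (star : FinKernel B → FinKernel B)⟩

lemma of_mul (k l : FinKernel B) : of (k * l) = of k * of l :=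
  ((Completion.isDenseInducing_coe.prodMap Completion.isDenseInducing_coe).extend_eq
      (continuous_of.comp continuous_mul') (k, l)).symm

lemma of_star (k : FinKernel B) : of (star k) = star (of k) :=
  (Completion.map_coe lipschitz_star.uniformContinuous k).symm

instance : ContinuousMul (KernelAlgebra B) where
  continuous_mul := by
    let m := (AddMonoidHom.mul : FinKernel B →+ FinKernel B →+ FinKernel B).compr₂
      Completion.toCompl
    have : Continuous fun p : FinKernel B × FinKernel B => m p.1 p.2 :=
      (Completion.continuous_coe (FinKernel B)).comp continuous_mul'
    have di : IsDenseInducing (Completion.toCompl : FinKernel B → Completion (FinKernel B)) :=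
      Completion.isDenseInducing_coe
    exact (di.extend_Z_bilin di this :)

instance : ContinuousStar (KernelAlgebra B) where
  continuous_star := Completion.continuous_map

lemma continuous_smul' (z : ℂ) : Continuous fun a : KernelAlgebra B => z • a :=
  continuous_const_smul z

lemma smul_mul' (z : ℂ) (a b : KernelAlgebra B) : z • a * b = z • (a * b) := by
  induction a, b using ind₂ with
  | hp =>
    exact isClosed_eq (((continuous_smul' z).comp continuous_fst).mul continuous_snd)
      ((continuous_smul' z).comp continuous_mul)
  | ih a b => simp only [← of_smul, ← of_mul, smul_mul_assoc]

lemma mul_smul' (z : ℂ) (a b : KernelAlgebra B) : a * z • b = z • (a * b) := by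
  induction a, b using ind₂ with
  | hp =>
    exact isClosed_eq (continuous_fst.mul ((continuous_smul' z).comp continuous_snd))
      ((continuous_smul' z).comp continuous_mul)
  | ih a b => simp only [← of_smul, ← of_mul, mul_smul_comm]

instance : NonUnitalCStarAlgebra (KernelAlgebra B) where
  __ := (inferInstance : NormedAddCommGroup (KernelAlgebra B))
  __ := (inferInstance : NormedSpace ℂ (KernelAlgebra B))
  dist_eq := dist_eq_norm_neg_add
  left_distrib a b c := by
    induction a, b, c using ind₃ with
    | hp => exact isClosed_eq (by fun_prop) (by fun_prop)
    | ih a b c => simp only [← of_add, ← of_mul, mul_add]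
  right_distrib a b c := by
    induction a, b, c using ind₃ with
    | hp => exact isClosed_eq (by fun_prop) (by fun_prop)
    | ih a b c => simp only [← of_add, ← of_mul, add_mul]
  zero_mul a := by
    induction a using ind with
    | hp => exact isClosed_eq (by fun_prop) (by fun_prop)
    | ih a => rw [← of_zero, ← of_mul, zero_mul]
  mul_zero a := by
    induction a using ind with
    | hp => exact isClosed_eq (by fun_prop) (by fun_prop)
    | ih a => rw [← of_zero, ← of_mul, mul_zero]
  mul_assoc a b c := by
    induction a, b, c using ind₃ with
    | hp => exact isClosed_eq (by fun_prop) (by fun_prop)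
    | ih a b c => simp only [← of_mul, mul_assoc]
  norm_mul_le a b := by
    induction a, b using ind₂ with
    | hp => exact isClosed_le (by fun_prop) (by fun_prop)
    | ih a b => simpa only [← of_mul, norm_of] using norm_mul_le' a b
  star_involutive a := by
    induction a using ind with
    | hp => exact isClosed_eq (by fun_prop) (by fun_prop)
    | ih a => simp only [← of_star, star_star]
  star_mul a b := by
    induction a, b using ind₂ with
    | hp => exact isClosed_eq (by fun_prop) (by fun_prop)
    | ih a b => simp only [← of_star, ← of_mul, star_mul]
  star_add a b := by
    induction a, b using ind₂ with
    | hp => exact isClosed_eq (by fun_prop) (by fun_prop)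
    | ih a b => simp only [← of_star, ← of_add, star_add]
  complete := (inferInstance : CompleteSpace (KernelAlgebra B)).complete
  norm_mul_self_le a := by
    induction a using ind with
    | hp => exact isClosed_le (by fun_prop) (by fun_prop)
    | ih a => simpa only [← of_star, ← of_mul, norm_of] using norm_sq_le' a
  smul_assoc := smul_mul'
  smul_comm z a b := (mul_smul' z a b).symm
  star_smul z a := by
    induction a using ind with
    | hp =>
      exact isClosed_eq (continuous_star.comp (continuous_smul' z))
        ((continuous_smul' (star z)).comp continuous_star)
    | ih a => simp only [← of_star, ← of_smul, star_smul]

/-- The extension to `𝕜(B)` of the translation of kernels. -/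
def shift (g : G) : KernelAlgebra B → KernelAlgebra B := Completion.map (shiftHom B g)

@[fun_prop] lemma continuous_shift (g : G) : Continuous (shift (B := B) g) :=
  Completion.continuous_map

lemma shift_of (g : G) (k : FinKernel B) : shift g (of k) = of (shiftHom B g k) :=
  Completion.map_coe (lipschitz_shiftHom (B := B) g).uniformContinuous k

variable (B) in
/-- The canonical action `β` of `G` on `𝕜(B)`, extending `β_t(k)(r,s) = k(rt,st)`. -/
def canonicalAction : G →* (KernelAlgebra B →⋆ₙₐ[ℂ] KernelAlgebra B) where
  toFun g :=
    { toFun := shift g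
      map_smul' := fun z a => by
        simp only [MonoidHom.id_apply]
        induction a using ind with
        | hp =>
          exact isClosed_eq ((continuous_shift g).comp (continuous_smul' z))
            ((continuous_smul' z).comp (continuous_shift g))
        | ih a => simp only [← of_smul, shift_of, map_smul]
      map_zero' := by rw [← of_zero, shift_of, map_zero]
      map_add' := fun a b => by
        induction a, b using ind₂ with
        | hp => exact isClosed_eq (by fun_prop) (by fun_prop)
        | ih a b => simp only [← of_add, shift_of, map_add]
      map_mul' := fun a b => by
        induction a, b using ind₂ with
        | hp => exact isClosed_eq (by fun_prop) (by fun_prop)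
        | ih a b => simp only [← of_mul, shift_of, map_mul]
      map_star' := fun a => by
        induction a using ind with
        | hp => exact isClosed_eq (by fun_prop) (by fun_prop)
        | ih a => simp only [← of_star, shift_of, map_star] }
  map_one' := NonUnitalStarAlgHom.ext fun a => by
    change shift 1 a = a
    induction a using ind with
    | hp => exact isClosed_eq (by fun_prop) (by fun_prop)
    | ih a => simp only [shift_of, map_one, NonUnitalStarAlgHom.one_apply]
  map_mul' g h := NonUnitalStarAlgHom.ext fun a => by
    change shift (g * h) a = shift g (shift h a)
    induction a using ind with
    | hp => exact isClosed_eq (by fun_prop) (by fun_prop)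
    | ih a => simp only [shift_of, map_mul]; rfl

end KernelAlgebra

end KernelAlgebra

/-! ### W*-Fell bundles -/

section WStarFellBundle

variable {G : Type v} [Group G] (M : G → Type u) [∀ t, NormedAddCommGroup (M t)]
  [∀ t, NormedSpace ℂ (M t)]

/-- Each fibre `M t` is (isometrically isomorphic to) the dual of a Banach space `Pre t`. -/
class FibrePredual where
  Pre : G → Type u
  [instNormed : ∀ t, NormedAddCommGroup (Pre t)]
  [instSpace : ∀ t, NormedSpace ℂ (Pre t)]
  [instComplete : ∀ t, CompleteSpace (Pre t)]
  toDual : ∀ t, M t ≃ₗᵢ[ℂ] StrongDual ℂ (Pre t)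

attribute [reducible, instance] FibrePredual.instNormed FibrePredual.instSpace
attribute [instance] FibrePredual.instComplete

open FibrePredual

/-- The weak* topology of the fibre `M t`. -/
@[reducible] def weakStar [FibrePredual M] (t : G) : TopologicalSpace (M t) :=
  TopologicalSpace.induced (fun (x : M t) (p : Pre M t) => toDual t x p) Pi.topologicalSpace

/-- A W*-Fell bundle: a Fell bundle whose fibres are dual Banach spaces, such that the involution
and the left multiplications are weak*-continuous between fibres. -/
class WStarFellBundle [FellOps M] [FibrePredual M] : Prop extends FellBundle M where
  continuous_inv : ∀ {s t : G} (h : s⁻¹ = t),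
    Continuous[weakStar M s, weakStar M t] (FellOps.inv h : M s → M t)
  continuous_mul : ∀ {s t u : G} (h : s * t = u) (a : M s),
    Continuous[weakStar M t, weakStar M u] (FellOps.mul h a : M t → M u)

end WStarFellBundle

/-! ### The bidual bundle -/

section Bidual

variable {G : Type v} [Group G] (B : G → Type u) [∀ t, NormedAddCommGroup (B t)]
  [∀ t, NormedSpace ℂ (B t)]

/-- The bundle of biduals `B'' = {B_t''}`. -/
def Bidual (t : G) : Type u := StrongDual ℂ (StrongDual ℂ (B t))

instance (t : G) : NormedAddCommGroup (Bidual B t) :=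
  inferInstanceAs (NormedAddCommGroup (StrongDual ℂ (StrongDual ℂ (B t))))
instance (t : G) : NormedSpace ℂ (Bidual B t) :=
  inferInstanceAs (NormedSpace ℂ (StrongDual ℂ (StrongDual ℂ (B t))))

/-- The multiplication and the involution of `B''` are the (separately) weak*-continuous extensions
of those of `B`. -/
instance [FellOps B] [FellBundle B] : FellOps (Bidual B) where
  mul h := arens (mulL h)
  inv h := bidualInv (invL h)

instance : FibrePredual (Bidual B) where
  Pre t := StrongDual ℂ (B t)
  toDual t := LinearIsometryEquiv.refl ℂ (StrongDual ℂ (StrongDual ℂ (B t)))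

end Bidual

/-! ### Finite inner products of sections -/

section FiniteInner

variable {G : Type v} [Group G] {M : G → Type u} [∀ t, NormedAddCommGroup (M t)]
  [∀ t, NormedSpace ℂ (M t)] [FellOps M] [FellBundle M]

/-- `ξ(t)* η(t)`, as an element of the unit fibre. -/
def ip (ξ η : ∀ t, M t) (t : G) : UnitFibre M :=
  FellOps.mul (B := M) (inv_mul_cancel t) (FellOps.inv (B := M) rfl (ξ t)) (η t)

/-- `∑_{t ∈ F} ξ(t)* η(t)`. -/
def fip (F : Finset G) (ξ η : ∀ t, M t) : UnitFibre M := ∑ t ∈ F, ip ξ η t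

variable (ξ ξ' η η' : ∀ t, M t) (t : G) (F : Finset G)

lemma ip_add_right : ip ξ (η + η') t = ip ξ η t + ip ξ η' t := FellBundle.mul_add (B := M) _ _ _ _
lemma ip_sub_right : ip ξ (η - η') t = ip ξ η t - ip ξ η' t := mul_sub' (B := M) _ _ _ _
lemma ip_smul_right (z : ℂ) : ip ξ (z • η) t = z • ip ξ η t := FellBundle.mul_smul (B := M) _ _ _ _
lemma star_ip : star (ip ξ η t) = ip η ξ t := by
  have h : (t⁻¹)⁻¹ = t := _root_.inv_inv t
  have h1 := FellBundle.inv_mul (B := M) (inv_mul_cancel t) h rfl (inv_one (G := G))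
    (inv_mul_cancel t) (FellOps.inv (B := M) rfl (ξ t)) (η t)
  rw [FellBundle.inv_inv (B := M) rfl h (ξ t)] at h1
  exact h1
lemma ip_add_left : ip (ξ + ξ') η t = ip ξ η t + ip ξ' η t := by
  rw [← star_ip, ip_add_right, star_add, star_ip, star_ip]
lemma ip_sub_left : ip (ξ - ξ') η t = ip ξ η t - ip ξ' η t := by
  rw [← star_ip, ip_sub_right, star_sub, star_ip, star_ip]
lemma ip_smul_left (z : ℂ) : ip (z • ξ) η t = conj z • ip ξ η t := by
  rw [← star_ip, ip_smul_right, star_smul, star_ip]; rfl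
lemma norm_ip_self : ‖ip ξ ξ t‖ = ‖ξ t‖ ^ 2 := FellBundle.norm_inv_mul_self (B := M) _ _ _
lemma ip_zero_right (h : η t = 0) : ip ξ η t = 0 := by
  unfold ip; rw [h]; exact mul_zero' (B := M) _ _
lemma ip_zero_left (h : ξ t = 0) : ip ξ η t = 0 := by
  rw [← star_ip, ip_zero_right _ _ _ h, star_zero]

/-- The right action of the unit fibre on sections. -/
def rsmul (ξ : ∀ t, M t) (c : UnitFibre M) : ∀ t, M t := fun t => FellOps.mul (B := M) (mul_one t) (ξ t) c

lemma ip_rsmul_right (c : UnitFibre M) : ip ξ (rsmul η c) t = ip ξ η t * c :=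
  (FellBundle.mul_assoc (B := M) _ _ _ _ _ _ _).symm
lemma ip_rsmul_left (c : UnitFibre M) : ip (rsmul ξ c) η t = star c * ip ξ η t := by
  rw [← star_ip, ip_rsmul_right, star_mul, star_ip]

lemma ip_self_eq : ∃ c : UnitFibre M, ip ξ ξ t = star c * c :=
  FellBundle.inv_mul_self_pos (B := M) _ _ _

lemma star_fip : star (fip F ξ η) = fip F η ξ := by
  simp only [fip, star_sum, star_ip]

lemma norm_fip_sq_le : ‖fip F ξ η‖ ^ 2 ≤ ‖fip F ξ ξ‖ * ‖fip F η η‖ := by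
  let _ : PartialOrder (UnitFibre M) := CStarAlgebra.spectralOrder (UnitFibre M)
  have : StarOrderedRing (UnitFibre M) := CStarAlgebra.spectralOrderedRing (UnitFibre M)
  set a := fip F ξ ξ
  set b := fip F η η
  set c := fip F ξ η
  have key : ∀ N : ℝ, ‖a‖ < N → ‖c‖ ^ 2 ≤ N * ‖b‖ := by
    intro N hN
    have hN0 : 0 < N := (norm_nonneg a).trans_lt hN
    have hz : 0 ≤ fip F (rsmul ξ c - (N : ℂ) • η) (rsmul ξ c - (N : ℂ) • η) := by
      refine Finset.sum_nonneg fun t _ => ?_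
      obtain ⟨d, hd⟩ := ip_self_eq (rsmul ξ c - (N : ℂ) • η) t
      rw [hd]; exact star_mul_self_nonneg d
    have hexp : fip F (rsmul ξ c - (N : ℂ) • η) (rsmul ξ c - (N : ℂ) • η) =
        star c * a * c - (N : ℂ) • (star c * c) - (N : ℂ) • (star c * c) +
          (N : ℂ) • (N : ℂ) • b := by
      have h1 : star c * a * c = ∑ t ∈ F, star c * ip ξ ξ t * c := by
        rw [← Finset.sum_mul, ← Finset.mul_sum]; rfl
      have h2 : star c * c = ∑ t ∈ F, star c * ip ξ η t := by
        rw [← Finset.mul_sum]; rfl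
      have h3 : star c * c = ∑ t ∈ F, ip η ξ t * c := by
        rw [← Finset.sum_mul, star_fip]; rfl
      have h4 : b = ∑ t ∈ F, ip η η t := rfl
      rw [h1]
      nth_rewrite 1 [h2]
      rw [h3, h4, Finset.smul_sum, Finset.smul_sum, Finset.smul_sum, Finset.smul_sum,
        ← Finset.sum_sub_distrib, ← Finset.sum_sub_distrib, ← Finset.sum_add_distrib]
      refine Finset.sum_congr rfl fun t _ => ?_
      rw [ip_sub_right, ip_sub_left, ip_sub_left, ip_smul_right, ip_smul_right, ip_smul_left,
        ip_smul_left, ip_rsmul_right, ip_rsmul_right, ip_rsmul_left, ip_rsmul_left,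
        Complex.conj_ofReal]
      abel
    have hsa : IsSelfAdjoint a := star_fip ξ ξ F
    have h5 : star c * a * c ≤ ‖a‖ • (star c * c) := CStarAlgebra.star_left_conjugate_le_norm_smul
    have h6 : ‖a‖ • (star c * c) ≤ N • (star c * c) :=
      smul_le_smul_of_nonneg_right hN.le (star_mul_self_nonneg c)
    have h7 : N • (star c * c) ≤ N • N • b := by
      rw [hexp] at hz
      simp only [Complex.coe_smul] at hz
      have h8 := h5.trans h6
      have h9 : 0 ≤ N • (star c * c) - N • (star c * c) - N • (star c * c) + N • N • b :=
        hz.trans (by gcongr)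
      rw [sub_self, zero_sub, neg_add_eq_sub] at h9
      exact sub_nonneg.1 h9
    have h8 : 0 ≤ N • (star c * c) := smul_nonneg hN0.le (star_mul_self_nonneg c)
    have h9 := CStarAlgebra.norm_le_norm_of_nonneg_of_le h8 h7
    rw [norm_smul, norm_smul, norm_smul, Real.norm_of_nonneg hN0.le,
      CStarRing.norm_star_mul_self] at h9
    have := le_of_mul_le_mul_left h9 hN0
    rwa [← sq] at this
  refine le_of_forall_pos_le_add fun ε hε => ?_
  have hb := norm_nonneg b
  have h := key (‖a‖ + ε / (‖b‖ + 1)) (by linarith [show 0 < ε / (‖b‖ + 1) by positivity])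
  have h' : ε / (‖b‖ + 1) * ‖b‖ ≤ ε := by
    rw [div_mul_eq_mul_div, div_le_iff₀ (by positivity)]
    nlinarith
  nlinarith

lemma norm_fip_le : ‖fip F ξ η‖ ≤ √‖fip F ξ ξ‖ * √‖fip F η η‖ := by
  rw [← Real.sqrt_mul (norm_nonneg _)]
  exact Real.le_sqrt_of_sq_le (norm_fip_sq_le ξ η F)

lemma sqrt_fip_add_le : √‖fip F (ξ + η) (ξ + η)‖ ≤ √‖fip F ξ ξ‖ + √‖fip F η η‖ := by
  rw [Real.sqrt_le_left (by positivity)]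
  have h : fip F (ξ + η) (ξ + η) = fip F ξ ξ + fip F ξ η + (fip F η ξ + fip F η η) := by
    simp only [fip, ← Finset.sum_add_distrib]
    exact Finset.sum_congr rfl fun t _ => by
      rw [ip_add_right, ip_add_left, ip_add_left]; abel
  have h1 := norm_fip_le ξ η F
  have h2 := norm_fip_le η ξ F
  have h3 := Real.sq_sqrt (norm_nonneg (fip F ξ ξ))
  have h4 := Real.sq_sqrt (norm_nonneg (fip F η η))
  rw [h]
  calc _ ≤ ‖fip F ξ ξ‖ + ‖fip F ξ η‖ + (‖fip F η ξ‖ + ‖fip F η η‖) :=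
        (norm_add_le _ _).trans (add_le_add (norm_add_le _ _) (norm_add_le _ _))
    _ ≤ _ := by nlinarith

lemma fip_smul (z : ℂ) : fip F (z • ξ) (z • ξ) = (conj z * z) • fip F ξ ξ := by
  simp only [fip, Finset.smul_sum]
  exact Finset.sum_congr rfl fun t _ => by rw [ip_smul_right, ip_smul_left, smul_smul, mul_comm]

lemma norm_fip_smul (z : ℂ) : ‖fip F (z • ξ) (z • ξ)‖ = ‖z‖ ^ 2 * ‖fip F ξ ξ‖ := by
  rw [fip_smul, norm_smul, norm_mul, RCLike.norm_conj, sq]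

end FiniteInner

/-! ### The module `ℓ²_{w*}(M)` -/

section Ell2

variable {G : Type v} [Group G] (M : G → Type u) [∀ t, NormedAddCommGroup (M t)]
  [∀ t, NormedSpace ℂ (M t)] [FellOps M] [FellBundle M]

/-- The sections `ξ` for which the finite sums `∑_{t ∈ F} ξ(t)* ξ(t)` are bounded. -/
def ell2Submodule : Submodule ℂ (∀ t, M t) where
  carrier := {ξ | ∃ C : ℝ, ∀ F : Finset G, ‖fip F ξ ξ‖ ≤ C}
  zero_mem' := ⟨0, fun F => by
    rw [fip, Finset.sum_eq_zero fun t _ => ip_zero_right _ _ _ rfl, norm_zero]⟩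
  add_mem' := by
    rintro ξ η ⟨C, hC⟩ ⟨D, hD⟩
    refine ⟨(√C + √D) ^ 2, fun F => ?_⟩
    rw [← Real.sqrt_le_left (by positivity)]
    exact (sqrt_fip_add_le ξ η F).trans
      (add_le_add (Real.sqrt_le_sqrt (hC F)) (Real.sqrt_le_sqrt (hD F)))
  smul_mem' := by
    rintro z ξ ⟨C, hC⟩
    refine ⟨‖z‖ ^ 2 * C, fun F => ?_⟩
    rw [norm_fip_smul]
    gcongr
    exact hC F

/-- The space `ℓ²_{w*}(M)`. -/
def Ell2 : Type (max u v) := ell2Submodule M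

namespace Ell2

instance : AddCommGroup (Ell2 M) := inferInstanceAs (AddCommGroup (ell2Submodule M))
instance : Module ℂ (Ell2 M) := inferInstanceAs (Module ℂ (ell2Submodule M))

variable {M}

/-- The underlying section. -/
def val (ξ : Ell2 M) : ∀ t, M t := ξ.1

lemma val_add (ξ η : Ell2 M) : (ξ + η).val = ξ.val + η.val := rfl
lemma val_smul (z : ℂ) (ξ : Ell2 M) : (z • ξ).val = z • ξ.val := rfl
lemma ext' {ξ η : Ell2 M} (h : ∀ t, ξ.val t = η.val t) : ξ = η := Subtype.ext (funext h)

/-- `‖ξ‖ = sup_F ‖∑_{t ∈ F} ξ(t)* ξ(t)‖^{1/2}`. -/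
instance : Norm (Ell2 M) := ⟨fun ξ => √(⨆ F : Finset G, ‖fip F ξ.val ξ.val‖)⟩

lemma norm_def (ξ : Ell2 M) : ‖ξ‖ = √(⨆ F : Finset G, ‖fip F ξ.val ξ.val‖) := rfl

lemma bdd (ξ : Ell2 M) : BddAbove (Set.range fun F : Finset G => ‖fip F ξ.val ξ.val‖) := by
  obtain ⟨C, hC⟩ := ξ.2
  exact ⟨C, by rintro _ ⟨F, rfl⟩; exact hC F⟩

lemma sqrt_fip_le (ξ : Ell2 M) (F : Finset G) : √‖fip F ξ.val ξ.val‖ ≤ ‖ξ‖ :=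
  Real.sqrt_le_sqrt (le_ciSup ξ.bdd F)

lemma norm_le {ξ : Ell2 M} {C : ℝ} (hC : 0 ≤ C) (h : ∀ F, √‖fip F ξ.val ξ.val‖ ≤ C) :
    ‖ξ‖ ≤ C := by
  rw [norm_def, Real.sqrt_le_left hC]
  exact ciSup_le fun F => (Real.sqrt_le_left hC).1 (h F)

lemma norm_val_le (ξ : Ell2 M) (t : G) : ‖ξ.val t‖ ≤ ‖ξ‖ := by
  have := sqrt_fip_le ξ {t}
  rwa [fip, Finset.sum_singleton, norm_ip_self, Real.sqrt_sq (norm_nonneg _)] at this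

lemma normedSpaceCore : NormedSpace.Core ℂ (Ell2 M) where
  norm_nonneg ξ := Real.sqrt_nonneg _
  norm_smul z ξ := by
    have : ∀ (z : ℂ) (ξ : Ell2 M), ‖z • ξ‖ ≤ ‖z‖ * ‖ξ‖ := fun z ξ => by
      refine norm_le (mul_nonneg (norm_nonneg z) (Real.sqrt_nonneg _)) fun F => ?_
      rw [val_smul, norm_fip_smul, Real.sqrt_mul (by positivity), Real.sqrt_sq (norm_nonneg _)]
      gcongr
      exact sqrt_fip_le ξ F
    refine le_antisymm (this z ξ) ?_
    rcases eq_or_ne z 0 with rfl | hz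
    · rw [norm_zero, zero_mul]; exact Real.sqrt_nonneg _
    · have h := this z⁻¹ (z • ξ)
      rw [smul_smul, inv_mul_cancel₀ hz, one_smul, _root_.norm_inv] at h
      rwa [le_inv_mul_iff₀ (norm_pos_iff.2 hz)] at h
  norm_triangle ξ η := norm_le (add_nonneg (Real.sqrt_nonneg _) (Real.sqrt_nonneg _)) fun F =>
    (sqrt_fip_add_le ξ.val η.val F).trans (add_le_add (sqrt_fip_le ξ F) (sqrt_fip_le η F))
  norm_eq_zero_iff ξ := by
    constructor
    · intro h
      refine ext' fun t => ?_
      have := norm_val_le ξ t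
      rw [h] at this
      exact norm_le_zero_iff.1 this
    · rintro rfl
      refine le_antisymm (norm_le le_rfl fun F => ?_) (Real.sqrt_nonneg _)
      rw [fip, Finset.sum_eq_zero fun t _ => ip_zero_right _ _ _ rfl]
      simp

instance : NormedAddCommGroup (Ell2 M) := NormedAddCommGroup.ofCore normedSpaceCore
instance : NormedSpace ℂ (Ell2 M) := NormedSpace.ofCore normedSpaceCore

/-- A section of finite support. -/
def ofFinset (x : ∀ t, M t) (F : Finset G) (hF : ∀ t, t ∉ F → x t = 0) : Ell2 M :=
  ⟨x, ∑ t ∈ F, ‖x t‖ ^ 2, fun F' => by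
    classical
    calc ‖fip F' x x‖ ≤ ∑ t ∈ F', ‖ip x x t‖ := norm_sum_le _ _
      _ = ∑ t ∈ F', ‖x t‖ ^ 2 := Finset.sum_congr rfl fun t _ => norm_ip_self x t
      _ = ∑ t ∈ F' ∩ F, ‖x t‖ ^ 2 := (Finset.sum_subset Finset.inter_subset_left
          fun t ht hn => by
            have : t ∉ F := fun h => hn (Finset.mem_inter.2 ⟨ht, h⟩)
            rw [hF t this, norm_zero]; simp).symm
      _ ≤ _ := Finset.sum_le_sum_of_subset_of_nonneg Finset.inter_subset_right
          fun t _ _ => by positivity⟩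

lemma val_ofFinset (x : ∀ t, M t) (F : Finset G) (hF : ∀ t, t ∉ F → x t = 0) :
    (ofFinset x F hF).val = x := rfl

lemma norm_ofFinset_le (x : ∀ t, M t) (F : Finset G) (hF : ∀ t, t ∉ F → x t = 0) :
    ‖ofFinset x F hF‖ ≤ ∑ t ∈ F, ‖x t‖ := by
  classical
  refine norm_le (by positivity) fun F' => ?_
  rw [Real.sqrt_le_left (by positivity), val_ofFinset]
  calc ‖fip F' x x‖ ≤ ∑ t ∈ F', ‖ip x x t‖ := norm_sum_le _ _
      _ = ∑ t ∈ F', ‖x t‖ ^ 2 := Finset.sum_congr rfl fun t _ => norm_ip_self x t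
      _ = ∑ t ∈ F' ∩ F, ‖x t‖ ^ 2 := (Finset.sum_subset Finset.inter_subset_left
          fun t ht hn => by
            have : t ∉ F := fun h => hn (Finset.mem_inter.2 ⟨ht, h⟩)
            rw [hF t this, norm_zero]; simp).symm
      _ ≤ ∑ t ∈ F, ‖x t‖ ^ 2 := Finset.sum_le_sum_of_subset_of_nonneg Finset.inter_subset_right
          fun t _ _ => by positivity
      _ ≤ _ := Finset.sum_sq_le_sq_sum_of_nonneg fun t _ => norm_nonneg _

end Ell2

end Ell2

open FibrePredual

/-! ### The inner product of `ℓ²_{w*}(M)` -/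

section Inner

variable {G : Type v} [Group G] {M : G → Type u} [∀ t, NormedAddCommGroup (M t)]
  [∀ t, NormedSpace ℂ (M t)] [FibrePredual M]

/-- The pairing of the unit fibre with its predual. -/
def pair (x : UnitFibre M) (p : Pre M 1) : ℂ := toDual (M := M) 1 x p

variable [FellOps M] [FellBundle M]

lemma pair_add_left (x y : UnitFibre M) (p : Pre M 1) : pair (x + y) p = pair x p + pair y p := by
  have := map_add (toDual (M := M) 1) x y
  exact congrArg (fun f => f p) this
lemma pair_smul_left (z : ℂ) (x : UnitFibre M) (p : Pre M 1) : pair (z • x) p = z * pair x p := by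
  have := map_smul (toDual (M := M) 1) z x
  exact congrArg (fun f => f p) this
lemma pair_zero_left (p : Pre M 1) : pair (0 : UnitFibre M) p = 0 := by
  have := map_zero (toDual (M := M) 1)
  exact congrArg (fun f => f p) this
lemma pair_add_right (x : UnitFibre M) (p q : Pre M 1) : pair x (p + q) = pair x p + pair x q :=
  map_add (toDual (M := M) 1 x) p q
lemma pair_smul_right (z : ℂ) (x : UnitFibre M) (p : Pre M 1) : pair x (z • p) = z * pair x p :=
  map_smul (toDual (M := M) 1 x) z p
lemma norm_pair_le (x : UnitFibre M) (p : Pre M 1) : ‖pair x p‖ ≤ ‖x‖ * ‖p‖ := by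
  have h := (toDual (M := M) 1 x).le_opNorm p
  rwa [(toDual (M := M) 1).norm_map x] at h
lemma pair_sum {ι : Type*} (F : Finset ι) (x : ι → UnitFibre M) (p : Pre M 1) :
    pair (∑ i ∈ F, x i) p = ∑ i ∈ F, pair (x i) p :=
  map_sum (⟨⟨fun x => pair x p, pair_zero_left p⟩, fun x y => pair_add_left x y p⟩ :
    UnitFibre M →+ ℂ) x F
lemma pair_ext {x y : UnitFibre M} (h : ∀ p : Pre M 1, pair x p = pair y p) : x = y :=
  (toDual (M := M) 1).injective (ContinuousLinearMap.ext h)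

lemma exists_pair_eq (f : Pre M 1 → ℂ) (hadd : ∀ p q, f (p + q) = f p + f q)
    (hsmul : ∀ (z : ℂ) p, f (z • p) = z * f p) (C : ℝ) (hC : ∀ p, ‖f p‖ ≤ C * ‖p‖) :
    ∃ x : UnitFibre M, ∀ p, pair x p = f p :=
  ⟨(toDual (M := M) 1).symm (LinearMap.mkContinuous ⟨⟨f, hadd⟩, hsmul⟩ C hC), fun p => by
    unfold pair
    rw [LinearIsometryEquiv.apply_symm_apply]; rfl⟩

namespace Ell2

lemma sum_norm_pair_le (ξ η : Ell2 M) (p : Pre M 1) (F : Finset G) :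
    ∑ t ∈ F, ‖pair (ip ξ.val η.val t) p‖ ≤ ‖ξ‖ * ‖η‖ * ‖p‖ := by
  have hc : ∀ t, ∃ c : ℂ, ‖c‖ = 1 ∧ (‖pair (ip ξ.val η.val t) p‖ : ℂ) =
      c * pair (ip ξ.val η.val t) p := fun t => RCLike.exists_norm_eq_mul_self _
  choose c hc1 hc2 using hc
  let y : ∀ t, M t := fun t => c t • η.val t
  have h1 : ∀ t, ip ξ.val y t = c t • ip ξ.val η.val t := fun t =>
    FellBundle.mul_smul (B := M) _ _ _ _
  have h2 : fip F y y = fip F η.val η.val := by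
    refine Finset.sum_congr rfl fun t _ => ?_
    have h3 : ip y y t = c t • ip y η.val t := FellBundle.mul_smul (B := M) _ _ _ _
    have h4 : ip η.val y t = c t • ip η.val η.val t := FellBundle.mul_smul (B := M) _ _ _ _
    rw [h3, ← star_ip, h4, star_smul, star_ip, smul_smul]
    have : c t * star (c t) = 1 := by
      have := RCLike.mul_conj (c t)
      rw [hc1] at this
      simpa using this
    rw [this, one_smul]
  have h3 : (∑ t ∈ F, ‖pair (ip ξ.val η.val t) p‖ : ℂ) = pair (fip F ξ.val y) p := by
    rw [fip, pair_sum]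
    refine Finset.sum_congr rfl fun t _ => ?_
    rw [h1, pair_smul_left, hc2]
  have h4 : ‖(∑ t ∈ F, ‖pair (ip ξ.val η.val t) p‖ : ℂ)‖ =
      ∑ t ∈ F, ‖pair (ip ξ.val η.val t) p‖ := by
    rw [← Complex.ofReal_sum, Complex.norm_real, Real.norm_of_nonneg]
    exact Finset.sum_nonneg fun t _ => norm_nonneg _
  rw [← h4, h3]
  refine (norm_pair_le _ _).trans ?_
  gcongr
  refine (norm_fip_le _ _ F).trans ?_
  rw [h2]
  exact mul_le_mul (sqrt_fip_le ξ F) (sqrt_fip_le η F) (Real.sqrt_nonneg _) (norm_nonneg ξ)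

lemma summable_pair (ξ η : Ell2 M) (p : Pre M 1) :
    Summable fun t => pair (ip ξ.val η.val t) p :=
  Summable.of_norm (summable_of_sum_le (fun _ => norm_nonneg _) (sum_norm_pair_le ξ η p))

lemma norm_tsum_pair_le (ξ η : Ell2 M) (p : Pre M 1) :
    ‖∑' t, pair (ip ξ.val η.val t) p‖ ≤ ‖ξ‖ * ‖η‖ * ‖p‖ :=
  (norm_tsum_le_tsum_norm (summable_of_sum_le (fun _ => norm_nonneg _)
    (sum_norm_pair_le ξ η p))).trans
      ((summable_of_sum_le (fun _ => norm_nonneg _) (sum_norm_pair_le ξ η p)).tsum_le_of_sum_le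
        (sum_norm_pair_le ξ η p))

lemma exists_inner (ξ η : Ell2 M) :
    ∃ x : UnitFibre M, ∀ p, pair x p = ∑' t, pair (ip ξ.val η.val t) p :=
  exists_pair_eq _ (fun p q => by
      simp only [pair_add_right]; exact (summable_pair ξ η p).tsum_add (summable_pair ξ η q))
    (fun z p => by simp only [pair_smul_right]; exact tsum_mul_left)
    (‖ξ‖ * ‖η‖) (norm_tsum_pair_le ξ η)

/-- The inner product `⟨ξ, η⟩ = ∑ₜ ξ(t)* η(t)`, a weak*-convergent sum in the unit fibre. -/
def inner (ξ η : Ell2 M) : UnitFibre M := (exists_inner ξ η).choose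

lemma pair_inner (ξ η : Ell2 M) (p : Pre M 1) :
    pair (inner ξ η) p = ∑' t, pair (ip ξ.val η.val t) p := (exists_inner ξ η).choose_spec p

lemma norm_pair_inner_le (ξ η : Ell2 M) (p : Pre M 1) :
    ‖pair (inner ξ η) p‖ ≤ ‖ξ‖ * ‖η‖ * ‖p‖ := by
  rw [pair_inner]; exact norm_tsum_pair_le ξ η p

lemma inner_add_right (ξ η η' : Ell2 M) : inner ξ (η + η') = inner ξ η + inner ξ η' :=
  pair_ext fun p => by
    rw [pair_add_left, pair_inner, pair_inner, pair_inner, val_add]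
    simp only [ip_add_right, pair_add_left]
    exact (summable_pair ξ η p).tsum_add (summable_pair ξ η' p)

lemma inner_add_left (ξ ξ' η : Ell2 M) : inner (ξ + ξ') η = inner ξ η + inner ξ' η :=
  pair_ext fun p => by
    rw [pair_add_left, pair_inner, pair_inner, pair_inner, val_add]
    simp only [ip_add_left, pair_add_left]
    exact (summable_pair ξ η p).tsum_add (summable_pair ξ' η p)

lemma inner_smul_right (z : ℂ) (ξ η : Ell2 M) : inner ξ (z • η) = z • inner ξ η :=
  pair_ext fun p => by
    rw [pair_smul_left, pair_inner, pair_inner, val_smul]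
    simp only [ip_smul_right, pair_smul_left]
    exact tsum_mul_left

lemma inner_smul_left (z : ℂ) (ξ η : Ell2 M) : inner (z • ξ) η = conj z • inner ξ η :=
  pair_ext fun p => by
    rw [pair_smul_left, pair_inner, pair_inner, val_smul]
    simp only [ip_smul_left, pair_smul_left]
    exact tsum_mul_left

lemma inner_sub_right (ξ η η' : Ell2 M) : inner ξ (η - η') = inner ξ η - inner ξ η' := by
  rw [eq_sub_iff_add_eq, ← inner_add_right, sub_add_cancel]

lemma inner_eq_fip (ξ η : Ell2 M) (F : Finset G) (h : ∀ t, t ∉ F → ip ξ.val η.val t = 0) :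
    inner ξ η = fip F ξ.val η.val := pair_ext fun p => by
  rw [pair_inner, fip, pair_sum]
  exact tsum_eq_sum fun t ht => by rw [h t ht, pair_zero_left]

lemma ext_inner {η η' : Ell2 M} (h : ∀ ξ, inner ξ η = inner ξ η') : η = η' := by
  classical
  rw [← sub_eq_zero]
  refine ext' fun t => ?_
  set ζ := η - η'
  have h0 : ∀ s, s ∉ ({t} : Finset G) → (Pi.single t (ζ.val t) : ∀ t, M t) s = 0 := fun s hs =>
    Pi.single_eq_of_ne (by simpa using hs) _
  have h1 : inner (ofFinset _ {t} h0) ζ = 0 := by rw [inner_sub_right, h, sub_self]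
  rw [inner_eq_fip _ _ {t} fun s hs => ip_zero_left (ofFinset _ {t} h0).val _ _ (h0 s hs), fip,
    Finset.sum_singleton] at h1
  have h2 : ip (ofFinset _ {t} h0).val ζ.val t = ip ζ.val ζ.val t := by
    unfold ip
    rw [val_ofFinset, Pi.single_eq_same]
  rw [h2] at h1
  have h3 := norm_ip_self ζ.val t
  rw [h1, norm_zero] at h3
  exact norm_eq_zero.1 (pow_eq_zero_iff two_ne_zero |>.1 h3.symm)

end Ell2

end Inner

section StarInner

variable {G : Type v} [Group G] {M : G → Type u} [∀ t, NormedAddCommGroup (M t)]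
  [∀ t, NormedSpace ℂ (M t)] [FellOps M] [FibrePredual M] [WStarFellBundle M]

lemma exists_pair_star (p : Pre M 1) :
    ∃ q : Pre M 1, ‖q‖ ≤ ‖p‖ ∧ ∀ x : UnitFibre M, pair (star x) p = conj (pair x q) := by
  let τ : TopologicalSpace (UnitFibre M) := weakStar M 1
  let f : Pre M 1 → (UnitFibre M →ₗ[ℂ] ℂ) := fun q =>
    ⟨⟨fun x => pair x q, fun x y => pair_add_left x y q⟩, fun z x => pair_smul_left z x q⟩
  let φ : UnitFibre M →ₗ[ℂ] ℂ :=
    ⟨⟨fun x => conj (pair (star x) p), fun x y => by rw [star_add, pair_add_left, map_add]⟩,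
      fun z x => by
        change conj (pair (star (z • x)) p) = z * conj (pair (star x) p)
        rw [star_smul, pair_smul_left, map_mul]
        simp⟩
  have hf : ∀ q, @Continuous _ _ τ _ (fun x : UnitFibre M => pair x q) := fun q =>
    (continuous_apply q).comp continuous_induced_dom
  have hφ : @Continuous _ _ τ _ φ :=
    Complex.continuous_conj.comp ((hf p).comp
      (WStarFellBundle.continuous_inv (M := M) (inv_one (G := G))))
  have hτ : τ = ⨅ q, TopologicalSpace.induced (f q) inferInstance := by
    change TopologicalSpace.induced _ Pi.topologicalSpace = _
    rw [induced_to_pi]; rfl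
  have hmem : φ ∈ Submodule.span ℂ (Set.range f) := by
    rw [LinearMap.mem_span_iff_continuous, ← hτ]
    exact hφ
  have hrange : ∃ q, f q = φ := by
    refine Submodule.span_induction (p := fun ψ _ => ∃ q, f q = ψ) (fun ψ h => h)
      ⟨0, LinearMap.ext fun x => ?_⟩ ?_ ?_ hmem
    · change pair x 0 = 0
      simpa using pair_smul_right 0 x (0 : Pre M 1)
    · rintro _ _ _ _ ⟨q, rfl⟩ ⟨q', rfl⟩
      exact ⟨q + q', LinearMap.ext fun x => pair_add_right x q q'⟩
    · rintro z _ _ ⟨q, rfl⟩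
      exact ⟨z • q, LinearMap.ext fun x => pair_smul_right z x q⟩
  obtain ⟨q, hq⟩ := hrange
  have hq' : ∀ x, pair x q = conj (pair (star x) p) := fun x => congrArg (fun g => g x) hq
  refine ⟨q, ?_, fun x => by rw [hq', RingHomCompTriple.comp_apply]; rfl⟩
  refine NormedSpace.norm_le_dual_bound ℂ q (norm_nonneg p) fun g => ?_
  have key : ∀ x : UnitFibre M, ‖pair x q‖ ≤ ‖p‖ * ‖x‖ := fun x => by
    rw [hq', RCLike.norm_conj]
    refine (norm_pair_le _ _).trans ?_
    rw [norm_star, mul_comm]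
  obtain ⟨x, rfl⟩ := (toDual (M := M) 1).surjective g
  rw [(toDual (M := M) 1).norm_map x]
  exact key x

namespace Ell2

lemma star_inner (ξ η : Ell2 M) : star (inner ξ η) = inner η ξ := pair_ext fun p => by
  obtain ⟨q, -, hq⟩ := exists_pair_star p
  rw [hq, pair_inner, pair_inner]
  rw [Complex.conj_tsum]
  refine tsum_congr fun t => ?_
  rw [← hq, star_ip]

end Ell2

end StarInner

/-! ### The W*-algebra `ℓ^∞(G, 𝕃(ℓ²_{w*}(M)))` -/

section EllInfty

variable {G : Type v} [Group G] (M : G → Type u) [∀ t, NormedAddCommGroup (M t)]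
  [∀ t, NormedSpace ℂ (M t)] [FellOps M] [FibrePredual M] [WStarFellBundle M]

/-- The bounded families `(f_t)` of adjointable operators on `ℓ²_{w*}(M)`. (The family of
adjoints of a bounded family is automatically bounded.) -/
def ellInftySub : Subalgebra ℂ (G → (Ell2 M →L[ℂ] Ell2 M)) where
  carrier := {f | ∃ g : G → (Ell2 M →L[ℂ] Ell2 M), (∃ C : ℝ, ∀ t, ‖f t‖ ≤ C ∧ ‖g t‖ ≤ C) ∧
    ∀ t ξ η, Ell2.inner (f t ξ) η = Ell2.inner ξ (g t η)}
  mul_mem' := by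
    rintro a b ⟨a', ⟨C, hC⟩, ha⟩ ⟨b', ⟨D, hD⟩, hb⟩
    refine ⟨b' * a', ⟨max C D * max C D, fun t => ⟨?_, ?_⟩⟩, fun t ξ η => ?_⟩
    · exact (norm_mul_le (a t) (b t)).trans (mul_le_mul ((hC t).1.trans (le_max_left _ _))
        ((hD t).1.trans (le_max_right _ _)) (norm_nonneg _)
        ((norm_nonneg _).trans ((hC t).1.trans (le_max_left _ _))))
    · exact (norm_mul_le (b' t) (a' t)).trans (mul_le_mul ((hD t).2.trans (le_max_right _ _))
        ((hC t).2.trans (le_max_left _ _)) (norm_nonneg _)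
        ((norm_nonneg _).trans ((hC t).1.trans (le_max_left _ _))))
    · exact (ha t _ η).trans (hb t ξ _)
  add_mem' := by
    rintro a b ⟨a', ⟨C, hC⟩, ha⟩ ⟨b', ⟨D, hD⟩, hb⟩
    refine ⟨a' + b', ⟨C + D, fun t => ⟨?_, ?_⟩⟩, fun t ξ η => ?_⟩
    · exact (norm_add_le (a t) (b t)).trans (add_le_add (hC t).1 (hD t).1)
    · exact (norm_add_le (a' t) (b' t)).trans (add_le_add (hC t).2 (hD t).2)
    · change Ell2.inner (a t ξ + b t ξ) η = Ell2.inner ξ (a' t η + b' t η)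
      rw [Ell2.inner_add_left, Ell2.inner_add_right, ha, hb]
  algebraMap_mem' z := by
    refine ⟨fun _ => conj z • 1, ⟨‖(z • 1 : Ell2 M →L[ℂ] Ell2 M)‖ +
      ‖(conj z • 1 : Ell2 M →L[ℂ] Ell2 M)‖, fun t => ⟨?_, ?_⟩⟩, fun t ξ η => ?_⟩
    · rw [Pi.algebraMap_apply, Algebra.algebraMap_eq_smul_one]
      exact le_add_of_nonneg_right (norm_nonneg _)
    · exact le_add_of_nonneg_left (norm_nonneg _)
    · rw [Pi.algebraMap_apply, Algebra.algebraMap_eq_smul_one]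
      change Ell2.inner (z • ξ) η = Ell2.inner ξ (conj z • η)
      rw [Ell2.inner_smul_left, Ell2.inner_smul_right]

/-- The W*-algebra `ℓ^∞(G, 𝕃(ℓ²_{w*}(M)))`. -/
def EllInfty : Type (max u v) := ellInftySub M

namespace EllInfty

instance : Ring (EllInfty M) := inferInstanceAs (Ring (ellInftySub M))
instance : Algebra ℂ (EllInfty M) := inferInstanceAs (Algebra ℂ (ellInftySub M))

variable {M}

/-- The operator `f(t)`. -/
def app (f : EllInfty M) (t : G) : Ell2 M →L[ℂ] Ell2 M := f.1 t

lemma ext' {f g : EllInfty M} (h : ∀ t ξ, f.app t ξ = g.app t ξ) : f = g :=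
  Subtype.ext (funext fun t => ContinuousLinearMap.ext (h t))

lemma app_add (f g : EllInfty M) (t : G) (ξ : Ell2 M) :
    (f + g).app t ξ = f.app t ξ + g.app t ξ := rfl
lemma app_mul (f g : EllInfty M) (t : G) (ξ : Ell2 M) :
    (f * g).app t ξ = f.app t (g.app t ξ) := rfl
lemma app_smul (z : ℂ) (f : EllInfty M) (t : G) (ξ : Ell2 M) :
    (z • f).app t ξ = z • f.app t ξ := rfl

/-- The involution of `ℓ^∞(G, 𝕃(ℓ²_{w*}(M)))` is given by pointwise adjoints. -/
instance : Star (EllInfty M) := ⟨fun f => ⟨f.2.choose, f.1,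
  ⟨f.2.choose_spec.1.choose, fun t => (f.2.choose_spec.1.choose_spec t).symm⟩, fun t ξ η => by
    rw [← Ell2.star_inner, ← f.2.choose_spec.2, Ell2.star_inner]⟩⟩

lemma inner_app (f : EllInfty M) (t : G) (ξ η : Ell2 M) :
    Ell2.inner (f.app t ξ) η = Ell2.inner ξ ((star f).app t η) := f.2.choose_spec.2 t ξ η

lemma eq_star {f g : EllInfty M}
    (h : ∀ t ξ η, Ell2.inner (f.app t ξ) η = Ell2.inner ξ (g.app t η)) : g = star f :=
  ext' fun t η => Ell2.ext_inner fun ξ => by rw [← h, inner_app]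

lemma exists_bound (f : EllInfty M) : ∃ C : ℝ, ∀ t ξ, ‖f.app t ξ‖ ≤ C * ‖ξ‖ := by
  obtain ⟨g, ⟨C, hC⟩, -⟩ := f.2
  exact ⟨C, fun t ξ => ContinuousLinearMap.le_of_opNorm_le _ (hC t).1 ξ⟩

instance : StarRing (EllInfty M) where
  star_involutive f := (eq_star fun t ξ η => by
    rw [← Ell2.star_inner, ← inner_app, Ell2.star_inner]).symm
  star_mul f g := (eq_star fun t ξ η => by rw [app_mul, app_mul, inner_app, inner_app]).symm
  star_add f g := (eq_star fun t ξ η => by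
    rw [app_add, app_add, Ell2.inner_add_left, Ell2.inner_add_right, inner_app, inner_app]).symm

instance : StarModule ℂ (EllInfty M) where
  star_smul z f := (eq_star fun t ξ η => by
    rw [app_smul, app_smul, Ell2.inner_smul_left, Ell2.inner_smul_right, inner_app]; rfl).symm

variable (M) in
/-- The data of an element `∑ₙ pₙ(⟨xₙ, f(tₙ) yₙ⟩)` of the predual. -/
structure PredualElt where
  t : ℕ → G
  x : ℕ → Ell2 M
  y : ℕ → Ell2 M
  p : ℕ → Pre M 1
  summable : Summable fun n => ‖x n‖ * ‖y n‖ * ‖p n‖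

/-- The value of an element of the predual. -/
def eval (f : EllInfty M) (ω : PredualElt M) : ℂ :=
  ∑' n, pair (Ell2.inner (ω.x n) (f.app (ω.t n) (ω.y n))) (ω.p n)

/-- The weak* topology of `ℓ^∞(G, 𝕃(ℓ²_{w*}(M)))`. -/
instance : TopologicalSpace (EllInfty M) :=
  TopologicalSpace.induced (eval : EllInfty M → PredualElt M → ℂ) Pi.topologicalSpace

lemma summable_eval (f : EllInfty M) (ω : PredualElt M) :
    Summable fun n => pair (Ell2.inner (ω.x n) (f.app (ω.t n) (ω.y n))) (ω.p n) := by
  obtain ⟨C, hC⟩ := f.exists_bound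
  refine Summable.of_norm_bounded (ω.summable.mul_left C) fun n => ?_
  refine (Ell2.norm_pair_inner_le _ _ _).trans ?_
  calc _ ≤ ‖ω.x n‖ * (C * ‖ω.y n‖) * ‖ω.p n‖ := by gcongr; exact hC _ _
    _ = _ := by ring

lemma eval_add (f g : EllInfty M) (ω : PredualElt M) : eval (f + g) ω = eval f ω + eval g ω := by
  unfold eval
  simp only [app_add, Ell2.inner_add_right, pair_add_left]
  exact (summable_eval f ω).tsum_add (summable_eval g ω)

lemma eval_smul (z : ℂ) (f : EllInfty M) (ω : PredualElt M) : eval (z • f) ω = z * eval f ω := by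
  unfold eval
  simp only [app_smul, Ell2.inner_smul_right, pair_smul_left]
  exact tsum_mul_left

lemma exists_eval_mul_right (a : EllInfty M) (ω : PredualElt M) :
    ∃ ω', ∀ f : EllInfty M, eval (f * a) ω = eval f ω' := by
  obtain ⟨C, hC⟩ := a.exists_bound
  refine ⟨⟨ω.t, ω.x, fun n => a.app (ω.t n) (ω.y n), ω.p, ?_⟩, fun f => rfl⟩
  refine Summable.of_nonneg_of_le (fun n => by positivity) (fun n => ?_) (ω.summable.mul_left C)
  calc _ ≤ ‖ω.x n‖ * (C * ‖ω.y n‖) * ‖ω.p n‖ := by gcongr; exact hC _ _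
    _ = _ := by ring

lemma exists_eval_mul_left (a : EllInfty M) (ω : PredualElt M) :
    ∃ ω', ∀ f : EllInfty M, eval (a * f) ω = eval f ω' := by
  obtain ⟨C, hC⟩ := (star a).exists_bound
  refine ⟨⟨ω.t, fun n => (star a).app (ω.t n) (ω.x n), ω.y, ω.p, ?_⟩, fun f => ?_⟩
  · refine Summable.of_nonneg_of_le (fun n => by positivity) (fun n => ?_) (ω.summable.mul_left C)
    calc _ ≤ (C * ‖ω.x n‖) * ‖ω.y n‖ * ‖ω.p n‖ := by gcongr; exact hC _ _
      _ = _ := by ring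
  · refine tsum_congr fun n => ?_
    rw [app_mul, inner_app, star_star]

lemma exists_eval_star (ω : PredualElt M) :
    ∃ ω', ∀ f : EllInfty M, eval (star f) ω = conj (eval f ω') := by
  choose q hq hq' using fun n => exists_pair_star (ω.p n)
  refine ⟨⟨ω.t, ω.y, ω.x, q, ?_⟩, fun f => ?_⟩
  · refine Summable.of_nonneg_of_le (fun n => by positivity) (fun n => ?_) ω.summable
    calc _ ≤ ‖ω.y n‖ * ‖ω.x n‖ * ‖ω.p n‖ := by gcongr; exact hq n
      _ = _ := by ring
  · unfold eval
    rw [Complex.conj_tsum]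
    refine tsum_congr fun n => ?_
    rw [← hq', Ell2.star_inner, inner_app]

lemma continuous_of_eval {X : Type*} [TopologicalSpace X] {F : X → EllInfty M}
    (h : ∀ ω, Continuous fun x => eval (F x) ω) : Continuous F :=
  continuous_induced_rng.2 (continuous_pi h)

lemma continuous_eval (ω : PredualElt M) : Continuous fun f : EllInfty M => eval f ω :=
  (continuous_apply ω : Continuous fun g : PredualElt M → ℂ => g ω).comp
    (continuous_induced_dom (f := (eval : EllInfty M → PredualElt M → ℂ)))

lemma continuous_of_exists {F : EllInfty M → EllInfty M}
    (h : ∀ ω, ∃ ω', ∀ f, eval (F f) ω = eval f ω') : Continuous F :=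
  continuous_of_eval fun ω => by
    obtain ⟨ω', h⟩ := h ω
    simp only [h]
    exact continuous_eval ω'

instance : IsSemitopologicalSemiring (EllInfty M) where
  continuous_add := continuous_of_eval fun ω => by
    simp only [eval_add]
    exact ((continuous_eval ω).comp continuous_fst).add ((continuous_eval ω).comp continuous_snd)
  continuous_const_mul {a} := continuous_of_exists (exists_eval_mul_left a)
  continuous_mul_const {a} := continuous_of_exists (exists_eval_mul_right a)

instance : ContinuousConstSMul ℂ (EllInfty M) where
  continuous_const_smul z := continuous_of_eval fun ω => by
    simp only [eval_smul]
    exact continuous_const.mul (continuous_eval ω)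

instance : ContinuousStar (EllInfty M) where
  continuous_star := continuous_of_eval fun ω => by
    obtain ⟨ω', h⟩ := exists_eval_star ω
    simp only [h]
    exact Complex.continuous_conj.comp (continuous_eval ω')

/-- The translation `γ_s(f)(t) = f(s⁻¹t)`. -/
def translate (s : G) : EllInfty M →⋆ₙₐ[ℂ] EllInfty M where
  toFun f := ⟨fun t => f.1 (s⁻¹ * t), by
    obtain ⟨g, ⟨C, hC⟩, h⟩ := f.2
    exact ⟨fun t => g (s⁻¹ * t), ⟨C, fun t => hC _⟩, fun t => h _⟩⟩
  map_smul' _ _ := rfl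
  map_zero' := rfl
  map_add' _ _ := rfl
  map_mul' _ _ := rfl
  map_star' f := eq_star fun t ξ η => inner_app f (s⁻¹ * t) ξ η

lemma app_translate (s : G) (f : EllInfty M) (t : G) :
    (translate s f).app t = f.app (s⁻¹ * t) := rfl

lemma continuous_translate (s : G) : Continuous (translate (M := M) s) :=
  continuous_of_exists fun ω => ⟨⟨fun n => s⁻¹ * ω.t n, ω.x, ω.y, ω.p, ω.summable⟩, fun _ => rfl⟩

end EllInfty

end EllInfty

/-! ### The W*-algebra of kernels -/

section WStarKernel

variable {G : Type v} [Group G] {M : G → Type u} [∀ t, NormedAddCommGroup (M t)]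
  [∀ t, NormedSpace ℂ (M t)]

namespace FinKernel

/-- `∑ ‖k(s,t)‖`. -/
def norm1 (k : FinKernel M) : ℝ := ∑ᶠ p : G × G, ‖k.1 p.1 p.2‖

lemma norm1_shift (g : G) (k : FinKernel M) : norm1 (shift g k) = norm1 k := by
  unfold norm1
  rw [← finsum_comp_equiv ((Equiv.mulRight g).prodCongr (Equiv.mulRight g))
    (f := fun p : G × G => ‖k.1 p.1 p.2‖)]
  refine finsum_congr fun p => ?_
  have h := norm_entry (shift g k) (rfl : p.1 * p.2⁻¹ = _)
  rw [entry_shift g k _ (show (p.1 * g) * (p.2 * g)⁻¹ = p.1 * p.2⁻¹ by group), norm_entry] at h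
  exact h.symm

lemma norm1_eq (k : FinKernel M) :
    norm1 k = ∑ s ∈ k.supp, ∑ t ∈ k.supp, ‖k.entry (rfl : s * t⁻¹ = _)‖ := by
  rw [norm1, ← Finset.sum_product']
  refine finsum_eq_sum_of_support_subset _ fun p hp => ?_
  have h : k.entry (rfl : p.1 * p.2⁻¹ = _) ≠ 0 := fun h => hp (by
    rw [entry_rfl] at h; simp [h])
  simpa using ⟨left_mem_supp _ h, right_mem_supp _ h⟩

lemma norm1_nonneg (k : FinKernel M) : 0 ≤ norm1 k := by rw [norm1_eq]; positivity

variable [FellOps M] [FellBundle M]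

lemma act_aux (s t : G) : s * t⁻¹ * t = s := by group

/-- `(kξ)(s) = ∑ₜ k(s,t) ξ(t)`. -/
def act (k : FinKernel M) (ξ : ∀ t, M t) (s : G) : M s :=
  ∑ᶠ t, FellOps.mul (B := M) (act_aux s t) (k.1 s t) (ξ t)

lemma act_eq_sum (k : FinKernel M) (ξ : ∀ t, M t) (s : G) (F : Finset G) (hF : k.supp ⊆ F) :
    act k ξ s = ∑ t ∈ F, FellOps.mul (B := M) (act_aux s t) (k.entry rfl) (ξ t) :=
  finsum_eq_sum_of_support_subset _ fun t ht => hF (right_mem_supp (rfl : s * t⁻¹ = _) fun h0 =>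
    ht (by rw [entry_rfl] at h0; simp [h0]))

lemma act_eq_zero (k : FinKernel M) (ξ : ∀ t, M t) (s : G) (hs : s ∉ k.supp) : act k ξ s = 0 := by
  rw [act_eq_sum k ξ s _ le_rfl]
  exact Finset.sum_eq_zero fun t _ => by rw [entry_left _ _ hs, zero_mul']

/-- The operator `π(k)` on `ℓ²_{w*}(M)`, `(π(k)ξ)(s) = ∑ₜ k(s,t) ξ(t)`. -/
def ker (k : FinKernel M) : Ell2 M →L[ℂ] Ell2 M :=
  LinearMap.mkContinuous
    { toFun := fun ξ => Ell2.ofFinset (act k ξ.val) k.supp (act_eq_zero k ξ.val)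
      map_add' := fun ξ η => Ell2.ext' fun s => by
        change act k (ξ + η).val s = act k ξ.val s + act k η.val s
        simp only [act_eq_sum k _ s _ le_rfl, ← Finset.sum_add_distrib, Ell2.val_add, Pi.add_apply,
          FellBundle.mul_add (B := M)]
      map_smul' := fun z ξ => Ell2.ext' fun s => by
        change act k (z • ξ).val s = z • act k ξ.val s
        simp only [act_eq_sum k _ s _ le_rfl, Finset.smul_sum, Ell2.val_smul, Pi.smul_apply,
          FellBundle.mul_smul (B := M)] } (norm1 k) fun ξ => by
    refine (Ell2.norm_ofFinset_le (act k ξ.val) k.supp (act_eq_zero k ξ.val)).trans ?_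
    rw [norm1_eq, Finset.sum_mul]
    refine Finset.sum_le_sum fun s _ => ?_
    rw [act_eq_sum k _ s _ le_rfl, Finset.sum_mul]
    refine norm_sum_le_of_le _ fun t _ => (FellBundle.norm_mul_le (B := M) _ _ _).trans ?_
    gcongr
    exact Ell2.norm_val_le ξ t

lemma val_ker (k : FinKernel M) (ξ : Ell2 M) (s : G) : (ker k ξ).val s = act k ξ.val s := rfl

lemma norm_ker_le (k : FinKernel M) : ‖ker k‖ ≤ norm1 k :=
  LinearMap.mkContinuous_norm_le _ (norm1_nonneg k) _

lemma ker_add (k l : FinKernel M) (ξ : Ell2 M) : ker (k + l) ξ = ker k ξ + ker l ξ := by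
  classical
  refine Ell2.ext' fun s => ?_
  change act (k + l) _ s = act k _ s + act l _ s
  let F := (k + l).supp ∪ (k.supp ∪ l.supp)
  rw [act_eq_sum _ _ s F Finset.subset_union_left,
    act_eq_sum k _ s F (Finset.subset_union_left.trans Finset.subset_union_right),
    act_eq_sum l _ s F (Finset.subset_union_right.trans Finset.subset_union_right),
    ← Finset.sum_add_distrib]
  exact Finset.sum_congr rfl fun t _ => by rw [entry_add, FellBundle.add_mul (B := M)]

lemma ker_smul (z : ℂ) (k : FinKernel M) (ξ : Ell2 M) : ker (z • k) ξ = z • ker k ξ := by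
  classical
  refine Ell2.ext' fun s => ?_
  change act (z • k) _ s = z • act k _ s
  rw [act_eq_sum _ _ s ((z • k).supp ∪ k.supp) Finset.subset_union_left,
    act_eq_sum k _ s ((z • k).supp ∪ k.supp) Finset.subset_union_right, Finset.smul_sum]
  exact Finset.sum_congr rfl fun t _ => by rw [entry_smul, FellBundle.smul_mul (B := M)]

lemma ker_mul (k l : FinKernel M) (ξ : Ell2 M) : ker (k * l) ξ = ker k (ker l ξ) := by
  classical
  refine Ell2.ext' fun s => ?_
  rw [val_ker, val_ker]
  let F := (k * l).supp ∪ (k.supp ∪ l.supp)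
  have hk : k.supp ⊆ F := Finset.subset_union_left.trans Finset.subset_union_right
  have hl : l.supp ⊆ F := Finset.subset_union_right.trans Finset.subset_union_right
  rw [act_eq_sum _ _ s F Finset.subset_union_left, act_eq_sum k _ s F hk]
  simp only [val_ker, act_eq_sum l _ _ F hl, entry_mul k l _ F (.inl hk), sum_mul, mul_sum]
  rw [Finset.sum_comm]
  exact Finset.sum_congr rfl fun t _ => Finset.sum_congr rfl fun r _ =>
    FellBundle.mul_assoc (B := M) _ _ _ _ _ _ _

end FinKernel

open FinKernel

variable [FellOps M] [FibrePredual M] [WStarFellBundle M]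

lemma inner_ker (k : FinKernel M) (ξ η : Ell2 M) :
    Ell2.inner (ker k ξ) η = Ell2.inner ξ (ker (star k) η) := by
  classical
  let F := k.supp ∪ (star k).supp
  have h1 : k.supp ⊆ F := Finset.subset_union_left
  have h2 : (star k).supp ⊆ F := Finset.subset_union_right
  rw [Ell2.inner_eq_fip _ _ F fun t ht => ip_zero_left (ker k ξ).val _ _
      (act_eq_zero k _ t fun h => ht (h1 h)),
    Ell2.inner_eq_fip _ _ F fun t ht => ip_zero_right _ (ker (star k) η).val _
      (act_eq_zero (star k) _ t fun h => ht (h2 h))]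
  simp only [fip, ip, val_ker, act_eq_sum k _ _ F h1, act_eq_sum (star k) _ _ F h2, inv_sum,
    sum_mul, mul_sum]
  refine Eq.trans Finset.sum_comm ?_
  refine Finset.sum_congr rfl fun t _ => Finset.sum_congr rfl fun s _ => ?_
  rw [entry_star, FellBundle.inv_mul (B := M) (act_aux s t) (by group : (s * t⁻¹)⁻¹ = t * s⁻¹) rfl
    rfl (by group)]
  exact FellBundle.mul_assoc (B := M) _ _ _ _ _ _ _

variable (M) in
/-- The *-homomorphism `π^β : k ↦ (t ↦ π(β_t⁻¹(k)))` on kernels of finite support. -/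
def piBeta : FinKernel M →⋆ₙₐ[ℂ] EllInfty M where
  toFun k := ⟨fun t => ker (shiftHom M t⁻¹ k), fun t => ker (shiftHom M t⁻¹ (star k)),
    ⟨max (norm1 k) (norm1 (star k)), fun t => ⟨((norm_ker_le _).trans
      (norm1_shift t⁻¹ k).le).trans (le_max_left _ _), ((norm_ker_le _).trans
      (norm1_shift t⁻¹ (star k)).le).trans (le_max_right _ _)⟩⟩,
    fun t ξ η => (inner_ker _ ξ η).trans (by rw [← map_star])⟩
  map_smul' z k := EllInfty.ext' fun t ξ => by
    change ker (shiftHom M t⁻¹ (z • k)) ξ = z • ker (shiftHom M t⁻¹ k) ξ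
    rw [map_smul, ker_smul]
  map_zero' := EllInfty.ext' fun t ξ => by
    change ker (shiftHom M t⁻¹ 0) ξ = 0
    rw [map_zero]
    simpa using ker_smul 0 (0 : FinKernel M) ξ
  map_add' k l := EllInfty.ext' fun t ξ => by
    change ker (shiftHom M t⁻¹ (k + l)) ξ = ker (shiftHom M t⁻¹ k) ξ + ker (shiftHom M t⁻¹ l) ξ
    rw [map_add, ker_add]
  map_mul' k l := EllInfty.ext' fun t ξ => by
    change ker (shiftHom M t⁻¹ (k * l)) ξ = ker (shiftHom M t⁻¹ k) (ker (shiftHom M t⁻¹ l) ξ)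
    rw [map_mul, ker_mul]
  map_star' k := EllInfty.eq_star fun t ξ η => by
    change Ell2.inner (ker (shiftHom M t⁻¹ k) ξ) η =
      Ell2.inner ξ (ker (shiftHom M t⁻¹ (star k)) η)
    rw [inner_ker, map_star]

lemma app_piBeta (k : FinKernel M) (t : G) : (piBeta M k).app t = ker (shiftHom M t⁻¹ k) := rfl

lemma translate_piBeta (s : G) (k : FinKernel M) :
    EllInfty.translate s (piBeta M k) = piBeta M (shiftHom M s k) := EllInfty.ext' fun t ξ => by
  rw [EllInfty.app_translate, app_piBeta, app_piBeta, mul_inv_rev, _root_.inv_inv, map_mul]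
  rfl

variable (M) in
/-- The W*-algebra of kernels `𝕜_{w*}(M)`: the weak* closure of the image of `π^β`, with the
weak* topology. (Kernels of finite support are norm dense in `𝕜(M)`, so they have the same weak*
closure as the image of all of `𝕜(M)` under the contractive extension of `π^β`.) -/
def WStarKernel : NonUnitalStarSubalgebra ℂ (EllInfty M) :=
  (NonUnitalStarAlgHom.range (piBeta M)).topologicalClosure

lemma translate_mem (s : G) {f : EllInfty M} (hf : f ∈ WStarKernel M) :
    EllInfty.translate s f ∈ WStarKernel M :=
  map_mem_closure (EllInfty.continuous_translate s) hf fun g hg => by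
    obtain ⟨k, rfl⟩ := hg
    exact ⟨shiftHom M s k, (translate_piBeta s k).symm⟩

variable (M) in
/-- The canonical W*-action `β^{w*}` of `G` on `𝕜_{w*}(M)`, the restriction of the translation
`γ_s(f)(t) = f(s⁻¹t)`. -/
def wstarAction : G →* (WStarKernel M →⋆ₙₐ[ℂ] WStarKernel M) where
  toFun s :=
    { toFun := fun f => ⟨EllInfty.translate s f.1, translate_mem s f.2⟩
      map_smul' := fun z f => Subtype.ext (map_smul (EllInfty.translate s) z f.1)
      map_zero' := Subtype.ext (map_zero (EllInfty.translate s))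
      map_add' := fun f g => Subtype.ext (map_add (EllInfty.translate s) f.1 g.1)
      map_mul' := fun f g => Subtype.ext (map_mul (EllInfty.translate s) f.1 g.1)
      map_star' := fun f => Subtype.ext (map_star (EllInfty.translate s) f.1) }
  map_one' := NonUnitalStarAlgHom.ext fun f => Subtype.ext (EllInfty.ext' fun t ξ => by
    change f.1.app (1⁻¹ * t) ξ = f.1.app t ξ
    simp)
  map_mul' s r := NonUnitalStarAlgHom.ext fun f => Subtype.ext (EllInfty.ext' fun t ξ => by
    change f.1.app ((s * r)⁻¹ * t) ξ = f.1.app (r⁻¹ * (s⁻¹ * t)) ξ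
    rw [mul_inv_rev, _root_.mul_assoc])

end WStarKernel

end Fell

end

open scoped ENNReal ComplexConjugate Topology

set_option linter.unusedSectionVars false

noncomputable section

namespace Fell

universe u v

/-! Two facts have to be proved: the biduals of the fibres form a W*-Fell bundle, and the
representation of kernels on `ℓ²_{w*}(B'')` extends to an isomorphism of `𝕜(B)''` onto
`𝕜_{w*}(B'')`.

Both rest on one domination principle, `IsCStarInner.exists_dominating`. If the norm of `Y` comes
from an inner product with values in a C*-algebra, then every bounded functional `φ` on `Y`
satisfies `|φ(y)|² ≤ p(⟨y, y⟩)` for a positive functional `p` with `‖p‖ ≤ ‖φ‖²`. Hence `φ` factors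
through the Hilbert space of `p`. Hilbert spaces are reflexive, so a bilinear form which factors
through one has a single separately weak*-continuous extension to the biduals (`bidual_swap`). The
products of a Fell bundle are therefore Arens regular. This gives `(ab)* = b* a*` and the
weak*-continuity of left multiplication in `B''`. The inequality `|φ(y)|² ≤ p(y* y)` persists on the
bidual and gives the C*-identity. Positivity of `a* a` follows since its values at positive
functionals are squares of Hilbert space norms.

The representation of kernels of `B` is dominated by `‖·‖₂`, so it is a contraction on `𝕜(B)`. An
element `x` of the bidual acts by operators `x_t` determined by `p(⟨ξ, x_t η⟩) = x(a ↦ p(⟨ξ, a_t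
η⟩))`. Such a vector `x_t η` exists because the functional `ζ ↦ p(⟨ξ, ζ⟩)` is a norm convergent sum
of its coordinates (`hasSum_innerDual`), which is again a consequence of domination.

The extension is injective. For a kernel `e` with a single entry, every functional `φ(e* · e)` on
`𝕜(B)` is one of these coefficient functionals; so if `x` acts as zero then `(xe)*(xe) = 0`. It
follows that `x` annihilates `𝕜(B)`, and then `x x* = 0`. An injective *-homomorphism of C*-algebras
is isometric, so the coefficients norm `𝕜(B)''`. By Hahn–Banach and a geometric series, every
functional on `𝕜(B)` is an absolutely convergent series of coefficients (`exists_coeff_eq`). Thus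
the predual of `ℓ^∞(G, 𝕃(ℓ²_{w*}(B'')))` induces the whole dual of `𝕜(B)`. This makes the extension
a weak* homeomorphism onto its range and identifies the range with the weak* closure of the kernels.
Equivariance holds because `β_s` moves a coefficient at `t` to one at `s⁻¹ t`. -/

open FellOps FibrePredual

/-! ### C*-valued inner products and domination of functionals -/

section CStarInner

open scoped ComplexOrder

variable {A Y : Type*} [NonUnitalCStarAlgebra A] [NormedAddCommGroup Y] [NormedSpace ℂ Y]

/-- An inner product on `Y` with values in a C*-algebra that induces the norm of `Y`. -/
structure IsCStarInner (ip : Y →L⋆[ℂ] Y →L[ℂ] A) : Prop where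
  symm : ∀ x y, star (ip x y) = ip y x
  pos : ∀ x, ∃ c, ip x x = star c * c
  norm_self : ∀ x, ‖ip x x‖ = ‖x‖ ^ 2

/-- Positivity of a functional on a C*-algebra. -/
def IsPos (p : StrongDual ℂ A) : Prop := ∀ a, 0 ≤ p (star a * a)

lemma IsPos.nonneg [PartialOrder A] [StarOrderedRing A] {p : StrongDual ℂ A} (hp : IsPos p) {a : A}
    (ha : 0 ≤ a) : 0 ≤ p a := by
  rw [StarOrderedRing.nonneg_iff] at ha
  refine AddSubmonoid.closure_induction (motive := fun a _ => 0 ≤ p a) ?_ ?_ ?_ ha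
  · rintro _ ⟨s, rfl⟩; exact hp s
  · simp
  · intro x y _ _ hx hy; rw [map_add]; exact add_nonneg hx hy

lemma IsPos.map_star {p : StrongDual ℂ A} (hp : IsPos p) (a : A) : p (star a) = conj (p a) := by
  let _ : PartialOrder A := CStarAlgebra.spectralOrder A
  have : StarOrderedRing A := CStarAlgebra.spectralOrderedRing A
  let P : A →ₚ[ℂ] ℂ := PositiveLinearMap.mk₀ p.toLinearMap fun a ha => hp.nonneg ha
  exact StarHomClass.map_star P a

/-- The positive part of `h`. It supplies the admissible elements `d` in the infimum that defines
the sublinear functional of `exists_dominating`, in an algebra where `‖h‖ • 1` need not exist. -/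
lemma exists_nonneg_ge [PartialOrder A] [StarOrderedRing A] (h : selfAdjoint A) :
    ∃ d : A, 0 ≤ d ∧ ‖d‖ ≤ ‖h‖ ∧ (h : A) ≤ d :=
  ⟨(h : A)⁺, CFC.posPart_nonneg _, CStarAlgebra.norm_posPart_le _, CFC.le_posPart h.2⟩

namespace IsCStarInner

variable {ip : Y →L⋆[ℂ] Y →L[ℂ] A} (hip : IsCStarInner ip)
include hip

lemma nonneg [PartialOrder A] [StarOrderedRing A] (y : Y) : 0 ≤ ip y y := by
  obtain ⟨c, hc⟩ := hip.pos y
  rw [hc]; exact star_mul_self_nonneg c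

lemma selfAdj (y : Y) : IsSelfAdjoint (ip y y) := hip.symm y y

/-- Two vectors can be combined into one without decreasing `‖φ‖²` or increasing the inner
product. -/
lemma exists_combine [PartialOrder A] [StarOrderedRing A] (φ : StrongDual ℂ Y) (y₁ y₂ : Y) :
    ∃ y, ‖φ y₁‖ ^ 2 + ‖φ y₂‖ ^ 2 ≤ ‖φ y‖ ^ 2 ∧ ip y y ≤ ip y₁ y₁ + ip y₂ y₂ := by
  set r : ℝ := √(‖φ y₁‖ ^ 2 + ‖φ y₂‖ ^ 2) with hr
  have hr2 : r ^ 2 = ‖φ y₁‖ ^ 2 + ‖φ y₂‖ ^ 2 := Real.sq_sqrt (by positivity)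
  rcases eq_or_ne r 0 with h0 | h0
  · refine ⟨0, ?_, ?_⟩
    · rw [← hr2, h0]; simp
    · simpa using add_nonneg (hip.nonneg y₁) (hip.nonneg y₂)
  -- The unit vector `(c₁, c₂)` realises equality in Cauchy–Schwarz, so that `φ` takes the value `r`
  -- at the combination. The second row of the corresponding unitary matrix gives `conj c₂ • y₁ -
  -- conj c₁ • y₂`, and unitary matrices preserve `⟨y₁, y₁⟩ + ⟨y₂, y₂⟩`.
  set c₁ : ℂ := conj (φ y₁) / r with hc₁
  set c₂ : ℂ := conj (φ y₂) / r with hc₂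
  have hr0 : (r : ℂ) ≠ 0 := by exact_mod_cast h0
  have e1 : φ y₁ * conj (φ y₁) + φ y₂ * conj (φ y₂) = (r : ℂ) ^ 2 := by
    rw [Complex.mul_conj, Complex.mul_conj, Complex.normSq_eq_norm_sq, Complex.normSq_eq_norm_sq]
    exact_mod_cast hr2.symm
  have hc : conj c₁ * c₁ + conj c₂ * c₂ = 1 := by
    simp only [hc₁, hc₂, map_div₀, Complex.conj_conj, Complex.conj_ofReal]
    field_simp
    linear_combination e1
  refine ⟨c₁ • y₁ + c₂ • y₂, ?_, ?_⟩
  · have : φ (c₁ • y₁ + c₂ • y₂) = r := by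
      simp only [map_add, map_smul, smul_eq_mul, hc₁, hc₂]
      field_simp
      linear_combination e1
    rw [this, ← hr2, Complex.norm_real, Real.norm_eq_abs, sq_abs]
  · have h1 := hip.nonneg (conj c₂ • y₁ - conj c₁ • y₂)
    have h2 : ip (c₁ • y₁ + c₂ • y₂) (c₁ • y₁ + c₂ • y₂) +
        ip (conj c₂ • y₁ - conj c₁ • y₂) (conj c₂ • y₁ - conj c₁ • y₂) =
        (conj c₁ * c₁ + conj c₂ * c₂) • (ip y₁ y₁ + ip y₂ y₂) := by
      clear_value c₁ c₂
      simp only [map_add, map_sub, map_smulₛₗ, add_apply, sub_apply, smul_apply,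
        Complex.conj_conj, RingHom.id_apply]
      module
    rw [hc, one_smul] at h2
    rw [← h2]
    exact le_add_of_nonneg_right h1

/-- Every bounded functional on `Y` is dominated by a positive functional on the C*-algebra. -/
theorem exists_dominating (φ : StrongDual ℂ Y) : ∃ p : StrongDual ℂ A, ‖p‖ ≤ ‖φ‖ ^ 2 ∧ IsPos p ∧
    ∀ y, ‖φ y‖ ^ 2 ≤ (p (ip y y)).re := by
  let _ : PartialOrder A := CStarAlgebra.spectralOrder A
  have : StarOrderedRing A := CStarAlgebra.spectralOrderedRing A
  -- The set is designed so that a linear `g` below its infimum has all the required properties: `y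
  -- = 0` gives `g h ≤ ‖φ‖² ‖d‖` for `h ≤ d`, hence the norm bound and (with `d = 0`) positivity,
  -- while `d = 0` and `h = -⟨y, y⟩` give `|φ y|² ≤ g ⟨y, y⟩`.
  let S : selfAdjoint A → Set ℝ := fun h =>
    {r | ∃ d y, 0 ≤ d ∧ (h : A) + ip y y ≤ d ∧ r = ‖φ‖ ^ 2 * ‖d‖ - ‖φ y‖ ^ 2}
  -- With `-h ≤ e` and `‖e‖ ≤ ‖h‖` the constraint becomes `⟨y, y⟩ ≤ d + e`, so `‖y‖² ≤ ‖d‖ + ‖h‖`;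
  -- this is where the inner product inducing the norm of `Y` is used.
  have hlow : ∀ h, ∀ r ∈ S h, -(‖φ‖ ^ 2 * ‖h‖) ≤ r := by
    rintro h _ ⟨d, y, hd, hy, rfl⟩
    obtain ⟨e, he, hen, hle⟩ := exists_nonneg_ge (-h)
    have h1 : ip y y ≤ d + e := by
      have := add_le_add hy hle
      simpa [add_comm, add_left_comm] using this
    have h2 := CStarAlgebra.norm_le_norm_of_nonneg_of_le (hip.nonneg y) h1
    rw [hip.norm_self] at h2
    have h3 : ‖φ y‖ ^ 2 ≤ ‖φ‖ ^ 2 * ‖y‖ ^ 2 := by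
      rw [← mul_pow]; gcongr; exact φ.le_opNorm y
    have h4 : ‖y‖ ^ 2 ≤ ‖d‖ + ‖h‖ := by
      refine h2.trans ((norm_add_le _ _).trans ?_)
      rw [norm_neg] at hen
      gcongr
    have h5 : ‖φ‖ ^ 2 * ‖y‖ ^ 2 ≤ ‖φ‖ ^ 2 * (‖d‖ + ‖h‖) := by gcongr
    linarith
  have hbdd : ∀ h, BddBelow (S h) := fun h => ⟨_, fun r hr => hlow h r hr⟩
  have hmem : ∀ (h : selfAdjoint A) (d : A), 0 ≤ d → (h : A) ≤ d → ‖φ‖ ^ 2 * ‖d‖ ∈ S h :=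
    fun h d hd hh => ⟨d, 0, hd, by simpa using hh, by simp⟩
  have hne : ∀ h, (S h).Nonempty := fun h => by
    obtain ⟨d, hd, -, hh⟩ := exists_nonneg_ge h
    exact ⟨_, hmem h d hd hh⟩
  let N : selfAdjoint A → ℝ := fun h => sInf (S h)
  -- The vector scales by `√c` because `⟨y, y⟩` and `|φ y|²` are quadratic in `y`.
  have hsmul : ∀ c : ℝ, 0 < c → ∀ h, ∀ r ∈ S h, c * r ∈ S (c • h) := by
    rintro c hc h _ ⟨d, y, hd, hy, rfl⟩
    refine ⟨c • d, ((√c : ℝ) : ℂ) • y, smul_nonneg hc.le hd, ?_, ?_⟩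
    · have : ip (((√c : ℝ) : ℂ) • y) (((√c : ℝ) : ℂ) • y) = c • ip y y := by
        simp only [map_smulₛₗ, smul_apply, smul_smul, Complex.conj_ofReal]
        rw [RingHom.id_apply, ← Complex.ofReal_mul, Real.mul_self_sqrt hc.le, Complex.coe_smul]
      rw [this, selfAdjoint.val_smul, ← smul_add]
      exact smul_le_smul_of_nonneg_left hy hc.le
    · rw [map_smul, norm_smul, norm_smul, Complex.norm_real, mul_pow, Real.norm_eq_abs,
        Real.norm_eq_abs, sq_abs, Real.sq_sqrt hc.le, abs_of_pos hc]
      ring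
  have hle : ∀ c : ℝ, 0 < c → ∀ h, N (c • h) ≤ c * N h := fun c hc h => by
    rw [← div_le_iff₀' hc]
    refine le_csInf (hne h) fun r hr => ?_
    rw [div_le_iff₀' hc]
    exact csInf_le (hbdd _) (hsmul c hc h r hr)
  obtain ⟨g, -, hg⟩ := exists_extension_of_le_sublinear (⊥ : selfAdjoint A →ₗ.[ℝ] ℝ) N
    (fun c hc h => by
      refine le_antisymm (hle c hc h) ?_
      have := hle c⁻¹ (inv_pos.2 hc) (c • h)
      rw [smul_smul, inv_mul_cancel₀ hc.ne', one_smul] at this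
      rwa [← le_inv_mul_iff₀ hc])
    (fun h₁ h₂ => by
      have : N (h₁ + h₂) - N h₂ ≤ N h₁ := le_csInf (hne h₁) fun r₁ hr₁ => by
        have : N (h₁ + h₂) - r₁ ≤ N h₂ := le_csInf (hne h₂) fun r₂ hr₂ => by
          obtain ⟨d₁, y₁, hd₁, hy₁, rfl⟩ := hr₁
          obtain ⟨d₂, y₂, hd₂, hy₂, rfl⟩ := hr₂
          -- Subadditivity needs one vector that does the work of two.
          obtain ⟨y, hy, hy'⟩ := hip.exists_combine φ y₁ y₂
          have h1 : N (h₁ + h₂) ≤ ‖φ‖ ^ 2 * ‖d₁ + d₂‖ - ‖φ y‖ ^ 2 :=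
            csInf_le (hbdd _) ⟨d₁ + d₂, y, add_nonneg hd₁ hd₂, by
              refine le_trans ?_ (add_le_add hy₁ hy₂)
              calc (h₁ + h₂ : A) + ip y y ≤ h₁ + h₂ + (ip y₁ y₁ + ip y₂ y₂) := by gcongr
                _ = _ := by abel, rfl⟩
          have h2 : ‖φ‖ ^ 2 * ‖d₁ + d₂‖ ≤ ‖φ‖ ^ 2 * (‖d₁‖ + ‖d₂‖) := by
            gcongr; exact norm_add_le _ _
          linarith
        linarith
      linarith)
    -- On the zero subspace the hypothesis of Hahn–Banach is just `0 ≤ N 0`.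
    (fun x => by
      have hx : (x : selfAdjoint A) = 0 := (Submodule.mem_bot ℝ).1 x.2
      have : (⊥ : selfAdjoint A →ₗ.[ℝ] ℝ) x = 0 := rfl
      rw [this]
      refine le_csInf (hne _) fun r hr => ?_
      simpa [hx] using hlow _ r hr)
  have hgd : ∀ (h : selfAdjoint A) (d : A), 0 ≤ d → (h : A) ≤ d → g h ≤ ‖φ‖ ^ 2 * ‖d‖ :=
    fun h d hd hh => (hg h).trans (csInf_le (hbdd _) (hmem h d hd hh))
  have hgn : ∀ h, g h ≤ ‖φ‖ ^ 2 * ‖h‖ := fun h => by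
    obtain ⟨d, hd, hdn, hh⟩ := exists_nonneg_ge h
    exact (hgd h d hd hh).trans (by gcongr)
  -- `g` lives on the self-adjoint part; composed with the real part and complexified it becomes the
  -- functional `p` with `Re p(a) = g(Re a)`.
  let f : StrongDual ℝ A := LinearMap.mkContinuous (g.comp realPart) (‖φ‖ ^ 2) fun a => by
    have h1 := hgn (realPart a)
    have h2 := hgn (-realPart a)
    rw [map_neg, norm_neg] at h2
    have h3 : ‖φ‖ ^ 2 * ‖realPart a‖ ≤ ‖φ‖ ^ 2 * ‖a‖ := by gcongr; exact realPart.norm_le a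
    rw [LinearMap.comp_apply, Real.norm_eq_abs, abs_le]
    exact ⟨by linarith, by linarith⟩
  have hf : ∀ a, f a = g (realPart a) := fun a => rfl
  have hre : ∀ a, ((f.extendRCLike : StrongDual ℂ A) a).re = f a := fun a =>
    StrongDual.re_extendRCLike_apply (𝕜 := ℂ) f a
  have him : ∀ a, ((f.extendRCLike : StrongDual ℂ A) a).im = -f (Complex.I • a) := fun a =>
    StrongDual.im_extendRCLike_apply (𝕜 := ℂ) f a
  refine ⟨f.extendRCLike, ?_, fun a => ?_, fun y => ?_⟩
  · refine ContinuousLinearMap.opNorm_le_bound _ (by positivity) fun a => ?_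
    refine (StrongDual.norm_extendRCLike_bound f a).trans ?_
    gcongr
    exact LinearMap.mkContinuous_norm_le _ (by positivity) _
  · have hsa : IsSelfAdjoint (star a * a) := .star_mul_self a
    rw [Complex.nonneg_iff, hre, him, hf, hf]
    constructor
    · have h1 := hgd (-realPart (star a * a)) 0 le_rfl (by
        rw [NegMemClass.coe_neg, hsa.coe_realPart]
        exact neg_nonpos.2 (star_mul_self_nonneg a))
      rw [map_neg, norm_zero] at h1
      linarith
    · rw [realPart_I_smul, hsa.imaginaryPart]
      simp
  · rw [hre, hf]
    have h1 : g (-realPart (ip y y)) ≤ -‖φ y‖ ^ 2 := by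
      refine (hg _).trans (csInf_le (hbdd _) ⟨0, y, le_rfl, ?_, by simp⟩)
      rw [NegMemClass.coe_neg, (hip.selfAdj y).coe_realPart]
      simp
    rw [map_neg] at h1
    linarith

end IsCStarInner

end CStarInner

/-! ### Positive semidefinite forms and biduals -/

section PSD

variable {X Y : Type*} [NormedAddCommGroup X] [NormedSpace ℂ X] [NormedAddCommGroup Y]
  [NormedSpace ℂ Y]

/-- A positive semidefinite sesquilinear form. -/
structure IsPSD (σ : Y →L⋆[ℂ] Y →L[ℂ] ℂ) : Prop where
  symm : ∀ x y, conj (σ x y) = σ y x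
  nonneg : ∀ x, 0 ≤ (σ x x).re

/-- The space `Y` with the seminorm of a positive semidefinite form. -/
def FormSpace {σ : Y →L⋆[ℂ] Y →L[ℂ] ℂ} (_ : IsPSD σ) := Y

namespace FormSpace

variable {σ : Y →L⋆[ℂ] Y →L[ℂ] ℂ} (h : IsPSD σ)

instance : AddCommGroup (FormSpace h) := inferInstanceAs (AddCommGroup Y)
instance : Module ℂ (FormSpace h) := inferInstanceAs (Module ℂ Y)

/-- The inner product of the form. -/
abbrev core : PreInnerProductSpace.Core ℂ (FormSpace h) where
  inner x y := σ x y
  conj_inner_symm x y := h.symm y x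
  re_inner_nonneg := h.nonneg
  add_left x y z := congrArg (fun f : Y →L[ℂ] ℂ => f z) (map_add σ x y)
  smul_left x y z := congrArg (fun f : Y →L[ℂ] ℂ => f y) (map_smulₛₗ σ z x)

instance : SeminormedAddCommGroup (FormSpace h) :=
  InnerProductSpace.Core.toSeminormedAddCommGroup (c := core h)
instance : InnerProductSpace ℂ (FormSpace h) := InnerProductSpace.ofCore (core h)

end FormSpace

/-- A positive semidefinite form is the pullback of the inner product of a Hilbert space. -/
lemma IsPSD.exists_hilbert {Y : Type u} [NormedAddCommGroup Y] [NormedSpace ℂ Y]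
    {σ : Y →L⋆[ℂ] Y →L[ℂ] ℂ} (h : IsPSD σ) :
    ∃ (H : Type u) (_ : NormedAddCommGroup H) (_ : InnerProductSpace ℂ H) (_ : CompleteSpace H)
      (J : Y →L[ℂ] H), ∀ x y, inner ℂ (J x) (J y) = σ x y := by
  let J : Y →ₗ[ℂ] UniformSpace.Completion (FormSpace h) :=
    (UniformSpace.Completion.toComplₗᵢ (𝕜 := ℂ) (E := FormSpace h)).toLinearMap ∘ₗ
      (LinearMap.id : Y →ₗ[ℂ] Y)
  have hJ : ∀ x y, inner ℂ (J x) (J y) = σ x y := fun x y =>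
    UniformSpace.Completion.inner_coe (𝕜 := ℂ) (E := FormSpace h) x y
  refine ⟨UniformSpace.Completion (FormSpace h), inferInstance, inferInstance, inferInstance,
    J.mkContinuous (√‖σ‖) fun y => ?_, hJ⟩
  have h1 : ‖J y‖ ^ 2 = (σ y y).re := by
    rw [norm_sq_eq_re_inner (𝕜 := ℂ), hJ]; rfl
  have h2 : (σ y y).re ≤ ‖σ‖ * ‖y‖ ^ 2 := by
    refine (Complex.re_le_norm _).trans (((σ y).le_opNorm y).trans ?_)
    calc ‖σ y‖ * ‖y‖ ≤ (‖σ‖ * ‖y‖) * ‖y‖ := by gcongr; exact σ.le_opNorm y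
      _ = _ := by ring
  rw [← h1] at h2
  refine le_of_sq_le_sq ?_ (by positivity)
  rw [mul_pow, Real.sq_sqrt (norm_nonneg σ)]
  exact h2

section Represent

variable {H : Type*} [NormedAddCommGroup H] [InnerProductSpace ℂ H] [CompleteSpace H]
  (J : Y →L[ℂ] H)

/-- A functional dominated by `‖J ·‖` factors through `J`. -/
lemma exists_inner_eq (ψ : StrongDual ℂ Y) (c : ℝ) (hc : 0 ≤ c) (hψ : ∀ y, ‖ψ y‖ ≤ c * ‖J y‖) :
    ∃ h : H, ‖h‖ ≤ c ∧ ψ = (innerSL ℂ h).comp J := by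
  let R := LinearMap.range J.toLinearMap
  -- The section `g` of `J` is merely linear; the composite of `ψ` with it is bounded because `ψ` is
  -- dominated by `‖J ·‖`.
  obtain ⟨g, hg⟩ := J.toLinearMap.rangeRestrict.exists_rightInverse_of_surjective
    (LinearMap.range_rangeRestrict _)
  have hg' : ∀ w : R, J (g w) = w := fun w =>
    congrArg Subtype.val (LinearMap.congr_fun hg w)
  let f : StrongDual ℂ R := (ψ.toLinearMap ∘ₗ g).mkContinuous c fun w => by
    have := hψ (g w)
    rwa [hg'] at this
  obtain ⟨F, hF, hFn⟩ := exists_extension_norm_eq R f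
  refine ⟨(InnerProductSpace.toDual ℂ H).symm F, ?_, ContinuousLinearMap.ext fun y => ?_⟩
  · rw [LinearIsometryEquiv.norm_map, hFn]
    exact LinearMap.mkContinuous_norm_le _ hc _
  · rw [ContinuousLinearMap.comp_apply, innerSL_apply_apply, InnerProductSpace.toDual_symm_apply]
    have h1 := hF ⟨J y, LinearMap.mem_range_self _ y⟩
    rw [h1]
    change ψ y = ψ (g _)
    -- The choice of section does not matter, as `ψ` vanishes on the kernel of `J`.
    have h2 := hψ (y - g ⟨J y, LinearMap.mem_range_self _ y⟩)
    rw [map_sub, map_sub, hg', sub_self, norm_zero, mul_zero] at h2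
    exact sub_eq_zero.1 (norm_le_zero_iff.1 h2)

/-- An element of `Y''` is represented by a vector on functionals dominated by `‖J ·‖`. -/
lemma exists_represent (a : StrongDual ℂ (StrongDual ℂ Y)) : ∃ v ∈ closure (Set.range J),
    (∀ h, a ((innerSL ℂ h).comp J) = inner ℂ h v) ∧
    ∀ (ψ : StrongDual ℂ Y) (c : ℝ), 0 ≤ c → (∀ y, ‖ψ y‖ ≤ c * ‖J y‖) →
      ∀ y, ‖a ψ - ψ y‖ ≤ c * ‖v - J y‖ := by
  -- The assignment `h ↦ a(⟨h, J ·⟩)` is conjugate-linear, so its conjugate `F` is a bounded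
  -- functional and Riesz gives `v`.
  let S : H →L⋆[ℂ] StrongDual ℂ Y :=
    (((ContinuousLinearMap.compL ℂ Y H ℂ).flip J).comp (innerSL ℂ))
  let F : StrongDual ℂ H := conjDual S a
  let v := (InnerProductSpace.toDual ℂ H).symm F
  have hv : ∀ h, a ((innerSL ℂ h).comp J) = inner ℂ h v := fun h => by
    rw [← inner_conj_symm, InnerProductSpace.toDual_symm_apply, conjDual_apply, Complex.conj_conj]
    rfl
  refine ⟨v, ?_, hv, fun ψ c hc hψ y => ?_⟩
  -- The component `w` of `v` orthogonal to the range of `J` satisfies `⟨w, J ·⟩ = 0`, hence `⟨w, v⟩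
  -- = a 0 = 0` and `w = 0`.
  · let R := (LinearMap.range J.toLinearMap).topologicalClosure
    have hR : IsClosed (R : Set H) := Submodule.isClosed_topologicalClosure _
    have : CompleteSpace R := hR.completeSpace_coe
    have hw : v - R.starProjection v ∈ Rᗮ := Submodule.sub_starProjection_mem_orthogonal v
    set w := v - R.starProjection v with hwdef
    have h1 : (innerSL ℂ w).comp J = 0 := ContinuousLinearMap.ext fun y =>
      Submodule.inner_left_of_mem_orthogonal
        (Submodule.le_topologicalClosure _ (LinearMap.mem_range_self J.toLinearMap y)) hw
    have h2 := hv w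
    rw [h1, map_zero] at h2
    have h3 : inner ℂ w (R.starProjection v) = 0 :=
      Submodule.inner_left_of_mem_orthogonal (Submodule.starProjection_apply_mem R v) hw
    have h4 : inner ℂ w w = 0 := by
      nth_rewrite 2 [hwdef]
      rw [inner_sub_right, h3, ← h2, sub_zero]
    have h5 : v = R.starProjection v := sub_eq_zero.1 (inner_self_eq_zero.1 h4)
    rw [h5]
    exact Submodule.starProjection_apply_mem R v
  · obtain ⟨h, hh, rfl⟩ := exists_inner_eq J ψ c hc hψ
    rw [hv, ContinuousLinearMap.comp_apply, innerSL_apply_apply, ← inner_sub_right]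
    exact (norm_inner_le_norm _ _).trans (by gcongr)

/-- Arens regularity of a bilinear form that factors through a Hilbert space. -/
theorem bidual_swap (β : X →L[ℂ] Y →L[ℂ] ℂ) (C : ℝ) (hC : 0 ≤ C)
    (hβ : ∀ x y, ‖β x y‖ ≤ C * ‖x‖ * ‖J y‖) (Φ : StrongDual ℂ (StrongDual ℂ X))
    (Ψ : StrongDual ℂ (StrongDual ℂ Y)) (f : StrongDual ℂ X) (g : StrongDual ℂ Y)
    (hf : ∀ x, f x = Ψ (β x)) (hg : ∀ y, g y = Φ (β.flip y)) : Φ f = Ψ g := by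
  obtain ⟨v, hv, -, hd⟩ := exists_represent J Ψ
  -- A vector `y` with `J y` near `v` replaces `Ψ` on every functional dominated by `‖J ·‖`, with an
  -- error proportional to the domination constant. Both `Φ f` and `Ψ g` are then close to the
  -- number `g y`.
  have key : ∀ y, ‖Φ f - Ψ g‖ ≤ 2 * (‖Φ‖ * C) * ‖v - J y‖ := fun y => by
    have h1 : ‖Φ f - g y‖ ≤ ‖Φ‖ * (C * ‖v - J y‖) := by
      rw [hg, ← map_sub]
      refine Φ.le_opNorm_of_le (ContinuousLinearMap.opNorm_le_bound _ (by positivity) fun x => ?_)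
      rw [sub_apply, hf]
      refine (hd (β x) (C * ‖x‖) (by positivity) (hβ x) y).trans (le_of_eq ?_)
      ring
    have h2 : ‖Ψ g - g y‖ ≤ ‖Φ‖ * C * ‖v - J y‖ := hd g (‖Φ‖ * C) (by positivity) (fun y => by
      rw [hg, _root_.mul_assoc]
      refine Φ.le_opNorm_of_le (ContinuousLinearMap.opNorm_le_bound _ (by positivity) fun x => ?_)
      exact (hβ x y).trans (le_of_eq (by ring))) y
    calc ‖Φ f - Ψ g‖ = ‖(Φ f - g y) - (Ψ g - g y)‖ := by congr 1; ring
      _ ≤ _ := (norm_sub_le _ _).trans (by linarith)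
  rw [← sub_eq_zero, ← norm_le_zero_iff]
  refine le_of_forall_pos_le_add fun ε hε => ?_
  obtain ⟨_, ⟨y, rfl⟩, hy⟩ := Metric.mem_closure_iff.1 hv (ε / (2 * (‖Φ‖ * C) + 1)) (by positivity)
  rw [dist_eq_norm, lt_div_iff₀ (by positivity)] at hy
  have := key y
  have := norm_nonneg (v - J y)
  linarith

end Represent

/-- The value of the extension of a positive semidefinite form at an element of the bidual. -/
theorem IsPSD.bidual_gram {σ : Y →L⋆[ℂ] Y →L[ℂ] ℂ} (h : IsPSD σ)
    (a : StrongDual ℂ (StrongDual ℂ Y)) (χ : StrongDual ℂ Y) (hχ : ∀ z, χ z = conj (a (σ z))) :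
    ∃ r : ℝ, 0 ≤ r ∧ a χ = r ∧ ∀ (φ : StrongDual ℂ Y) (K : ℝ), 0 ≤ K →
      (∀ y, ‖φ y‖ ^ 2 ≤ K * (σ y y).re) → ‖a φ‖ ^ 2 ≤ K * r := by
  obtain ⟨H, _, _, _, J, hJ⟩ := h.exists_hilbert
  obtain ⟨v, -, hv, hd⟩ := exists_represent J a
  refine ⟨‖v‖ ^ 2, by positivity, ?_, fun φ K hK hφ => ?_⟩
  · have h1 : χ = (innerSL ℂ v).comp J := ContinuousLinearMap.ext fun z => by
      have h2 : σ z = (innerSL ℂ (J z)).comp J := ContinuousLinearMap.ext fun y => (hJ z y).symm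
      rw [hχ, h2, hv, inner_conj_symm]; rfl
    rw [h1, hv, inner_self_eq_norm_sq_to_K]; simp
  -- Comparison with the vector `0` turns the approximation estimate into the bound `|a φ| ≤ √K
  -- ‖v‖`.
  · have h1 : ‖a φ - φ 0‖ ≤ √K * ‖v - J 0‖ := hd φ (√K) (Real.sqrt_nonneg _) (fun y => by
      refine le_of_sq_le_sq ?_ (by positivity)
      rw [mul_pow, Real.sq_sqrt hK, norm_sq_eq_re_inner (𝕜 := ℂ) (J y), hJ]
      exact hφ y) 0
    rw [map_zero, map_zero, sub_zero, sub_zero] at h1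
    calc ‖a φ‖ ^ 2 ≤ (√K * ‖v‖) ^ 2 := by gcongr
      _ = _ := by rw [mul_pow, Real.sq_sqrt hK]

end PSD

section CStarInner

open scoped ComplexOrder

variable {A Y : Type*} [NonUnitalCStarAlgebra A] [NormedAddCommGroup Y] [NormedSpace ℂ Y]
  {ip : Y →L⋆[ℂ] Y →L[ℂ] A} (hip : IsCStarInner ip)

/-- The form `(x, y) ↦ p(⟨x, y⟩)`. -/
def formOf (ip : Y →L⋆[ℂ] Y →L[ℂ] A) (p : StrongDual ℂ A) : Y →L⋆[ℂ] Y →L[ℂ] ℂ :=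
  (ContinuousLinearMap.compL ℂ Y A ℂ p).comp ip

lemma formOf_apply (p : StrongDual ℂ A) (x y : Y) : formOf ip p x y = p (ip x y) := rfl

include hip in
lemma IsCStarInner.isPSD {p : StrongDual ℂ A} (hp : IsPos p) : IsPSD (formOf ip p) where
  symm x y := by rw [formOf_apply, formOf_apply, ← hip.symm x y, hp.map_star]
  nonneg x := by
    obtain ⟨c, hc⟩ := hip.pos x
    rw [formOf_apply, hc]
    exact (Complex.nonneg_iff.1 (hp c)).1

end CStarInner

/-! ### Arens products -/

section Arens

variable {X Y Z V W U X' Y' Z' : Type*} [NormedAddCommGroup X] [NormedSpace ℂ X]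
  [NormedAddCommGroup Y] [NormedSpace ℂ Y] [NormedAddCommGroup Z] [NormedSpace ℂ Z]
  [NormedAddCommGroup V] [NormedSpace ℂ V] [NormedAddCommGroup W] [NormedSpace ℂ W]
  [NormedAddCommGroup U] [NormedSpace ℂ U] [NormedAddCommGroup X'] [NormedSpace ℂ X']
  [NormedAddCommGroup Y'] [NormedSpace ℂ Y'] [NormedAddCommGroup Z'] [NormedSpace ℂ Z']

lemma arens_apply (m : X →L[ℂ] Y →L[ℂ] Z) (Φ : StrongDual ℂ (StrongDual ℂ X))
    (Ψ : StrongDual ℂ (StrongDual ℂ Y)) (φ : StrongDual ℂ Z) :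
    arens m Φ Ψ φ = Φ (arensAux m Ψ φ) := rfl

lemma bidualInv_apply (σ : X →L⋆[ℂ] Y) (Φ : StrongDual ℂ (StrongDual ℂ X)) (φ : StrongDual ℂ Y) :
    bidualInv σ Φ φ = conj (Φ (conjDualL σ φ)) := rfl

lemma arens_add_left (m : X →L[ℂ] Y →L[ℂ] Z) (Φ Φ' : StrongDual ℂ (StrongDual ℂ X))
    (Ψ : StrongDual ℂ (StrongDual ℂ Y)) : arens m (Φ + Φ') Ψ = arens m Φ Ψ + arens m Φ' Ψ := rfl

lemma arens_smul_left (m : X →L[ℂ] Y →L[ℂ] Z) (z : ℂ) (Φ : StrongDual ℂ (StrongDual ℂ X))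
    (Ψ : StrongDual ℂ (StrongDual ℂ Y)) : arens m (z • Φ) Ψ = z • arens m Φ Ψ := rfl

lemma arens_add_right (m : X →L[ℂ] Y →L[ℂ] Z) (Φ : StrongDual ℂ (StrongDual ℂ X))
    (Ψ Ψ' : StrongDual ℂ (StrongDual ℂ Y)) :
    arens m Φ (Ψ + Ψ') = arens m Φ Ψ + arens m Φ Ψ' := by
  ext φ
  rw [add_apply, arens_apply, arens_apply, arens_apply, ← map_add]; rfl

lemma arens_smul_right (m : X →L[ℂ] Y →L[ℂ] Z) (z : ℂ) (Φ : StrongDual ℂ (StrongDual ℂ X))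
    (Ψ : StrongDual ℂ (StrongDual ℂ Y)) : arens m Φ (z • Ψ) = z • arens m Φ Ψ := by
  ext φ
  rw [smul_apply, arens_apply, arens_apply, ← map_smul]; rfl

lemma arens_zero_right (m : X →L[ℂ] Y →L[ℂ] Z) (Φ : StrongDual ℂ (StrongDual ℂ X)) :
    arens m Φ 0 = 0 := by
  ext φ
  have h : arensAux m (0 : StrongDual ℂ (StrongDual ℂ Y)) φ = 0 := by ext x; rfl
  rw [arens_apply, h, map_zero]; rfl

lemma arens_assoc (m₁ : X →L[ℂ] Y →L[ℂ] V) (m₂ : V →L[ℂ] Z →L[ℂ] W) (m₃ : Y →L[ℂ] Z →L[ℂ] U)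
    (m₄ : X →L[ℂ] U →L[ℂ] W) (h : ∀ x y z, m₂ (m₁ x y) z = m₄ x (m₃ y z))
    (a : StrongDual ℂ (StrongDual ℂ X)) (b : StrongDual ℂ (StrongDual ℂ Y))
    (c : StrongDual ℂ (StrongDual ℂ Z)) :
    arens m₂ (arens m₁ a b) c = arens m₄ a (arens m₃ b c) := by
  ext φ
  simp only [arens_apply]
  congr 1
  ext x
  simp only [arensAux_apply, arens_apply]
  congr 1
  ext y
  simp only [arensAux_apply, ContinuousLinearMap.comp_apply]
  congr 1
  ext z
  simp [h]

lemma norm_arens_le (m : X →L[ℂ] Y →L[ℂ] Z) (hm : ∀ x y, ‖m x y‖ ≤ ‖x‖ * ‖y‖)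
    (Φ : StrongDual ℂ (StrongDual ℂ X)) (Ψ : StrongDual ℂ (StrongDual ℂ Y)) :
    ‖arens m Φ Ψ‖ ≤ ‖Φ‖ * ‖Ψ‖ := by
  refine ContinuousLinearMap.opNorm_le_bound _ (by positivity) fun φ => ?_
  rw [arens_apply, _root_.mul_assoc]
  refine Φ.le_opNorm_of_le (ContinuousLinearMap.opNorm_le_bound _ (by positivity) fun x => ?_)
  rw [arensAux_apply, _root_.mul_assoc]
  refine Ψ.le_opNorm_of_le (ContinuousLinearMap.opNorm_le_bound _ (by positivity) fun y => ?_)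
  rw [_root_.mul_assoc]
  exact φ.le_opNorm_of_le (hm x y)

lemma bidualInv_add (σ : X →L⋆[ℂ] Y) (Φ Ψ : StrongDual ℂ (StrongDual ℂ X)) :
    bidualInv σ (Φ + Ψ) = bidualInv σ Φ + bidualInv σ Ψ := by
  ext φ; simp [bidualInv_apply]

lemma bidualInv_smul (σ : X →L⋆[ℂ] Y) (z : ℂ) (Φ : StrongDual ℂ (StrongDual ℂ X)) :
    bidualInv σ (z • Φ) = conj z • bidualInv σ Φ := by
  ext φ; simp [bidualInv_apply]

lemma bidualInv_bidualInv (σ : X →L⋆[ℂ] Y) (τ : Y →L⋆[ℂ] X) (h : ∀ x, τ (σ x) = x)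
    (Φ : StrongDual ℂ (StrongDual ℂ X)) : bidualInv τ (bidualInv σ Φ) = Φ := by
  ext φ
  rw [bidualInv_apply, bidualInv_apply, Complex.conj_conj]
  congr 1
  ext x
  simp [h]

lemma norm_bidualInv_le (σ : X →L⋆[ℂ] Y) (hσ : ∀ x, ‖σ x‖ ≤ ‖x‖)
    (Φ : StrongDual ℂ (StrongDual ℂ X)) : ‖bidualInv σ Φ‖ ≤ ‖Φ‖ := by
  refine ContinuousLinearMap.opNorm_le_bound _ (by positivity) fun φ => ?_
  rw [bidualInv_apply, RCLike.norm_conj]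
  refine Φ.le_opNorm_of_le (ContinuousLinearMap.opNorm_le_bound _ (by positivity) fun x => ?_)
  rw [conjDualL_apply, RCLike.norm_conj]
  exact φ.le_opNorm_of_le (hσ x)

/-- `m` is Arens regular. -/
def IsRegular (m : X →L[ℂ] Y →L[ℂ] Z) : Prop :=
  ∀ (Φ : StrongDual ℂ (StrongDual ℂ X)) (Ψ : StrongDual ℂ (StrongDual ℂ Y)) (φ : StrongDual ℂ Z),
    arens m Φ Ψ φ = Ψ (arensAux m.flip Φ φ)

/-- An involution that reverses products carries the first Arens extension to the second one.
Regularity says that the two coincide. -/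
lemma IsRegular.bidualInv_arens {m : X →L[ℂ] Y →L[ℂ] Z} (hm : IsRegular m)
    (m' : Y' →L[ℂ] X' →L[ℂ] Z') (σX : X →L⋆[ℂ] X') (σY : Y →L⋆[ℂ] Y') (σZ : Z →L⋆[ℂ] Z')
    (h : ∀ x y, σZ (m x y) = m' (σY y) (σX x)) (Φ : StrongDual ℂ (StrongDual ℂ X))
    (Ψ : StrongDual ℂ (StrongDual ℂ Y)) :
    bidualInv σZ (arens m Φ Ψ) = arens m' (bidualInv σY Ψ) (bidualInv σX Φ) := by
  ext φ
  rw [bidualInv_apply, hm, arens_apply, bidualInv_apply]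
  congr 2
  ext y
  rw [arensAux_apply, conjDualL_apply, arensAux_apply, bidualInv_apply, Complex.conj_conj]
  congr 1
  ext x
  simp [h]

end Arens

/-! ### Arens regularity and positivity from domination -/

section Regular

variable {A X Y Z : Type*} [NonUnitalCStarAlgebra A] [NormedAddCommGroup X] [NormedSpace ℂ X]
  [NormedAddCommGroup Y] [NormedSpace ℂ Y] [NormedAddCommGroup Z] [NormedSpace ℂ Z]

/-- A functional `φ` on `Z` is dominated by some `p(⟨z, z⟩)`, and `hm` transfers this to `|φ(m x y)|
≤ ‖x‖ ‖J y‖`, where `J` maps `Y` to the Hilbert space of `p`. So `φ ∘ m` factors through a Hilbert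
space and `bidual_swap` applies. -/
theorem isRegular_of_dominated {ipY : Y →L⋆[ℂ] Y →L[ℂ] A} {ipZ : Z →L⋆[ℂ] Z →L[ℂ] A}
    (hY : IsCStarInner ipY) (hZ : IsCStarInner ipZ) (m : X →L[ℂ] Y →L[ℂ] Z)
    (hm : ∀ p : StrongDual ℂ A, IsPos p → ∀ x y,
      (p (ipZ (m x y) (m x y))).re ≤ ‖x‖ ^ 2 * (p (ipY y y)).re) : IsRegular m := by
  intro Φ Ψ φ
  obtain ⟨p, -, hp, hφ⟩ := hZ.exists_dominating φ
  obtain ⟨H, _, _, _, J, hJ⟩ := (hY.isPSD hp).exists_hilbert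
  refine bidual_swap J ((ContinuousLinearMap.compL ℂ Y Z ℂ φ).comp m) 1 zero_le_one
    (fun x y => ?_) Φ Ψ _ _ (fun x => rfl) fun y => rfl
  refine le_of_sq_le_sq ?_ (by positivity)
  rw [one_mul, mul_pow, norm_sq_eq_re_inner (𝕜 := ℂ) (J y), hJ]
  exact (hφ _).trans (hm p hp x y)

variable {W : Type*} [NormedAddCommGroup W] [NormedSpace ℂ W] {σ : Y →L⋆[ℂ] W}
  {m : W →L[ℂ] Y →L[ℂ] A}

/-- The value of `a* a` at `p` is the squared norm of the vector representing `a` in the Hilbert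
space of `p`. The last clause is Cauchy–Schwarz in that space. -/
lemma arens_inv_self_pos (hip : IsCStarInner (m.comp σ)) (a : StrongDual ℂ (StrongDual ℂ Y))
    {p : StrongDual ℂ A} (hp : IsPos p) :
    ∃ r : ℝ, 0 ≤ r ∧ arens m (bidualInv σ a) a p = r ∧ ∀ (φ : StrongDual ℂ Y) (K : ℝ), 0 ≤ K →
      (∀ y, ‖φ y‖ ^ 2 ≤ K * (p (m (σ y) y)).re) → ‖a φ‖ ^ 2 ≤ K * r := by
  obtain ⟨r, hr, h1, h2⟩ := (hip.isPSD hp).bidual_gram a (conjDualL σ (arensAux m a p))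
    fun z => rfl
  exact ⟨r, hr, by rw [arens_apply, bidualInv_apply, h1, Complex.conj_ofReal], h2⟩

/-- The domination `|φ(y)|² ≤ p(y* y)` survives the passage to the bidual, with the same `p` for all
`a`. -/
lemma exists_norm_sq_le_arens (hip : IsCStarInner (m.comp σ)) (φ : StrongDual ℂ Y) :
    ∃ p : StrongDual ℂ A, ‖p‖ ≤ ‖φ‖ ^ 2 ∧ IsPos p ∧ ∀ a : StrongDual ℂ (StrongDual ℂ Y),
      ‖a φ‖ ^ 2 ≤ (arens m (bidualInv σ a) a p).re := by
  obtain ⟨p, hpn, hp, hφ⟩ := hip.exists_dominating φ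
  refine ⟨p, hpn, hp, fun a => ?_⟩
  obtain ⟨r, hr, h1, h2⟩ := arens_inv_self_pos hip a hp
  rw [h1]
  simpa using h2 φ 1 zero_le_one fun y => by simpa using hφ y

/-- The nontrivial half of the C*-identity in the bidual; the control `‖p‖ ≤ ‖φ‖²` of the dominating
functional is what gives the constant one. -/
lemma sq_norm_le_arens (hip : IsCStarInner (m.comp σ)) (a : StrongDual ℂ (StrongDual ℂ Y)) :
    ‖a‖ ^ 2 ≤ ‖arens m (bidualInv σ a) a‖ := by
  have h : ‖a‖ ≤ √‖arens m (bidualInv σ a) a‖ := by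
    refine ContinuousLinearMap.opNorm_le_bound _ (Real.sqrt_nonneg _) fun φ => ?_
    obtain ⟨p, hpn, hp, hφ⟩ := exists_norm_sq_le_arens hip φ
    refine le_of_sq_le_sq ?_ (by positivity)
    rw [mul_pow, Real.sq_sqrt (norm_nonneg (arens m (bidualInv σ a) a))]
    refine (hφ a).trans ((Complex.re_le_norm _).trans ?_)
    exact ContinuousLinearMap.le_opNorm_of_le _ hpn
  calc ‖a‖ ^ 2 ≤ (√‖arens m (bidualInv σ a) a‖) ^ 2 := by gcongr
    _ = _ := Real.sq_sqrt (norm_nonneg (arens m (bidualInv σ a) a))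

end Regular

/-! ### The bidual of a C*-algebra as a C*-algebra -/

section CStarBidual

variable (A : Type*) [NonUnitalCStarAlgebra A]

lemma isCStarInner_mul : IsCStarInner ((ContinuousLinearMap.mul ℂ A).comp
    ((starL ℂ : A ≃L⋆[ℂ] A) : A →L⋆[ℂ] A)) where
  symm x y := by simp
  pos x := ⟨x, rfl⟩
  norm_self x := by
    rw [sq]
    exact CStarRing.norm_star_mul_self

/-- The required domination is `y* (x* x) y ≤ ‖x‖² y* y`. -/
lemma isRegular_mul : IsRegular (ContinuousLinearMap.mul ℂ A) :=
  isRegular_of_dominated (isCStarInner_mul A) (isCStarInner_mul A) _ fun p hp x y => by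
    let _ : PartialOrder A := CStarAlgebra.spectralOrder A
    have : StarOrderedRing A := CStarAlgebra.spectralOrderedRing A
    have h1 : star y * (star x * x) * y ≤ ‖star x * x‖ • (star y * y) :=
      CStarAlgebra.star_left_conjugate_le_norm_smul
    have h2 := hp.nonneg (sub_nonneg.2 h1)
    rw [map_sub, Complex.nonneg_iff, Complex.sub_re] at h2
    have h3 : p (‖star x * x‖ • (star y * y)) = ((‖x‖ ^ 2 : ℝ) : ℂ) * p (star y * y) := by
      rw [CStarRing.norm_star_mul_self, ← sq, ← Complex.coe_smul, map_smul, smul_eq_mul]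
    rw [h3, Complex.re_ofReal_mul] at h2
    have h4 : star (x * y) * (x * y) = star y * (star x * x) * y := by
      rw [star_mul]; simp only [_root_.mul_assoc]
    change (p (star (x * y) * (x * y))).re ≤ ‖x‖ ^ 2 * (p (star y * y)).re
    rw [h4]
    linarith [h2.1]

/-- The bidual of a C*-algebra with its norm and the Arens product. -/
def CStarBidual : Type _ := StrongDual ℂ (StrongDual ℂ A)

namespace CStarBidual

instance : NormedAddCommGroup (CStarBidual A) :=
  inferInstanceAs (NormedAddCommGroup (StrongDual ℂ (StrongDual ℂ A)))
instance : NormedSpace ℂ (CStarBidual A) :=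
  inferInstanceAs (NormedSpace ℂ (StrongDual ℂ (StrongDual ℂ A)))
instance : CompleteSpace (CStarBidual A) :=
  inferInstanceAs (CompleteSpace (StrongDual ℂ (StrongDual ℂ A)))
instance : Mul (CStarBidual A) := ⟨arens (ContinuousLinearMap.mul ℂ A)⟩
instance : Star (CStarBidual A) := ⟨bidualInv ((starL ℂ : A ≃L⋆[ℂ] A) : A →L⋆[ℂ] A)⟩

instance : NonUnitalCStarAlgebra (CStarBidual A) where
  __ := (inferInstance : NormedAddCommGroup (CStarBidual A))
  __ := (inferInstance : NormedSpace ℂ (CStarBidual A))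
  dist_eq := dist_eq_norm_neg_add
  left_distrib := arens_add_right _
  right_distrib := arens_add_left _
  zero_mul _ := rfl
  mul_zero := arens_zero_right _
  mul_assoc := arens_assoc _ _ _ _ fun x y z => _root_.mul_assoc x y z
  norm_mul_le := norm_arens_le _ norm_mul_le
  star_involutive := bidualInv_bidualInv _ _ star_star
  star_mul := (isRegular_mul A).bidualInv_arens _ _ _ _ star_mul
  star_add := bidualInv_add _
  complete := (inferInstance : CompleteSpace (CStarBidual A)).complete
  norm_mul_self_le a := by
    have := sq_norm_le_arens (isCStarInner_mul A) a
    exact (sq ‖a‖ ▸ this)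
  smul_assoc := arens_smul_left _
  smul_comm z a b := (arens_smul_right _ z a b).symm
  star_smul := bidualInv_smul _

end CStarBidual

end CStarBidual

/-! ### Square roots by functional calculus -/

section

variable {A : Type*} [NonUnitalCStarAlgebra A] [PartialOrder A] [StarOrderedRing A]

/-- Take `d = √(‖h‖ - h) - √‖h‖`, so that `(√‖h‖ + d)² = ‖h‖ - h`. The function vanishes at `0`,
hence `d` exists without a unit; it stands in for the square root of `‖h‖ - h` in the unitization.
-/
lemma exists_add_mul_self_eq_neg {h : A} (hh : 0 ≤ h) :
    ∃ d : A, star d = d ∧ (2 * √‖h‖) • d + d * d = -h := by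
  have hsa : IsSelfAdjoint h := .of_nonneg hh
  let f : ℝ → ℝ := fun t => √(‖h‖ - t) - √‖h‖
  have hf : Continuous f := by fun_prop
  have hf0 : f 0 = 0 := by simp [f]
  refine ⟨cfcₙ f h, cfcₙ_predicate f h, ?_⟩
  rw [← cfcₙ_const_mul _ f h hf.continuousOn hf0,
    ← cfcₙ_mul f f h hf.continuousOn hf0 hf.continuousOn hf0,
    ← cfcₙ_add (a := h) (fun t => 2 * √‖h‖ * f t) (fun t => f t * f t) (by fun_prop)
      (by simp [hf0]) (by fun_prop) (by simp [hf0]), ← cfcₙ_neg_id (R := ℝ) h]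
  refine cfcₙ_congr fun t ht => ?_
  have h1 : ‖t‖ ≤ ‖h‖ := by
    have := norm_apply_le_norm_cfcₙ (id : ℝ → ℝ) h ht
    rwa [cfcₙ_id ℝ h] at this
  have h2 : 0 ≤ ‖h‖ - t := sub_nonneg.2 ((le_abs_self t).trans h1)
  have h3 := Real.mul_self_sqrt h2
  have h4 := Real.mul_self_sqrt (norm_nonneg h)
  simp only [f]
  linear_combination h3 - h4

lemma exists_eq_star_mul_self {h : A} (hh : 0 ≤ h) : ∃ d : A, h = star d * d :=
  CStarAlgebra.nonneg_iff_eq_star_mul_self.1 hh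

end

/-! ### The fibres of a Fell bundle -/

section Fibre

variable {G : Type v} [Group G] {B : G → Type u} [∀ t, NormedAddCommGroup (B t)]
  [∀ t, NormedSpace ℂ (B t)] [FellOps B] [FellBundle B]

/-- The multiplication with values in the unit fibre. -/
def mulU {s t : G} (h : s * t = 1) : B s →L[ℂ] B t →L[ℂ] UnitFibre B := mulL h

/-- The inner product `(a, b) ↦ a* b` on a fibre. -/
def fibInner {s t : G} (h : s⁻¹ = t) (h' : t * s = 1) : B s →L⋆[ℂ] B s →L[ℂ] UnitFibre B :=
  (mulU h').comp (invL h)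

lemma fibInner_apply {s t : G} (h : s⁻¹ = t) (h' : t * s = 1) (a b : B s) :
    fibInner h h' a b = mul h' (inv h a) b := rfl

lemma isCStarInner_fibInner {s t : G} (h : s⁻¹ = t) (h' : t * s = 1) :
    IsCStarInner (fibInner (B := B) h h') where
  symm x y := by
    have h1 := FellBundle.inv_mul (B := B) h' (by rw [← h, _root_.inv_inv]) h (inv_one (G := G))
      h' (inv h x) y
    rw [FellBundle.inv_inv] at h1
    exact h1
  pos x := FellBundle.inv_mul_self_pos h h' x
  norm_self x := FellBundle.norm_inv_mul_self h h' x

/-- The inequality `(xy)* (xy) ≤ ‖x‖² y* y` is not a statement about conjugation inside one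
C*-algebra, as `x` and `y` lie in different fibres. Instead the difference of the two sides is
exhibited as `z* z` for a vector `z` of the fibre of `y`, where positivity is an axiom. -/
lemma re_apply_mul_le {s t u t' u' : G} (h : s * t = u) (ht : t⁻¹ = t') (ht' : t' * t = 1)
    (hu : u⁻¹ = u') (hu' : u' * u = 1) {p : StrongDual ℂ (UnitFibre B)} (hp : IsPos p) (x : B s)
    (y : B t) : (p (fibInner hu hu' (mul h x y) (mul h x y))).re ≤
      ‖x‖ ^ 2 * (p (fibInner ht ht' y y)).re := by
  let _ : PartialOrder (UnitFibre B) := CStarAlgebra.spectralOrder (UnitFibre B)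
  have : StarOrderedRing (UnitFibre B) := CStarAlgebra.spectralOrderedRing (UnitFibre B)
  have hx := isCStarInner_fibInner (B := B) (rfl : s⁻¹ = _) (inv_mul_cancel s)
  have hy := isCStarInner_fibInner (B := B) ht ht'
  set c : UnitFibre B := fibInner rfl (inv_mul_cancel s) x x with hc
  obtain ⟨d, hd, hd'⟩ := exists_add_mul_self_eq_neg (hx.nonneg x)
  rw [← hc] at hd'
  have hcn : ‖c‖ = ‖x‖ ^ 2 := hx.norm_self x
  let L : UnitFibre B →L[ℂ] UnitFibre B :=
    (mulU ht' (inv ht y)).comp ((mulL (B := B) (one_mul t)).flip y)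
  have hL : ∀ a : UnitFibre B, L a = mul (B := B) ht' (inv ht y) (mul (B := B) (one_mul t) a y) :=
    fun a => rfl
  have hinv : ∀ a : UnitFibre B, inv ht (mul (B := B) (one_mul t) a y) =
      mul (B := B) (mul_one t') (inv ht y) (star a : UnitFibre B) := fun a =>
    FellBundle.inv_mul (B := B) (one_mul t) inv_one ht ht (mul_one t') a y
  -- Formally `z = (‖c‖ - c)^{1/2} y` with `c = x* x`, so that `z* z = ‖x‖² y* y - y* c y`.
  let z : B t := ((√‖c‖ : ℝ) : ℂ) • y + mul (B := B) (one_mul t) d y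
  have h1 : fibInner ht ht' y (mul (B := B) (one_mul t) d y) = L d := rfl
  have h2 : fibInner ht ht' (mul (B := B) (one_mul t) d y) y = L d := by
    rw [fibInner_apply, hinv, hd, hL]
    exact FellBundle.mul_assoc _ _ _ _ _ _ _
  have h3 : fibInner ht ht' (mul (B := B) (one_mul t) d y) (mul (B := B) (one_mul t) d y) =
      L (d * d) := by
    rw [fibInner_apply, hinv, hd, hL]
    refine (FellBundle.mul_assoc (B := B) (mul_one t') ht' (one_mul t) ht' _ _ _).trans ?_
    congr 1
    exact (FellBundle.mul_assoc (B := B) (one_mul 1) (one_mul t) (one_mul t) (one_mul t) _ _ _).symm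
  have h4 : fibInner hu hu' (mul h x y) (mul h x y) = L c := by
    have e : t' * s⁻¹ = u' := by rw [← ht, ← hu, ← h, mul_inv_rev]
    have e2 : s⁻¹ * u = t := by rw [← h, inv_mul_cancel_left]
    rw [fibInner_apply, hL, FellBundle.inv_mul h rfl ht hu e]
    refine (FellBundle.mul_assoc (B := B) e hu' e2 ht' _ _ _).trans ?_
    congr 1
    exact (FellBundle.mul_assoc (B := B) (inv_mul_cancel s) (one_mul t) h e2 _ _ _).symm
  have h5 : fibInner ht ht' z z = ((‖c‖ : ℝ) : ℂ) • fibInner ht ht' y y +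
      L ((2 * √‖c‖) • d + d * d) := by
    have e : ((‖c‖ : ℝ) : ℂ) = ((√‖c‖ : ℝ) : ℂ) * ((√‖c‖ : ℝ) : ℂ) := by
      rw [← Complex.ofReal_mul, Real.mul_self_sqrt (norm_nonneg c)]
    rw [← Complex.coe_smul (2 * √‖c‖) d, e]
    simp only [z, map_add, map_smulₛₗ, add_apply, smul_apply, h1, h2, h3, Complex.conj_ofReal,
      RingHom.id_apply]
    push_cast
    module
  rw [hd', map_neg, ← sub_eq_add_neg, hcn] at h5
  obtain ⟨e, he⟩ := hy.pos z
  have h6 := (Complex.nonneg_iff.1 (hp e)).1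
  rw [← he, h5, map_sub, map_smul, smul_eq_mul, Complex.sub_re, Complex.re_ofReal_mul] at h6
  rw [h4]
  linarith

theorem isRegular_mulL {s t u : G} (h : s * t = u) : IsRegular (mulL (B := B) h) :=
  isRegular_of_dominated (isCStarInner_fibInner rfl (inv_mul_cancel t))
    (isCStarInner_fibInner rfl (inv_mul_cancel u)) _ fun _ hp x y =>
      re_apply_mul_le h rfl (inv_mul_cancel t) rfl (inv_mul_cancel u) hp x y

end Fibre

/-! ### The enveloping W*-Fell bundle -/

section Bidual

variable {G : Type v} [Group G] (B : G → Type u) [∀ t, NormedAddCommGroup (B t)]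
  [∀ t, NormedSpace ℂ (B t)] [FellOps B] [FellBundle B]

namespace Bidual

variable {B}

protected lemma mul_assoc {r s t rs st u : G} (h₁ : r * s = rs) (h₂ : rs * t = u) (h₃ : s * t = st)
    (h₄ : r * st = u) (a : Bidual B r) (b : Bidual B s) (c : Bidual B t) :
    mul h₂ (mul h₁ a b) c = mul h₄ a (mul h₃ b c) :=
  arens_assoc _ _ _ _ (fun x y z => FellBundle.mul_assoc h₁ h₂ h₃ h₄ x y z) a b c

protected lemma inv_inv {s t : G} (h : s⁻¹ = t) (h' : t⁻¹ = s) (a : Bidual B s) :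
    inv h' (inv h a) = a :=
  bidualInv_bidualInv _ _ (FellBundle.inv_inv h h') a

protected lemma inv_mul {s t u s' t' u' : G} (h : s * t = u) (hs : s⁻¹ = s') (ht : t⁻¹ = t')
    (hu : u⁻¹ = u') (h' : t' * s' = u') (a : Bidual B s) (b : Bidual B t) :
    inv hu (mul h a b) = mul h' (inv ht b) (inv hs a) :=
  (isRegular_mulL h).bidualInv_arens _ _ _ _ (FellBundle.inv_mul h hs ht hu h') a b

protected lemma norm_mul_le {s t u : G} (h : s * t = u) (a : Bidual B s) (b : Bidual B t) :
    ‖mul h a b‖ ≤ ‖a‖ * ‖b‖ := norm_arens_le _ (FellBundle.norm_mul_le h) a b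

lemma norm_inv_le {s t : G} (h : s⁻¹ = t) (a : Bidual B s) : ‖inv h a‖ ≤ ‖a‖ :=
  norm_bidualInv_le _ (fun x => (norm_inv h x).le) a

protected lemma norm_inv_mul_self {s t u : G} (h : s⁻¹ = t) (h' : t * s = u) (a : Bidual B s) :
    ‖mul h' (inv h a) a‖ = ‖a‖ ^ 2 := by
  obtain rfl : u = 1 := by rw [← h', ← h, inv_mul_cancel]
  refine le_antisymm ?_ (sq_norm_le_arens (isCStarInner_fibInner h h') a)
  refine (Bidual.norm_mul_le h' _ _).trans ?_
  rw [sq]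
  gcongr
  exact norm_inv_le h a

/-- The unit fibre of the bidual bundle is the bidual of the unit fibre. -/
def toCStar (a : Bidual B 1) : CStarBidual (UnitFibre B) := a

/-- An element of the bidual of the unit fibre. -/
def ofCStar (a : CStarBidual (UnitFibre B)) : Bidual B 1 := a

/-- Let `x = a* a`, with negative part `n = d* d`, and put `b = a n`. Then `b* b = n x n = -n³ =
-(dn)* (dn)`. Values of `b* b` at positive functionals are nonnegative, so `dn = 0`, whence `n* n =
d* (dn) = 0` and `x` is positive. -/
protected lemma inv_mul_self_pos {s t : G} (h : s⁻¹ = t) (h' : t * s = 1) (a : Bidual B s) :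
    ∃ c : Bidual B 1, mul h' (inv h a) a = mul (one_mul 1) (inv inv_one c) c := by
  let N := CStarBidual (UnitFibre B)
  let _ : PartialOrder N := CStarAlgebra.spectralOrder N
  have : StarOrderedRing N := CStarAlgebra.spectralOrderedRing N
  let x : N := toCStar (mul h' (inv h a) a)
  have ht : t⁻¹ = s := by rw [← h, _root_.inv_inv]
  have hx : IsSelfAdjoint x := by
    change inv (B := Bidual B) inv_one (mul h' (inv h a) a) = mul h' (inv h a) a
    rw [Bidual.inv_mul h' ht h inv_one h', Bidual.inv_inv]
  suffices hn : x⁻ = 0 by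
    have h0 : 0 ≤ x := by
      rw [← CFC.posPart_sub_negPart x hx, hn, sub_zero]
      exact CFC.posPart_nonneg x
    obtain ⟨c, hc⟩ := exists_eq_star_mul_self h0
    exact ⟨ofCStar c, hc⟩
  obtain ⟨d, hd⟩ := exists_eq_star_mul_self (CFC.negPart_nonneg x)
  let n : Bidual B 1 := ofCStar x⁻
  let b : Bidual B s := mul (mul_one s) a n
  have hnn : star x⁻ = x⁻ := by rw [hd, star_mul, star_star]
  have hb : toCStar (mul h' (inv h b) b) = -(star (d * x⁻) * (d * x⁻)) := by
    have e1 : toCStar (mul h' (inv h b) b) = star x⁻ * (x * x⁻) := by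
      have e2 : inv h b = mul (one_mul t) (inv inv_one n) (inv h a) :=
        Bidual.inv_mul _ _ _ _ _ _ _
      rw [e2]
      refine (Bidual.mul_assoc (one_mul t) h' h' (one_mul 1) _ _ _).trans ?_
      have e3 : mul h' (inv h a) b = mul (one_mul 1) (mul h' (inv h a) a) n :=
        (Bidual.mul_assoc h' (one_mul 1) (mul_one s) h' _ _ _).symm
      rw [e3]
      rfl
    have e4 : x * x⁻ = -(x⁻ * x⁻) := by
      calc x * x⁻ = (x⁺ - x⁻) * x⁻ := by rw [CFC.posPart_sub_negPart x hx]
        _ = _ := by rw [sub_mul, CFC.posPart_mul_negPart, zero_sub]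
    rw [e1, e4, hnn, star_mul, hnn, mul_neg, _root_.mul_assoc, ← _root_.mul_assoc (star d), ← hd]
  have hdx : d * x⁻ = 0 := by
    refine ContinuousLinearMap.ext fun φ => ?_
    -- For `p` dominating `φ`, the value of `(dn)* (dn)` at `p` bounds `|φ(dn)|²` and equals `-r`
    -- with `r ≥ 0`.
    obtain ⟨p, -, hp, hφ⟩ := exists_norm_sq_le_arens (isCStarInner_mul (UnitFibre B)) φ
    obtain ⟨r, hr, hr', -⟩ := arens_inv_self_pos (isCStarInner_fibInner h h') b hp
    have h1 := hφ (d * x⁻)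
    have h2 : arens (ContinuousLinearMap.mul ℂ (UnitFibre B)) (bidualInv
        ((starL ℂ : UnitFibre B ≃L⋆[ℂ] UnitFibre B) : UnitFibre B →L⋆[ℂ] UnitFibre B) (d * x⁻))
        (d * x⁻) p = -(r : ℂ) := by
      rw [← hr']
      have := congrArg (fun F : StrongDual ℂ (StrongDual ℂ (UnitFibre B)) => F p) hb
      exact neg_eq_iff_eq_neg.1 this.symm
    rw [h2] at h1
    have h3 : (-(r : ℂ)).re = -r := by simp
    rw [h3] at h1
    exact norm_eq_zero.1 (pow_eq_zero_iff two_ne_zero |>.1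
      (le_antisymm (h1.trans (by linarith)) (sq_nonneg _)))
  have h5 : star x⁻ * x⁻ = 0 := by
    rw [hnn]
    nth_rewrite 1 [hd]
    rw [_root_.mul_assoc, hdx, mul_zero]
  exact CStarRing.star_mul_self_eq_zero_iff _ |>.1 h5

end Bidual

theorem wStarFellBundle_bidual : WStarFellBundle (Bidual B) where
  complete t := inferInstanceAs (CompleteSpace (StrongDual ℂ (StrongDual ℂ (B t))))
  mul_add h := arens_add_right _
  add_mul h := arens_add_left _
  smul_mul h := arens_smul_left _
  mul_smul h := arens_smul_right _
  mul_assoc := Bidual.mul_assoc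
  inv_add h := bidualInv_add _
  inv_smul h := bidualInv_smul _
  inv_inv := Bidual.inv_inv
  inv_mul := Bidual.inv_mul
  norm_mul_le := Bidual.norm_mul_le
  norm_inv_mul_self := Bidual.norm_inv_mul_self
  inv_mul_self_pos := Bidual.inv_mul_self_pos
  continuous_inv {s t} h := by
    let _ : TopologicalSpace (Bidual B s) := weakStar (Bidual B) s
    refine continuous_induced_rng.2 (continuous_pi fun φ => ?_)
    exact Complex.continuous_conj.comp
      ((continuous_apply (conjDualL (invL h) φ)).comp continuous_induced_dom)
  continuous_mul {s t u} h a := by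
    let _ : TopologicalSpace (Bidual B t) := weakStar (Bidual B) t
    refine continuous_induced_rng.2 (continuous_pi fun φ => ?_)
    -- By its construction this Arens product is weak*-continuous in the left factor only.
    -- Regularity rewrites it as the evaluation of `b` at a fixed functional.
    have h1 : (fun b : Bidual B t => arens (mulL h) a b φ) =
        fun b : Bidual B t => toDual (M := Bidual B) t b (arensAux (mulL h).flip a φ) :=
      funext fun b => isRegular_mulL h a b φ
    change Continuous fun b : Bidual B t => arens (mulL h) a b φ
    rw [h1]
    exact (continuous_apply (arensAux (mulL h).flip a φ)).comp continuous_induced_dom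

end Bidual

/-! ### Norms on `ℓ²_{w*}` -/

section Ell2

variable {G : Type v} [Group G] {M : G → Type u} [∀ t, NormedAddCommGroup (M t)]
  [∀ t, NormedSpace ℂ (M t)] [FellOps M] [FellBundle M]

lemma tendsto_ip {ι : Type*} {l : Filter ι} {x y : ι → ∀ t, M t} {x' y' : ∀ t, M t} (t : G)
    (hx : Filter.Tendsto (fun i => x i t) l (𝓝 (x' t)))
    (hy : Filter.Tendsto (fun i => y i t) l (𝓝 (y' t))) :
    Filter.Tendsto (fun i => ip (x i) (y i) t) l (𝓝 (ip x' y' t)) := by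
  have h1 : Filter.Tendsto (fun i => invL (B := M) rfl (x i t)) l (𝓝 (invL (B := M) rfl (x' t))) :=
    ((invL (B := M) (rfl : t⁻¹ = _)).continuous.tendsto _).comp hx
  exact ((mulL (B := M) (inv_mul_cancel t)).continuous₂.tendsto
    (invL (B := M) rfl (x' t), y' t)).comp (h1.prodMk_nhds hy)

lemma tendsto_fip {ι : Type*} {l : Filter ι} {x y : ι → ∀ t, M t} {x' y' : ∀ t, M t}
    (F : Finset G) (hx : ∀ t, Filter.Tendsto (fun i => x i t) l (𝓝 (x' t)))
    (hy : ∀ t, Filter.Tendsto (fun i => y i t) l (𝓝 (y' t))) :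
    Filter.Tendsto (fun i => fip F (x i) (y i)) l (𝓝 (fip F x' y')) :=
  tendsto_finsetSum _ fun t _ => tendsto_ip t (hx t) (hy t)

namespace Ell2

lemma norm_fip_self_le (ξ : Ell2 M) (F : Finset G) : ‖fip F ξ.val ξ.val‖ ≤ ‖ξ‖ ^ 2 := by
  have h := sqrt_fip_le ξ F
  rwa [Real.sqrt_le_left (norm_nonneg _)] at h

/-- The limit is taken fibrewise. Finite inner products are continuous for fibrewise norm
convergence, so bounds on all finite sums pass to the limit. -/
instance : CompleteSpace (Ell2 M) := by
  refine Metric.complete_of_cauchySeq_tendsto fun w hw => ?_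
  have hpt : ∀ t, ∃ x : M t, Filter.Tendsto (fun n => (w n).val t) Filter.atTop (𝓝 x) := fun t => by
    have : CompleteSpace (M t) := FellBundle.complete t
    refine cauchySeq_tendsto_of_complete ?_
    rw [Metric.cauchySeq_iff] at hw ⊢
    intro ε hε
    obtain ⟨N, hN⟩ := hw ε hε
    refine ⟨N, fun m hm n hn => (dist_eq_norm _ _).trans_lt ?_⟩
    exact (norm_val_le (w m - w n) t).trans_lt ((dist_eq_norm _ _).symm.trans_lt (hN m hm n hn))
  choose x hx using hpt
  obtain ⟨C, hC⟩ := hw.norm_bddAbove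
  have hC' : ∀ n, ‖w n‖ ≤ C := fun n => hC (Set.mem_range_self n)
  have hmem : x ∈ ell2Submodule M := ⟨C ^ 2, fun F => le_of_tendsto (tendsto_fip F hx hx).norm
    (.of_forall fun n => (norm_fip_self_le (w n) F).trans (by gcongr; exact hC' n))⟩
  let x' : Ell2 M := ⟨x, hmem⟩
  refine ⟨x', Metric.tendsto_atTop.2 fun ε hε => ?_⟩
  obtain ⟨N, hN⟩ := Metric.cauchySeq_iff.1 hw (ε / 2) (by positivity)
  refine ⟨N, fun n hn => ?_⟩
  rw [dist_eq_norm]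
  refine lt_of_le_of_lt (norm_le (C := ε / 2) (by positivity) fun F => ?_) (half_lt_self hε)
  have h1 : ∀ t, Filter.Tendsto (fun m => (w n - w m).val t) Filter.atTop
      (𝓝 ((w n).val t - x t)) := fun t => (hx t).const_sub _
  have h2 := (Real.continuous_sqrt.tendsto _).comp (tendsto_fip F h1 h1).norm
  refine le_of_tendsto h2 (Filter.eventually_atTop.2 ⟨N, fun m hm => ?_⟩)
  have := hN n hn m hm
  rw [dist_eq_norm] at this
  exact (sqrt_fip_le _ F).trans this.le

end Ell2

end Ell2

section Inner

variable {G : Type v} [Group G] {M : G → Type u} [∀ t, NormedAddCommGroup (M t)]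
  [∀ t, NormedSpace ℂ (M t)] [FellOps M] [FibrePredual M] [FellBundle M]

lemma norm_le_of_pair (x : UnitFibre M) (C : ℝ) (hC : 0 ≤ C) (h : ∀ p, ‖pair x p‖ ≤ C * ‖p‖) :
    ‖x‖ ≤ C := by
  have : ‖toDual (M := M) 1 x‖ ≤ C := ContinuousLinearMap.opNorm_le_bound _ hC h
  exact ((toDual (M := M) 1).norm_map x).symm.le.trans this

namespace Ell2

lemma norm_inner_le (ξ η : Ell2 M) : ‖inner ξ η‖ ≤ ‖ξ‖ * ‖η‖ :=
  norm_le_of_pair _ _ (by positivity) (norm_pair_inner_le ξ η)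

lemma inner_sub_left (ξ ξ' η : Ell2 M) : inner (ξ - ξ') η = inner ξ η - inner ξ' η := by
  rw [eq_sub_iff_add_eq, ← inner_add_left, sub_add_cancel]

lemma tendsto_inner_left {ι : Type*} {l : Filter ι} {x : ι → Ell2 M} {x' : Ell2 M} (η : Ell2 M)
    (hx : Filter.Tendsto x l (𝓝 x')) :
    Filter.Tendsto (fun i => inner (x i) η) l (𝓝 (inner x' η)) := by
  rw [tendsto_iff_norm_sub_tendsto_zero] at hx ⊢
  refine squeeze_zero (fun i => norm_nonneg _) (fun i => ?_)
    (by simpa using hx.mul_const ‖η‖)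
  rw [← inner_sub_left]
  exact norm_inner_le _ _

lemma tendsto_inner_right {ι : Type*} {l : Filter ι} {x : ι → Ell2 M} {x' : Ell2 M} (η : Ell2 M)
    (hx : Filter.Tendsto x l (𝓝 x')) :
    Filter.Tendsto (fun i => inner η (x i)) l (𝓝 (inner η x')) := by
  rw [tendsto_iff_norm_sub_tendsto_zero] at hx ⊢
  refine squeeze_zero (fun i => norm_nonneg _) (fun i => ?_)
    (by simpa using hx.const_mul ‖η‖)
  rw [← inner_sub_right]
  exact norm_inner_le _ _

end Ell2

end Inner

/-! ### The norm of `ℓ²_{w*}(B'')` in terms of its inner product -/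

section BidualNorm

variable {G : Type v} [Group G] {B : G → Type u} [∀ t, NormedAddCommGroup (B t)]
  [∀ t, NormedSpace ℂ (B t)] [FellOps B] [FellBundle B] [WStarFellBundle (Bidual B)]

namespace Bidual

/-- The pairing of the unit fibre of the bidual bundle with functionals on `B_e`. -/
def pairU (x : UnitFibre (Bidual B)) (p : StrongDual ℂ (UnitFibre B)) : ℂ :=
  pair (M := Bidual B) x p

lemma pairU_ip_self_nonneg (ξ : ∀ t, Bidual B t) (t : G) {p : StrongDual ℂ (UnitFibre B)}
    (hp : IsPos p) : ∃ r : ℝ, 0 ≤ r ∧ pairU (ip ξ ξ t) p = r := by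
  obtain ⟨r, hr, h, -⟩ := arens_inv_self_pos (isCStarInner_fibInner rfl (inv_mul_cancel t)) (ξ t) hp
  exact ⟨r, hr, h⟩

lemma exists_norm_sq_le (φ : StrongDual ℂ (UnitFibre B)) :
    ∃ p : StrongDual ℂ (UnitFibre B), ‖p‖ ≤ ‖φ‖ ^ 2 ∧ IsPos p ∧ ∀ c : UnitFibre (Bidual B),
      ‖pairU c φ‖ ^ 2 ≤ (pairU (star c * c) p).re :=
  exists_norm_sq_le_arens (isCStarInner_mul (UnitFibre B)) φ

/-- For `x = c* c` the norm can be tested on positive functionals of `B_e` alone, since `|φ(c)|² ≤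
p(c* c)` with `‖p‖ ≤ ‖φ‖²`. -/
lemma norm_le_of_pos {x : UnitFibre (Bidual B)} (hx : ∃ c, x = star c * c) (K : ℝ) (hK : 0 ≤ K)
    (h : ∀ p : StrongDual ℂ (UnitFibre B), IsPos p → (pairU x p).re ≤ K * ‖p‖) : ‖x‖ ≤ K := by
  obtain ⟨c, rfl⟩ := hx
  rw [CStarRing.norm_star_mul_self, ← sq, ← Real.sq_sqrt hK]
  gcongr
  refine norm_le_of_pair _ _ (Real.sqrt_nonneg _) fun φ => ?_
  obtain ⟨p, hpn, hp, hc⟩ := exists_norm_sq_le (B := B) φ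
  refine le_of_sq_le_sq ?_ (mul_nonneg (Real.sqrt_nonneg _) (norm_nonneg φ))
  rw [mul_pow, Real.sq_sqrt hK]
  refine (hc c).trans ((h p hp).trans ?_)
  gcongr
  exact hpn

lemma exists_fip_self_eq (ξ : ∀ t, Bidual B t) (F : Finset G) :
    ∃ c, fip F ξ ξ = star c * c := by
  let _ : PartialOrder (UnitFibre (Bidual B)) := CStarAlgebra.spectralOrder _
  have : StarOrderedRing (UnitFibre (Bidual B)) := CStarAlgebra.spectralOrderedRing _
  refine exists_eq_star_mul_self (Finset.sum_nonneg fun t _ => ?_)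
  obtain ⟨d, hd⟩ := ip_self_eq ξ t
  rw [hd]; exact star_mul_self_nonneg d

/-- At a positive functional the weak*-convergent sum `⟨ξ, ξ⟩` becomes a series of nonnegative
numbers, which dominates its partial sums. -/
lemma norm_fip_le_inner (ξ : Ell2 (Bidual B)) (F : Finset G) :
    ‖fip F ξ.val ξ.val‖ ≤ ‖Ell2.inner ξ ξ‖ := by
  refine norm_le_of_pos (exists_fip_self_eq ξ.val F) _ (norm_nonneg _) fun p hp => ?_
  choose r hr hr' using fun t => pairU_ip_self_nonneg ξ.val t hp
  have hs : Summable fun t => pairU (ip ξ.val ξ.val t) p := Ell2.summable_pair ξ ξ p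
  have h1 : pairU (Ell2.inner ξ ξ) p = ∑' t, pairU (ip ξ.val ξ.val t) p := Ell2.pair_inner ξ ξ p
  have h2 : pairU (fip F ξ.val ξ.val) p = ∑ t ∈ F, pairU (ip ξ.val ξ.val t) p := pair_sum _ _ _
  have h3 : ‖pairU (Ell2.inner ξ ξ) p‖ ≤ ‖Ell2.inner ξ ξ‖ * ‖p‖ := norm_pair_le _ _
  refine le_trans ?_ ((Complex.re_le_norm _).trans h3)
  simp only [hr'] at h1 h2 hs
  rw [h1, h2, ← Complex.ofReal_tsum, ← Complex.ofReal_sum, Complex.ofReal_re, Complex.ofReal_re]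
  exact (Complex.summable_ofReal.1 hs).sum_le_tsum F fun t _ => hr t

/-- The norm of `ξ` was defined through finite sums; its agreement with `⟨ξ, ξ⟩` yields the
C*-identity for families of adjointable operators. -/
lemma norm_inner_self (ξ : Ell2 (Bidual B)) : ‖Ell2.inner ξ ξ‖ = ‖ξ‖ ^ 2 := by
  refine le_antisymm ((Ell2.norm_inner_le ξ ξ).trans (sq ‖ξ‖).ge) ?_
  have h : ‖ξ‖ ≤ √‖Ell2.inner ξ ξ‖ := Ell2.norm_le (Real.sqrt_nonneg _) fun F =>
    Real.sqrt_le_sqrt (norm_fip_le_inner ξ F)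
  calc ‖ξ‖ ^ 2 ≤ (√‖Ell2.inner ξ ξ‖) ^ 2 := by gcongr
    _ = _ := Real.sq_sqrt (norm_nonneg _)

end Bidual

end BidualNorm

/-! ### The norm of `ℓ^∞(G, 𝕃(ℓ²_{w*}(B'')))` -/

section EllNorm

variable {G : Type v} [Group G] (B : G → Type u) [∀ t, NormedAddCommGroup (B t)]
  [∀ t, NormedSpace ℂ (B t)] [FellOps B] [FellBundle B] [WStarFellBundle (Bidual B)]

/-- `ℓ^∞(G, 𝕃(ℓ²_{w*}(B'')))` with the supremum norm. -/
def EllNorm : Type (max u v) := EllInfty (Bidual B)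

namespace EllNorm

instance : Ring (EllNorm B) := inferInstanceAs (Ring (EllInfty (Bidual B)))
instance : Algebra ℂ (EllNorm B) := inferInstanceAs (Algebra ℂ (EllInfty (Bidual B)))
instance : StarRing (EllNorm B) := inferInstanceAs (StarRing (EllInfty (Bidual B)))
instance : StarModule ℂ (EllNorm B) := inferInstanceAs (StarModule ℂ (EllInfty (Bidual B)))

variable {B}

/-- The operator `f(t)`. -/
def app (f : EllNorm B) (t : G) : Ell2 (Bidual B) →L[ℂ] Ell2 (Bidual B) := EllInfty.app f t

instance : Norm (EllNorm B) := ⟨fun f => ⨆ t, ‖f.app t‖⟩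

lemma norm_def (f : EllNorm B) : ‖f‖ = ⨆ t, ‖f.app t‖ := rfl

lemma bdd (f : EllNorm B) : BddAbove (Set.range fun t => ‖f.app t‖) := by
  obtain ⟨g, ⟨C, hC⟩, -⟩ := f.2
  exact ⟨C, by rintro _ ⟨t, rfl⟩; exact (hC t).1⟩

lemma norm_app_le (f : EllNorm B) (t : G) : ‖f.app t‖ ≤ ‖f‖ := le_ciSup f.bdd t

lemma norm_le {f : EllNorm B} {C : ℝ} (h : ∀ t, ‖f.app t‖ ≤ C) : ‖f‖ ≤ C := ciSup_le h

lemma normedSpaceCore : NormedSpace.Core ℂ (EllNorm B) where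
  norm_nonneg f := (norm_nonneg _).trans (norm_app_le f 1)
  norm_smul z f := by
    rw [norm_def, norm_def, Real.mul_iSup_of_nonneg (norm_nonneg z)]
    exact congrArg _ (funext fun t => norm_smul z (f.app t))
  norm_triangle f g := norm_le fun t =>
    (norm_add_le (f.app t) (g.app t)).trans (add_le_add (norm_app_le f t) (norm_app_le g t))
  norm_eq_zero_iff f := by
    constructor
    · intro h
      refine EllInfty.ext' fun t ξ => ?_
      have h1 := norm_app_le f t
      rw [h] at h1
      exact congrArg (fun T : Ell2 (Bidual B) →L[ℂ] Ell2 (Bidual B) => T ξ) (norm_le_zero_iff.1 h1)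
    · rintro rfl
      refine le_antisymm (norm_le fun t => ?_) ((norm_nonneg _).trans (norm_app_le _ 1))
      exact (norm_zero (E := Ell2 (Bidual B) →L[ℂ] Ell2 (Bidual B))).le

instance : NormedAddCommGroup (EllNorm B) := NormedAddCommGroup.ofCore normedSpaceCore
instance : NormedSpace ℂ (EllNorm B) := NormedSpace.ofCore normedSpaceCore

lemma inner_app (f : EllNorm B) (t : G) (ξ η : Ell2 (Bidual B)) :
    Ell2.inner (f.app t ξ) η = Ell2.inner ξ ((star f).app t η) := EllInfty.inner_app f t ξ η

protected lemma norm_mul_le (f g : EllNorm B) : ‖f * g‖ ≤ ‖f‖ * ‖g‖ := norm_le fun t =>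
  (norm_mul_le (f.app t) (g.app t)).trans
    (mul_le_mul (norm_app_le f t) (norm_app_le g t) (norm_nonneg _) (norm_nonneg f))

protected lemma norm_mul_self_le (f : EllNorm B) : ‖f‖ * ‖f‖ ≤ ‖star f * f‖ := by
  have h : ‖f‖ ≤ √‖star f * f‖ := norm_le fun t => by
    refine ContinuousLinearMap.opNorm_le_bound _ (Real.sqrt_nonneg _) fun ξ => ?_
    refine le_of_sq_le_sq ?_ (by positivity)
    rw [mul_pow, Real.sq_sqrt (norm_nonneg (star f * f)), ← Bidual.norm_inner_self, inner_app, sq,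
      mul_left_comm]
    refine (Ell2.norm_inner_le _ _).trans ?_
    gcongr
    exact ((star f * f).app t).le_of_opNorm_le (norm_app_le _ t) ξ
  calc ‖f‖ * ‖f‖ ≤ √‖star f * f‖ * √‖star f * f‖ := by gcongr
    _ = _ := Real.mul_self_sqrt (norm_nonneg _)

lemma norm_le_norm_star (f : EllNorm B) : ‖f‖ ≤ ‖star f‖ := by
  rcases (norm_nonneg f).eq_or_lt with h | h
  · rw [← h]; exact norm_nonneg _
  · exact le_of_mul_le_mul_right ((EllNorm.norm_mul_self_le f).trans (EllNorm.norm_mul_le _ _)) h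

lemma exists_tendsto_app {w : ℕ → EllNorm B} (hw : CauchySeq w) (t : G) :
    ∃ T, Filter.Tendsto (fun n => (w n).app t) Filter.atTop (𝓝 T) := by
  refine cauchySeq_tendsto_of_complete ?_
  rw [Metric.cauchySeq_iff] at hw ⊢
  intro ε hε
  obtain ⟨N, hN⟩ := hw ε hε
  refine ⟨N, fun m hm n hn => (dist_eq_norm _ _).trans_lt ?_⟩
  exact (norm_app_le (w m - w n) t).trans_lt ((dist_eq_norm _ _).symm.trans_lt (hN m hm n hn))

instance : CompleteSpace (EllNorm B) := by
  refine Metric.complete_of_cauchySeq_tendsto fun w hw => ?_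
  -- The limit family is adjointable because the adjoints converge as well.
  have hw' : CauchySeq fun n => star (w n) := by
    rw [Metric.cauchySeq_iff] at hw ⊢
    intro ε hε
    obtain ⟨N, hN⟩ := hw ε hε
    refine ⟨N, fun m hm n hn => lt_of_le_of_lt ?_ (hN m hm n hn)⟩
    rw [dist_eq_norm, dist_eq_norm, ← star_sub]
    simpa using norm_le_norm_star (star (w m - w n))
  choose f hf using exists_tendsto_app hw
  choose g hg using exists_tendsto_app hw'
  obtain ⟨C, hC⟩ := hw.norm_bddAbove
  obtain ⟨D, hD⟩ := hw'.norm_bddAbove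
  have hmem : f ∈ ellInftySub (Bidual B) := by
    refine ⟨g, ⟨max C D, fun t => ⟨?_, ?_⟩⟩, fun t ξ η => ?_⟩
    · exact le_of_tendsto (hf t).norm (.of_forall fun n =>
        (norm_app_le (w n) t).trans ((hC (Set.mem_range_self n)).trans (le_max_left _ _)))
    · exact le_of_tendsto (hg t).norm (.of_forall fun n =>
        (norm_app_le (star (w n)) t).trans ((hD (Set.mem_range_self n)).trans (le_max_right _ _)))
    · have h1 := Ell2.tendsto_inner_left η
        (((ContinuousLinearMap.apply ℂ _ ξ).continuous.tendsto _).comp (hf t))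
      have h2 := Ell2.tendsto_inner_right ξ
        (((ContinuousLinearMap.apply ℂ _ η).continuous.tendsto _).comp (hg t))
      refine tendsto_nhds_unique h1 (h2.congr fun n => ?_)
      exact (inner_app (w n) t ξ η).symm
  let f' : EllNorm B := ⟨f, hmem⟩
  refine ⟨f', Metric.tendsto_atTop.2 fun ε hε => ?_⟩
  obtain ⟨N, hN⟩ := Metric.cauchySeq_iff.1 hw (ε / 2) (by positivity)
  refine ⟨N, fun n hn => ?_⟩
  rw [dist_eq_norm]
  refine lt_of_le_of_lt (norm_le (C := ε / 2) fun t => ?_) (half_lt_self hε)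
  refine le_of_tendsto ((hf t).const_sub ((w n).app t)).norm
    (Filter.eventually_atTop.2 ⟨N, fun m hm => ?_⟩)
  have := hN n hn m hm
  rw [dist_eq_norm] at this
  exact (norm_app_le (w n - w m) t).trans this.le

instance : NonUnitalCStarAlgebra (EllNorm B) where
  __ := (inferInstance : Ring (EllNorm B))
  __ := (inferInstance : StarRing (EllNorm B))
  __ := (inferInstance : NormedAddCommGroup (EllNorm B))
  __ := (inferInstance : NormedSpace ℂ (EllNorm B))
  dist_eq := dist_eq_norm_neg_add
  norm_mul_le := EllNorm.norm_mul_le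
  norm_mul_self_le := EllNorm.norm_mul_self_le
  complete := (inferInstance : CompleteSpace (EllNorm B)).complete
  smul_assoc := smul_mul_assoc
  smul_comm z f g := (mul_smul_comm z f g).symm
  star_smul := star_smul

end EllNorm

end EllNorm

/-! ### The representation of kernels on `ℓ²_{w*}(B'')` -/

section Rep

variable {G : Type v} [Group G] {B : G → Type u} [∀ t, NormedAddCommGroup (B t)]
  [∀ t, NormedSpace ℂ (B t)]

namespace FinKernel

lemma norm2_sq (k : FinKernel B) :
    norm2 k ^ 2 = ∑ s ∈ k.supp, ∑ t ∈ k.supp, ‖k.entry (rfl : s * t⁻¹ = _)‖ ^ 2 := by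
  have h : ∑ᶠ p : G × G, ‖k.1 p.1 p.2‖ ^ 2 =
      ∑ s ∈ k.supp, ∑ t ∈ k.supp, ‖k.entry (rfl : s * t⁻¹ = _)‖ ^ 2 := by
    rw [← Finset.sum_product']
    refine finsum_eq_sum_of_support_subset _ fun p hp => ?_
    have h : k.entry (rfl : p.1 * p.2⁻¹ = _) ≠ 0 := fun h => hp (by
      rw [entry_rfl] at h; simp [h])
    simpa using ⟨left_mem_supp _ h, right_mem_supp _ h⟩
  rw [norm2, h, Real.sq_sqrt (by positivity)]

lemma norm2_nonneg (k : FinKernel B) : 0 ≤ norm2 k := Real.sqrt_nonneg _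

variable [FellOps B] [FellBundle B]

/-- Cauchy–Schwarz for one row. With `z = (kξ)(s)` and `η(t) = k(s,t)* z` one has `z* z = ∑ₜ η(t)*
ξ(t)`, and `‖∑ₜ η(t)* η(t)‖ ≤ C ‖z‖²`; then `‖z‖²` cancels. -/
lemma norm_act_sq_le (k : FinKernel B) (ξ : Ell2 B) (s : G) :
    ‖act k ξ.val s‖ ^ 2 ≤
      (∑ t ∈ k.supp, ‖k.entry (rfl : s * t⁻¹ = _)‖ ^ 2) * ‖ξ‖ ^ 2 := by
  set z := act k ξ.val s with hz
  set C := ∑ t ∈ k.supp, ‖k.entry (rfl : s * t⁻¹ = _)‖ ^ 2 with hC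
  have e1 : ∀ t : G, (s * t⁻¹)⁻¹ = t * s⁻¹ := fun t => by group
  have e2 : ∀ t : G, t * s⁻¹ * s = t := fun t => by group
  have e3 : ∀ t : G, s⁻¹ * (s * t⁻¹) = t⁻¹ := fun t => by group
  let η : ∀ t, B t := fun t => mul (e2 t) (inv (e1 t) (k.entry (rfl : s * t⁻¹ = _))) z
  have h1 : mul (B := B) (inv_mul_cancel s) (inv rfl z) z = fip k.supp η ξ.val := by
    have hz' : z = ∑ t ∈ k.supp, mul (act_aux s t) (k.entry rfl) (ξ.val t) :=
      act_eq_sum k ξ.val s _ le_rfl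
    refine (congrArg (mul (B := B) (inv_mul_cancel s) (inv rfl z)) hz').trans
      ((mul_sum _ _ _ _).trans (Finset.sum_congr rfl fun t _ => ?_))
    have h2 : inv rfl (η t) = mul (B := B) (e3 t) (inv rfl z) (k.entry (rfl : s * t⁻¹ = _)) := by
      rw [FellBundle.inv_mul (B := B) (e2 t) (by group : (t * s⁻¹)⁻¹ = s * t⁻¹) rfl rfl (e3 t),
        FellBundle.inv_inv]
    unfold ip
    rw [h2]
    exact (FellBundle.mul_assoc (B := B) _ _ _ _ _ _ _).symm
  have h2 : ‖z‖ ^ 2 ≤ √‖fip k.supp η η‖ * ‖ξ‖ := by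
    rw [← FellBundle.norm_inv_mul_self (B := B) rfl (inv_mul_cancel s) z, h1]
    refine (norm_fip_le η ξ.val k.supp).trans ?_
    gcongr
    exact Ell2.sqrt_fip_le ξ _
  have h3 : ‖fip k.supp η η‖ ≤ C * ‖z‖ ^ 2 := by
    refine (norm_sum_le _ _).trans ?_
    rw [hC, Finset.sum_mul]
    refine Finset.sum_le_sum fun t _ => ?_
    rw [norm_ip_self, ← mul_pow]
    gcongr
    refine (FellBundle.norm_mul_le (B := B) _ _ _).trans ?_
    rw [norm_inv]
  have hC0 : 0 ≤ C := by positivity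
  have h4 : ‖z‖ ^ 2 * ‖z‖ ^ 2 ≤ C * ‖ξ‖ ^ 2 * ‖z‖ ^ 2 := by
    calc ‖z‖ ^ 2 * ‖z‖ ^ 2 ≤ (√‖fip k.supp η η‖ * ‖ξ‖) * (√‖fip k.supp η η‖ * ‖ξ‖) := by gcongr
      _ = (√‖fip k.supp η η‖ * √‖fip k.supp η η‖) * ‖ξ‖ ^ 2 := by ring
      _ = ‖fip k.supp η η‖ * ‖ξ‖ ^ 2 := by rw [Real.mul_self_sqrt (norm_nonneg _)]
      _ ≤ C * ‖z‖ ^ 2 * ‖ξ‖ ^ 2 := by gcongr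
      _ = _ := by ring
  rcases (sq_nonneg ‖z‖).eq_or_lt with h | h
  · rw [← h]; positivity
  · exact le_of_mul_le_mul_right h4 h

/-- Rows are summed. The cruder bound by `norm1` would not suffice, as the universal seminorm only
sees C*-seminorms below `norm2`. -/
lemma norm_ker_le_norm2 (k : FinKernel B) : ‖ker k‖ ≤ norm2 k := by
  classical
  refine ContinuousLinearMap.opNorm_le_bound _ (norm2_nonneg k) fun ξ => ?_
  refine Ell2.norm_le (mul_nonneg (norm2_nonneg k) (norm_nonneg ξ)) fun F => ?_
  rw [Real.sqrt_le_left (mul_nonneg (norm2_nonneg k) (norm_nonneg ξ)), mul_pow, norm2_sq,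
    Finset.sum_mul]
  calc ‖fip F (ker k ξ).val (ker k ξ).val‖ ≤ ∑ s ∈ F, ‖act k ξ.val s‖ ^ 2 :=
        (norm_sum_le _ _).trans (Finset.sum_le_sum fun s _ => (norm_ip_self _ _).le)
    _ = ∑ s ∈ F ∩ k.supp, ‖act k ξ.val s‖ ^ 2 :=
        (Finset.sum_subset Finset.inter_subset_left fun s hs hn => by
          rw [act_eq_zero k ξ.val s fun h => hn (Finset.mem_inter.2 ⟨hs, h⟩), norm_zero]
          simp).symm
    _ ≤ ∑ s ∈ k.supp, ‖act k ξ.val s‖ ^ 2 :=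
        Finset.sum_le_sum_of_subset_of_nonneg Finset.inter_subset_right fun s _ _ => by positivity
    _ ≤ _ := Finset.sum_le_sum fun s _ => norm_act_sq_le k ξ s

end FinKernel

variable [FellOps B] [FellBundle B]

namespace Bidual

/-- The canonical inclusion of a fibre into its bidual. -/
def incl (t : G) : B t →L[ℂ] Bidual B t := NormedSpace.inclusionInDoubleDual ℂ (B t)

lemma norm_incl (t : G) (b : B t) : ‖incl t b‖ = ‖b‖ :=
  (NormedSpace.inclusionInDoubleDualLi ℂ (E := B t)).norm_map b

lemma incl_mul {s t u : G} (h : s * t = u) (a : B s) (b : B t) :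
    incl u (mul h a b) = mul h (incl s a) (incl t b) := rfl

lemma incl_inv {s t : G} (h : s⁻¹ = t) (a : B s) : incl t (inv h a) = inv h (incl s a) :=
  ContinuousLinearMap.ext fun φ => (Complex.conj_conj (φ (inv h a))).symm

end Bidual

variable [WStarFellBundle (Bidual B)]

open FinKernel

namespace FinKernel

/-- A kernel of `B` as a kernel of `B''`. -/
def toBidual (k : FinKernel B) : FinKernel (Bidual B) :=
  mk' (fun s t => Bidual.incl _ (k.1 s t)) k.supp fun s t h => by
    have h1 : k.entry (rfl : s * t⁻¹ = _) ≠ 0 := fun h0 => h (by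
      rw [entry_rfl] at h0; rw [h0, map_zero])
    exact ⟨left_mem_supp _ h1, right_mem_supp _ h1⟩

lemma entry_toBidual (k : FinKernel B) {s t u : G} (h : s * t⁻¹ = u) :
    (toBidual k).entry h = Bidual.incl u (k.entry h) := by subst h; rfl

lemma supp_toBidual (k : FinKernel B) : (toBidual k).supp ⊆ k.supp := supp_subset fun s t h => by
  rw [entry_toBidual] at h
  have h1 : k.entry (rfl : s * t⁻¹ = _) ≠ 0 := fun h0 => h (by rw [h0, map_zero])
  exact ⟨left_mem_supp _ h1, right_mem_supp _ h1⟩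

variable (B) in
/-- The inclusion of the kernels of `B` into those of `B''`. -/
def toBidualHom : FinKernel B →⋆ₙₐ[ℂ] FinKernel (Bidual B) where
  toFun := toBidual
  map_smul' z k := ext' fun s t => by
    simp only [MonoidHom.id_apply, entry_toBidual, entry_smul, map_smul]
  map_zero' := ext' fun s t => by rw [entry_toBidual, entry_zero, entry_zero, map_zero]
  map_add' k l := ext' fun s t => by simp only [entry_toBidual, entry_add, map_add]
  map_mul' k l := ext' fun r s => by
    rw [entry_toBidual, entry_mul k l _ k.supp (.inl le_rfl),
      entry_mul _ _ _ k.supp (.inl (supp_toBidual k)), map_sum]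
    refine Finset.sum_congr rfl fun t _ => ?_
    rw [entry_toBidual, entry_toBidual, Bidual.incl_mul]
  map_star' k := ext' fun r s => by
    rw [entry_toBidual, entry_star, entry_star, entry_toBidual, Bidual.incl_inv]

lemma toBidualHom_shiftHom (g : G) (k : FinKernel B) :
    toBidualHom B (shiftHom B g k) = shiftHom (Bidual B) g (toBidualHom B k) :=
  ext' fun r s => by
    have h : r * g * (s * g)⁻¹ = r * s⁻¹ := by group
    change (toBidual (shift g k)).entry rfl = (shift g (toBidual k)).entry rfl
    rw [entry_toBidual, entry_shift g _ _ h, entry_shift g _ _ h, entry_toBidual]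

lemma norm2_toBidual (k : FinKernel B) : norm2 (toBidual k) = norm2 k := by
  unfold norm2
  congr 1
  exact finsum_congr fun p => congrArg (· ^ 2) (Bidual.norm_incl _ _)

end FinKernel

variable (B) in
/-- The representation of the kernels of `B` in `ℓ^∞(G, 𝕃(ℓ²_{w*}(B'')))`. -/
def rep : FinKernel B →⋆ₙₐ[ℂ] EllNorm B :=
  NonUnitalStarAlgHom.comp (show FinKernel (Bidual B) →⋆ₙₐ[ℂ] EllNorm B from piBeta (Bidual B))
    (toBidualHom B)

lemma rep_apply (k : FinKernel B) : rep B k = piBeta (Bidual B) (toBidualHom B k) := rfl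

/-- The norm of `rep` is a C*-seminorm below `norm2`, hence one of those over which the universal
seminorm is the supremum. -/
lemma norm_rep_le (k : FinKernel B) : ‖rep B k‖ ≤ ‖k‖ := by
  let p : Seminorm ℂ (FinKernel B) := (normSeminorm ℂ (EllNorm B)).comp
    ({ toFun := rep B
       map_add' := map_add _
       map_smul' := fun z k => map_smul (rep B) z k } : FinKernel B →ₗ[ℂ] EllNorm B)
  have hp : p ∈ cstarSeminorms norm2 := by
    refine ⟨fun a b => ?_, fun a => ?_, fun a => EllNorm.norm_le fun t => ?_⟩
    · change ‖rep B (a * b)‖ ≤ ‖rep B a‖ * ‖rep B b‖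
      rw [map_mul]; exact norm_mul_le _ _
    · change ‖rep B (star a * a)‖ = ‖rep B a‖ ^ 2
      rw [map_mul, map_star, sq]; exact CStarRing.norm_star_mul_self
    · change ‖ker (shiftHom (Bidual B) t⁻¹ (toBidual a))‖ ≤ _
      refine (norm_ker_le_norm2 _).trans (le_of_eq ?_)
      exact (norm2_shift t⁻¹ (toBidual a)).trans (norm2_toBidual a)
  exact le_maxCStarSeminorm hp k

namespace KernelAlgebra

variable (B) in
/-- The canonical map of kernels of finite support into `𝕜(B)`, as a linear map. -/
def ofL : FinKernel B →ₗ[ℂ] KernelAlgebra B where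
  toFun := of
  map_add' := of_add
  map_smul' := of_smul

lemma denseRange_ofL : DenseRange (ofL B) := UniformSpace.Completion.denseRange_coe

lemma dual_ext {φ ψ : StrongDual ℂ (KernelAlgebra B)} (h : ∀ k, φ (of k) = ψ (of k)) : φ = ψ := by
  ext a
  induction a using ind with
  | hp => exact isClosed_eq φ.continuous ψ.continuous
  | ih k => exact h k

variable (B) in
/-- The extension of the representation of kernels to `𝕜(B)`, at `t`. -/
def repL (t : G) : KernelAlgebra B →L[ℂ] (Ell2 (Bidual B) →L[ℂ] Ell2 (Bidual B)) :=
  LinearMap.extendOfNorm ({ toFun := fun k => (rep B k).app t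
                            map_add' := fun k l => by rw [map_add]; rfl
                            map_smul' := fun z k => by rw [map_smul]; rfl } :
    FinKernel B →ₗ[ℂ] (Ell2 (Bidual B) →L[ℂ] Ell2 (Bidual B))) (ofL B)

lemma norm_rep_app_le (k : FinKernel B) (t : G) : ‖(rep B k).app t‖ ≤ 1 * ‖of k‖ := by
  rw [one_mul, norm_of]
  exact (EllNorm.norm_app_le _ t).trans (norm_rep_le k)

lemma repL_of (t : G) (k : FinKernel B) : repL B t (of k) = (rep B k).app t :=
  LinearMap.extendOfNorm_eq denseRange_ofL ⟨1, fun k => norm_rep_app_le k t⟩ k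

lemma norm_repL_le (t : G) : ‖repL B t‖ ≤ 1 :=
  LinearMap.opNorm_extendOfNorm_le denseRange_ofL zero_le_one fun k => norm_rep_app_le k t

end KernelAlgebra

end Rep

/-! ### Sections defined by functionals on the dual of `ℓ²_{w*}(B'')` -/

section Sec

variable {G : Type v} [Group G] {B : G → Type u} [∀ t, NormedAddCommGroup (B t)]
  [∀ t, NormedSpace ℂ (B t)] [FellOps B] [FellBundle B] [WStarFellBundle (Bidual B)]

section

variable {M : G → Type u} [∀ t, NormedAddCommGroup (M t)] [∀ t, NormedSpace ℂ (M t)] [FellOps M]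
  [FellBundle M]

/-- Cauchy–Schwarz in the order of the unit fibre, from `⟨ξc - Nη, ξc - Nη⟩ ≥ 0` with `c = ⟨ξ, η⟩`.
Unlike its norm version, it can be evaluated at a positive functional, which makes tails of series
small. -/
lemma star_fip_mul_fip_le [PartialOrder (UnitFibre M)] [StarOrderedRing (UnitFibre M)]
    (ξ η : ∀ t, M t) (F : Finset G) {N : ℝ} (hN0 : 0 < N) (hN : ‖fip F ξ ξ‖ ≤ N) :
    star (fip F ξ η) * fip F ξ η ≤ N • fip F η η := by
  set a := fip F ξ ξ
  set b := fip F η η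
  set c := fip F ξ η
  have hz : 0 ≤ fip F (rsmul ξ c - (N : ℂ) • η) (rsmul ξ c - (N : ℂ) • η) := by
    refine Finset.sum_nonneg fun t _ => ?_
    obtain ⟨d, hd⟩ := ip_self_eq (rsmul ξ c - (N : ℂ) • η) t
    rw [hd]; exact star_mul_self_nonneg d
  have hexp : fip F (rsmul ξ c - (N : ℂ) • η) (rsmul ξ c - (N : ℂ) • η) =
      star c * a * c - (N : ℂ) • (star c * c) - (N : ℂ) • (star c * c) +
        (N : ℂ) • (N : ℂ) • b := by
    have h1 : star c * a * c = ∑ t ∈ F, star c * ip ξ ξ t * c := by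
      rw [← Finset.sum_mul, ← Finset.mul_sum]; rfl
    have h2 : star c * c = ∑ t ∈ F, star c * ip ξ η t := by
      rw [← Finset.mul_sum]; rfl
    have h3 : star c * c = ∑ t ∈ F, ip η ξ t * c := by
      rw [← Finset.sum_mul, star_fip]; rfl
    have h4 : b = ∑ t ∈ F, ip η η t := rfl
    rw [h1]
    nth_rewrite 1 [h2]
    rw [h3, h4, Finset.smul_sum, Finset.smul_sum, Finset.smul_sum, Finset.smul_sum,
      ← Finset.sum_sub_distrib, ← Finset.sum_sub_distrib, ← Finset.sum_add_distrib]
    refine Finset.sum_congr rfl fun t _ => ?_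
    rw [ip_sub_right, ip_sub_left, ip_sub_left, ip_smul_right, ip_smul_right, ip_smul_left,
      ip_smul_left, ip_rsmul_right, ip_rsmul_right, ip_rsmul_left, ip_rsmul_left,
      Complex.conj_ofReal]
    abel
  have hsa : IsSelfAdjoint a := star_fip ξ ξ F
  have h5 : star c * a * c ≤ ‖a‖ • (star c * c) := CStarAlgebra.star_left_conjugate_le_norm_smul
  have h6 : ‖a‖ • (star c * c) ≤ N • (star c * c) :=
    smul_le_smul_of_nonneg_right hN (star_mul_self_nonneg c)
  have h7 : N • (star c * c) ≤ N • N • b := by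
    rw [hexp] at hz
    simp only [Complex.coe_smul] at hz
    have h8 := h5.trans h6
    have h9 : 0 ≤ N • (star c * c) - N • (star c * c) - N • (star c * c) + N • N • b :=
      hz.trans (by gcongr)
    rw [sub_self, zero_sub, neg_add_eq_sub] at h9
    exact sub_nonneg.1 h9
  have h8 := smul_le_smul_of_nonneg_left h7 (inv_nonneg.2 hN0.le)
  rwa [inv_smul_smul₀ hN0.ne', inv_smul_smul₀ hN0.ne'] at h8

end

namespace Bidual

lemma pairU_add (x y : UnitFibre (Bidual B)) (p : StrongDual ℂ (UnitFibre B)) :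
    pairU (x + y) p = pairU x p + pairU y p := rfl

lemma pairU_re_mono [PartialOrder (UnitFibre (Bidual B))] [StarOrderedRing (UnitFibre (Bidual B))]
    {p : StrongDual ℂ (UnitFibre B)} (hp : IsPos p) {x y : UnitFibre (Bidual B)} (h : x ≤ y) :
    (pairU x p).re ≤ (pairU y p).re := by
  obtain ⟨c, hc⟩ := exists_eq_star_mul_self (sub_nonneg.2 h)
  obtain ⟨r, hr, hr', -⟩ := arens_inv_self_pos (isCStarInner_mul (UnitFibre B)) c hp
  have h1 : pairU (star c * c) p = r := hr'
  have h2 : y = x + star c * c := by rw [← hc]; abel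
  rw [h2, pairU_add, h1, Complex.add_re, Complex.ofReal_re]
  linarith

/-- The value of an element of a fibre of `B''` at a functional. -/
def ev {t : G} (b : Bidual B t) (q : StrongDual ℂ (B t)) : ℂ :=
  (show StrongDual ℂ (StrongDual ℂ (B t)) from b) q

variable (B) in
/-- The value of a section at `s`. -/
def valL (s : G) : Ell2 (Bidual B) →L[ℂ] Bidual B s :=
  LinearMap.mkContinuous (⟨⟨fun ζ => ζ.val s, fun _ _ => rfl⟩, fun _ _ => rfl⟩ :
    Ell2 (Bidual B) →ₗ[ℂ] Bidual B s) 1 fun ζ => by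
      rw [one_mul]
      exact Ell2.norm_val_le ζ s

variable (B) in
/-- The functionals `ζ ↦ ζ(s)(q)`. -/
def coord (s : G) : StrongDual ℂ (B s) →L[ℂ] StrongDual ℂ (Ell2 (Bidual B)) :=
  ((ContinuousLinearMap.compL ℂ (Ell2 (Bidual B)) (StrongDual ℂ (StrongDual ℂ (B s))) ℂ).flip
    (valL B s)).comp (NormedSpace.inclusionInDoubleDual ℂ (StrongDual ℂ (B s)))

/-- The functional `p(ξ(s)* ·)`. -/
def dualCoord (ξ : ∀ t, Bidual B t) (s : G) (p : Pre (Bidual B) 1) : StrongDual ℂ (B s) :=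
  arensAux (mulL (B := B) (inv_mul_cancel s)).flip (inv (B := Bidual B) rfl (ξ s)) p

/-- Regularity puts `ζ(s)` in the outer position, so that `ζ ↦ p(ξ(s)* ζ(s))` is the evaluation at a
functional on `B_s`. -/
lemma pair_ip (ξ ζ : ∀ t, Bidual B t) (s : G) (p : Pre (Bidual B) 1) :
    pair (ip ξ ζ s) p = ev (ζ s) (dualCoord ξ s p) :=
  isRegular_mulL (inv_mul_cancel s) (inv (B := Bidual B) rfl (ξ s)) (ζ s) p

/-- The functional `ζ ↦ p(∑_{s ∈ F} ξ(s)* ζ(s))`. -/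
def partialDual (F : Finset G) (ξ : ∀ t, Bidual B t) (p : Pre (Bidual B) 1) :
    StrongDual ℂ (Ell2 (Bidual B)) := ∑ s ∈ F, coord B s (dualCoord ξ s p)

lemma partialDual_apply (F : Finset G) (ξ : ∀ t, Bidual B t) (p : Pre (Bidual B) 1)
    (ζ : Ell2 (Bidual B)) : partialDual F ξ p ζ = pair (fip F ξ ζ.val) p := by
  rw [fip, pair_sum, partialDual, sum_apply]
  exact Finset.sum_congr rfl fun s _ => (pair_ip ξ ζ.val s p).symm

lemma norm_partialDual_le (F : Finset G) (ξ : ∀ t, Bidual B t) (p : Pre (Bidual B) 1) :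
    ‖partialDual F ξ p‖ ≤ √‖fip F ξ ξ‖ * ‖p‖ := by
  refine ContinuousLinearMap.opNorm_le_bound _ (by positivity) fun ζ => ?_
  rw [partialDual_apply]
  calc ‖pair (fip F ξ ζ.val) p‖ ≤ ‖fip F ξ ζ.val‖ * ‖p‖ := norm_pair_le _ _
    _ ≤ √‖fip F ξ ξ‖ * ‖ζ‖ * ‖p‖ := by
        gcongr
        refine (norm_fip_le _ _ _).trans ?_
        gcongr
        exact Ell2.sqrt_fip_le ζ F
    _ = _ := by ring

/-- `p'` dominates the adjoint of `p` and is independent of `F` and `ξ`. Therefore it controls all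
tails of the series in `hasSum_innerDual` at once. -/
lemma exists_norm_partialDual_le (p : Pre (Bidual B) 1) :
    ∃ p' : StrongDual ℂ (UnitFibre B), ∀ (F : Finset G) (ξ : ∀ t, Bidual B t),
      ‖partialDual F ξ p‖ ≤ √(pairU (fip F ξ ξ) p').re := by
  let _ : PartialOrder (UnitFibre (Bidual B)) := CStarAlgebra.spectralOrder _
  have : StarOrderedRing (UnitFibre (Bidual B)) := CStarAlgebra.spectralOrderedRing _
  obtain ⟨q, -, hq⟩ := exists_pair_star (M := Bidual B) p
  obtain ⟨p', -, hp', hc⟩ := exists_norm_sq_le (B := B) q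
  refine ⟨p', fun F ξ => ContinuousLinearMap.opNorm_le_bound _ (Real.sqrt_nonneg _) fun ζ => ?_⟩
  rcases (norm_nonneg ζ).eq_or_lt with h0 | h0
  · rw [norm_eq_zero.1 h0.symm, map_zero, norm_zero, norm_zero, mul_zero]
  have h1 : ‖partialDual F ξ p ζ‖ = ‖pairU (fip F ζ.val ξ) q‖ := by
    rw [partialDual_apply, ← star_fip, hq, RCLike.norm_conj]; rfl
  have h2 := pairU_re_mono hp' (star_fip_mul_fip_le ζ.val ξ F (pow_pos h0 2)
    (Ell2.norm_fip_self_le ζ F))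
  have h3 : pairU (‖ζ‖ ^ 2 • fip F ξ ξ) p' = ((‖ζ‖ ^ 2 : ℝ) : ℂ) * pairU (fip F ξ ξ) p' := by
    rw [← Complex.coe_smul]; exact pair_smul_left _ _ _
  have h4 := (hc (fip F ζ.val ξ)).trans h2
  rw [h3, Complex.re_ofReal_mul] at h4
  rw [h1]
  calc ‖pairU (fip F ζ.val ξ) q‖ = √(‖pairU (fip F ζ.val ξ) q‖ ^ 2) :=
        (Real.sqrt_sq (norm_nonneg _)).symm
    _ ≤ √(‖ζ‖ ^ 2 * (pairU (fip F ξ ξ) p').re) := Real.sqrt_le_sqrt h4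
    _ = _ := by rw [Real.sqrt_mul (by positivity), Real.sqrt_sq (norm_nonneg _), mul_comm]

/-- The functional `ζ ↦ p(⟨ξ, ζ⟩)`. -/
def innerDual (ξ : Ell2 (Bidual B)) (p : Pre (Bidual B) 1) : StrongDual ℂ (Ell2 (Bidual B)) :=
  LinearMap.mkContinuous
    { toFun := fun ζ => pair (Ell2.inner ξ ζ) p
      map_add' := fun ζ ζ' => by rw [Ell2.inner_add_right, pair_add_left]
      map_smul' := fun z ζ => by rw [Ell2.inner_smul_right, pair_smul_left]; rfl } (‖ξ‖ * ‖p‖)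
    fun ζ => (Ell2.norm_pair_inner_le ξ ζ p).trans (by rw [mul_right_comm])

lemma innerDual_apply (ξ ζ : Ell2 (Bidual B)) (p : Pre (Bidual B) 1) :
    innerDual ξ p ζ = pair (Ell2.inner ξ ζ) p := rfl

lemma norm_innerDual_le (ξ : Ell2 (Bidual B)) (p : Pre (Bidual B) 1) :
    ‖innerDual ξ p‖ ≤ ‖ξ‖ * ‖p‖ := LinearMap.mkContinuous_norm_le _ (by positivity) _

/-- The convergence is in norm, although `ξ` need not be a norm limit of its finite restrictions:
the squared norm of the part over `F` is at most `p'(∑_{t ∈ F} ξ(t)* ξ(t))`, a tail of a convergent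
scalar series. Norm convergence is what lets an arbitrary element of the bidual be applied term by
term. -/
lemma hasSum_innerDual (ξ : Ell2 (Bidual B)) (p : Pre (Bidual B) 1) :
    HasSum (fun s => coord B s (dualCoord ξ.val s p)) (innerDual ξ p) := by
  obtain ⟨p', hp'⟩ := exists_norm_partialDual_le (B := B) p
  have hs : Summable fun t => (pairU (ip ξ.val ξ.val t) p').re :=
    (Complex.hasSum_re (Ell2.summable_pair ξ ξ p').hasSum).summable
  have h : Summable fun s => coord B s (dualCoord ξ.val s p) := by
    rw [summable_iff_vanishing_norm] at hs ⊢
    intro ε hε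
    obtain ⟨F₀, hF₀⟩ := hs (ε ^ 2) (by positivity)
    refine ⟨F₀, fun F hF => (hp' F ξ.val).trans_lt ?_⟩
    rw [Real.sqrt_lt' hε]
    have h1 : pairU (fip F ξ.val ξ.val) p' = ∑ t ∈ F, pairU (ip ξ.val ξ.val t) p' := pair_sum _ _ _
    rw [h1, Complex.re_sum]
    exact (le_abs_self _).trans_lt (hF₀ F hF)
  convert h.hasSum using 1
  ext ζ
  rw [innerDual_apply, Ell2.pair_inner]
  have h1 : ContinuousLinearMap.apply ℂ ℂ ζ (∑' s, coord B s (dualCoord ξ.val s p)) =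
      ∑' s, ContinuousLinearMap.apply ℂ ℂ ζ (coord B s (dualCoord ξ.val s p)) :=
    ContinuousLinearMap.map_tsum _ h
  exact (tsum_congr fun s => pair_ip ξ.val ζ.val s p).trans h1.symm

/-- The section `s ↦ (q ↦ Θ(ζ ↦ ζ(s)(q)))`. -/
def secFun (Θ : StrongDual ℂ (StrongDual ℂ (Ell2 (Bidual B)))) (s : G) : Bidual B s :=
  Θ.comp (coord B s)

/-- A self-improving bound. Pairing `y_F = ∑_{s ∈ F} y(s)* y(s)` with `p` is applying `Θ` to a
functional of norm at most `√‖y_F‖ ‖p‖`, so `‖y_F‖ ≤ ‖Θ‖ √‖y_F‖`. -/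
lemma sqrt_fip_secFun_le (Θ : StrongDual ℂ (StrongDual ℂ (Ell2 (Bidual B)))) (F : Finset G) :
    √‖fip F (secFun Θ) (secFun Θ)‖ ≤ ‖Θ‖ := by
  set y := secFun Θ
  have h : ‖fip F y y‖ ≤ ‖Θ‖ * √‖fip F y y‖ := by
    refine norm_le_of_pair _ _ (by positivity) fun p => ?_
    have h1 : pair (fip F y y) p = Θ (partialDual F y p) := by
      rw [fip, pair_sum, partialDual, map_sum]
      exact Finset.sum_congr rfl fun s _ => pair_ip y y s p
    rw [h1, _root_.mul_assoc]
    exact Θ.le_opNorm_of_le (norm_partialDual_le F y p)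
  rcases (Real.sqrt_nonneg ‖fip F y y‖).eq_or_lt with h0 | h0
  · rw [← h0]; exact norm_nonneg Θ
  · refine le_of_mul_le_mul_right ?_ h0
    rwa [Real.mul_self_sqrt (norm_nonneg _)]

/-- The section `s ↦ (q ↦ Θ(ζ ↦ ζ(s)(q)))` as an element of `ℓ²_{w*}(B'')`. -/
def sec (Θ : StrongDual ℂ (StrongDual ℂ (Ell2 (Bidual B)))) : Ell2 (Bidual B) :=
  ⟨secFun Θ, ‖Θ‖ ^ 2, fun F => (Real.sqrt_le_left (norm_nonneg Θ)).1 (sqrt_fip_secFun_le Θ F)⟩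

lemma norm_sec_le (Θ : StrongDual ℂ (StrongDual ℂ (Ell2 (Bidual B)))) : ‖sec Θ‖ ≤ ‖Θ‖ :=
  Ell2.norm_le (norm_nonneg Θ) (sqrt_fip_secFun_le Θ)

/-- The section remembers `Θ` exactly on the functionals given by inner products; it is built from
coordinates only, and norm summability recovers the rest. -/
lemma pair_inner_sec (ξ : Ell2 (Bidual B))
    (Θ : StrongDual ℂ (StrongDual ℂ (Ell2 (Bidual B)))) (p : Pre (Bidual B) 1) :
    pair (Ell2.inner ξ (sec Θ)) p = Θ (innerDual ξ p) := by
  rw [Ell2.pair_inner]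
  exact (tsum_congr fun s => pair_ip ξ.val (sec Θ).val s p).trans
    ((hasSum_innerDual ξ p).mapL Θ).tsum_eq

end Bidual

end Sec

/-! ### The extension of the representation to the bidual of `𝕜(B)` -/

section Extension

namespace CStarBidual

variable {A : Type*} [NonUnitalCStarAlgebra A]

/-- The value of an element of the bidual at a functional. -/
def ev (x : CStarBidual A) (φ : StrongDual ℂ A) : ℂ :=
  (show StrongDual ℂ (StrongDual ℂ A) from x) φ

lemma ev_ext {x y : CStarBidual A} (h : ∀ φ, ev x φ = ev y φ) : x = y := ContinuousLinearMap.ext h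

lemma norm_ev_le (x : CStarBidual A) (φ : StrongDual ℂ A) : ‖ev x φ‖ ≤ ‖x‖ * ‖φ‖ :=
  (show StrongDual ℂ (StrongDual ℂ A) from x).le_opNorm φ

lemma ev_add (x y : CStarBidual A) (φ : StrongDual ℂ A) : ev (x + y) φ = ev x φ + ev y φ := rfl

lemma ev_smul (z : ℂ) (x : CStarBidual A) (φ : StrongDual ℂ A) : ev (z • x) φ = z * ev x φ := rfl

lemma ev_mul (x y : CStarBidual A) (φ : StrongDual ℂ A) :
    ev (x * y) φ = ev x (arensAux (ContinuousLinearMap.mul ℂ A) y φ) := rfl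

lemma ev_star (x : CStarBidual A) (φ : StrongDual ℂ A) :
    ev (star x) φ = conj (ev x (conjDualL ((starL ℂ : A ≃L⋆[ℂ] A) : A →L⋆[ℂ] A) φ)) := rfl

lemma ev_tsum (x : CStarBidual A) {φ : ℕ → StrongDual ℂ A} (h : Summable φ) :
    ev x (∑' n, φ n) = ∑' n, ev x (φ n) :=
  ContinuousLinearMap.map_tsum (show StrongDual ℂ (StrongDual ℂ A) from x) h

end CStarBidual

variable {G : Type v} [Group G] {B : G → Type u} [∀ t, NormedAddCommGroup (B t)]
  [∀ t, NormedSpace ℂ (B t)] [FellOps B] [FellBundle B] [WStarFellBundle (Bidual B)]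

open FinKernel Bidual

namespace KernelAlgebra

/-- The map `a ↦ a_t η` from `𝕜(B)` to `ℓ²_{w*}(B'')`. -/
def orbit (t : G) (η : Ell2 (Bidual B)) : KernelAlgebra B →L[ℂ] Ell2 (Bidual B) :=
  (repL B t).flip η

lemma orbit_of (t : G) (η : Ell2 (Bidual B)) (k : FinKernel B) :
    orbit t η (of k) = (rep B k).app t η := by
  rw [← repL_of]; rfl

lemma norm_orbit_le (t : G) (η : Ell2 (Bidual B)) :
    ‖orbit (B := B) t η‖ ≤ ‖η‖ := by
  refine ContinuousLinearMap.opNorm_le_bound _ (norm_nonneg η) fun a => ?_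
  calc ‖repL B t a η‖ ≤ ‖repL B t a‖ * ‖η‖ := (repL B t a).le_opNorm η
    _ ≤ (1 * ‖a‖) * ‖η‖ := by
        gcongr
        exact (repL B t).le_of_opNorm_le (norm_repL_le t) a
    _ = _ := by ring

/-- The functional `a ↦ p(⟨ξ, a_t η⟩)`. -/
def coeff₁ (t : G) (ξ η : Ell2 (Bidual B)) (p : Pre (Bidual B) 1) :
    StrongDual ℂ (KernelAlgebra B) := (innerDual ξ p).comp (orbit t η)

lemma coeff₁_of (t : G) (ξ η : Ell2 (Bidual B)) (p : Pre (Bidual B) 1) (k : FinKernel B) :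
    coeff₁ t ξ η p (of k) = pair (Ell2.inner ξ ((rep B k).app t η)) p := by
  rw [← orbit_of]; rfl

lemma norm_coeff₁_le (t : G) (ξ η : Ell2 (Bidual B)) (p : Pre (Bidual B) 1) :
    ‖coeff₁ (B := B) t ξ η p‖ ≤ ‖ξ‖ * ‖η‖ * ‖p‖ := by
  refine (ContinuousLinearMap.opNorm_comp_le _ _).trans ?_
  calc _ ≤ ‖ξ‖ * ‖p‖ * ‖η‖ := by
        gcongr
        · exact norm_innerDual_le ξ p
        · exact norm_orbit_le t η
    _ = _ := by ring

/-- `x_t η` for `x` in the bidual of `𝕜(B)`. -/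
def extApp (x : CStarBidual (KernelAlgebra B)) (t : G) (η : Ell2 (Bidual B)) : Ell2 (Bidual B) :=
  sec ((show StrongDual ℂ (StrongDual ℂ (KernelAlgebra B)) from x).comp
    ((ContinuousLinearMap.compL ℂ (KernelAlgebra B) (Ell2 (Bidual B)) ℂ).flip (orbit t η)))

lemma pair_inner_extApp (x : CStarBidual (KernelAlgebra B)) (t : G) (ξ η : Ell2 (Bidual B))
    (p : Pre (Bidual B) 1) :
    pair (Ell2.inner ξ (extApp x t η)) p = x.ev (coeff₁ t ξ η p) :=
  pair_inner_sec ξ _ p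

lemma norm_extApp_le (x : CStarBidual (KernelAlgebra B)) (t : G) (η : Ell2 (Bidual B)) :
    ‖extApp x t η‖ ≤ ‖x‖ * ‖η‖ := by
  refine (norm_sec_le _).trans (ContinuousLinearMap.opNorm_le_bound _ (by positivity) fun g => ?_)
  refine (x.norm_ev_le _).trans ?_
  rw [_root_.mul_assoc]
  gcongr
  refine (ContinuousLinearMap.opNorm_comp_le g (orbit t η)).trans ?_
  rw [mul_comm]
  gcongr
  exact norm_orbit_le t η

lemma coeff₁_add (t : G) (ξ η η' : Ell2 (Bidual B)) (p : Pre (Bidual B) 1) :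
    coeff₁ (B := B) t ξ (η + η') p = coeff₁ t ξ η p + coeff₁ t ξ η' p := dual_ext fun k => by
  rw [add_apply, coeff₁_of, coeff₁_of, coeff₁_of, map_add, Ell2.inner_add_right, pair_add_left]

lemma coeff₁_smul (z : ℂ) (t : G) (ξ η : Ell2 (Bidual B)) (p : Pre (Bidual B) 1) :
    coeff₁ (B := B) t ξ (z • η) p = z • coeff₁ t ξ η p := dual_ext fun k => by
  rw [smul_apply, coeff₁_of, coeff₁_of, map_smul, Ell2.inner_smul_right, pair_smul_left]; rfl

lemma ext_pair_inner {η η' : Ell2 (Bidual B)} (h : ∀ (ξ : Ell2 (Bidual B)) (p : Pre (Bidual B) 1),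
    pair (Ell2.inner ξ η) p = pair (Ell2.inner ξ η') p) : η = η' :=
  Ell2.ext_inner fun ξ => pair_ext (h ξ)

/-- The operator `x_t` for `x` in the bidual of `𝕜(B)`. -/
def extL (x : CStarBidual (KernelAlgebra B)) (t : G) : Ell2 (Bidual B) →L[ℂ] Ell2 (Bidual B) :=
  LinearMap.mkContinuous
    { toFun := extApp x t
      map_add' := fun η η' => ext_pair_inner fun ξ p => by
        rw [Ell2.inner_add_right, pair_add_left, pair_inner_extApp, pair_inner_extApp,
          pair_inner_extApp, coeff₁_add]
        exact map_add (show StrongDual ℂ (StrongDual ℂ (KernelAlgebra B)) from x) _ _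
      map_smul' := fun z η => ext_pair_inner fun ξ p => by
        rw [RingHom.id_apply, Ell2.inner_smul_right, pair_smul_left, pair_inner_extApp,
          pair_inner_extApp, coeff₁_smul]
        exact map_smul (show StrongDual ℂ (StrongDual ℂ (KernelAlgebra B)) from x) _ _ }
    ‖x‖ (norm_extApp_le x t)

lemma norm_extL_le (x : CStarBidual (KernelAlgebra B)) (t : G) : ‖extL x t‖ ≤ ‖x‖ :=
  LinearMap.mkContinuous_norm_le _ (norm_nonneg x) _

lemma conjDual_coeff₁ (t : G) (ξ η : Ell2 (Bidual B)) {p q : Pre (Bidual B) 1}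
    (hq : ∀ x : UnitFibre (Bidual B), pair (star x) p = conj (pair x q)) :
    conjDualL ((starL ℂ : KernelAlgebra B ≃L⋆[ℂ] KernelAlgebra B) :
      KernelAlgebra B →L⋆[ℂ] KernelAlgebra B) (coeff₁ t ξ η p) = coeff₁ t η ξ q :=
  dual_ext fun k => by
    have h : coeff₁ t ξ η p (star (of k)) = conj (coeff₁ t η ξ q (of k)) := by
      rw [← of_star, coeff₁_of, coeff₁_of, ← hq, map_star, ← EllNorm.inner_app, Ell2.star_inner]
    change conj (coeff₁ t ξ η p (star (of k))) = _
    rw [h, Complex.conj_conj]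

lemma inner_extApp (x : CStarBidual (KernelAlgebra B)) (t : G) (ξ η : Ell2 (Bidual B)) :
    Ell2.inner (extApp x t ξ) η = Ell2.inner ξ (extApp (star x) t η) := pair_ext fun p => by
  obtain ⟨q, -, hq⟩ := exists_pair_star (M := Bidual B) p
  rw [pair_inner_extApp, CStarBidual.ev_star, conjDual_coeff₁ t ξ η hq, ← pair_inner_extApp, ← hq,
    Ell2.star_inner]

/-- The source of multiplicativity. For a fixed kernel `k`, the functional `l ↦ p(⟨ξ, k_t l_t η⟩)`
is again a coefficient, with `ξ` replaced by `(k*)_t ξ`; applying `y` to it turns `l_t η` into `y_t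
η`. -/
lemma arensAux_coeff₁ (y : CStarBidual (KernelAlgebra B)) (t : G) (ξ η : Ell2 (Bidual B))
    (p : Pre (Bidual B) 1) :
    arensAux (ContinuousLinearMap.mul ℂ (KernelAlgebra B)) y (coeff₁ t ξ η p) =
      coeff₁ t ξ (extApp y t η) p := dual_ext fun k => by
  have h : (coeff₁ t ξ η p).comp (ContinuousLinearMap.mul ℂ (KernelAlgebra B) (of k)) =
      coeff₁ t ((rep B (star k)).app t ξ) η p := dual_ext fun l => by
    change coeff₁ t ξ η p (of k * of l) = _
    rw [← of_mul, coeff₁_of, coeff₁_of, map_mul, map_star, EllNorm.inner_app, star_star]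
    rfl
  change y.ev ((coeff₁ t ξ η p).comp (ContinuousLinearMap.mul ℂ (KernelAlgebra B) (of k))) = _
  rw [h, ← pair_inner_extApp, coeff₁_of, map_star, EllNorm.inner_app, star_star]

variable (B) in
/-- The extension of the representation of `𝕜(B)` to its bidual. -/
def extHom : CStarBidual (KernelAlgebra B) →⋆ₙₐ[ℂ] EllNorm B where
  toFun x := ⟨extL x, extL (star x), ⟨max ‖x‖ ‖star x‖, fun t =>
    ⟨(norm_extL_le x t).trans (le_max_left _ _), (norm_extL_le (star x) t).trans (le_max_right _ _)⟩⟩,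
    inner_extApp x⟩
  map_smul' z x := EllInfty.ext' fun t η => ext_pair_inner fun ξ p => by
    change pair (Ell2.inner ξ (extApp (z • x) t η)) p = pair (Ell2.inner ξ (z • extApp x t η)) p
    rw [Ell2.inner_smul_right, pair_smul_left, pair_inner_extApp, pair_inner_extApp,
      CStarBidual.ev_smul]
  map_zero' := EllInfty.ext' fun t η => ext_pair_inner fun ξ p => by
    change pair (Ell2.inner ξ (extApp 0 t η)) p = pair (Ell2.inner ξ 0) p
    rw [pair_inner_extApp, ← zero_smul ℂ (0 : Ell2 (Bidual B)), Ell2.inner_smul_right,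
      pair_smul_left, zero_mul]
    rfl
  map_add' x y := EllInfty.ext' fun t η => ext_pair_inner fun ξ p => by
    change pair (Ell2.inner ξ (extApp (x + y) t η)) p =
      pair (Ell2.inner ξ (extApp x t η + extApp y t η)) p
    rw [Ell2.inner_add_right, pair_add_left, pair_inner_extApp, pair_inner_extApp,
      pair_inner_extApp, CStarBidual.ev_add]
  map_mul' x y := EllInfty.ext' fun t η => ext_pair_inner fun ξ p => by
    change pair (Ell2.inner ξ (extApp (x * y) t η)) p =
      pair (Ell2.inner ξ (extApp x t (extApp y t η))) p
    rw [pair_inner_extApp, pair_inner_extApp, CStarBidual.ev_mul, arensAux_coeff₁]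
  map_star' x := EllInfty.eq_star fun t ξ η => inner_extApp x t ξ η

/-- The norm of the data of an element of the predual. -/
def cost (ω : EllInfty.PredualElt (Bidual B)) : ℝ := ∑' n, ‖ω.x n‖ * ‖ω.y n‖ * ‖ω.p n‖

/-- The functional on `𝕜(B)` defined by an element of the predual. -/
def coeff (ω : EllInfty.PredualElt (Bidual B)) : StrongDual ℂ (KernelAlgebra B) :=
  ∑' n, coeff₁ (ω.t n) (ω.x n) (ω.y n) (ω.p n)

lemma summable_norm_coeff₁ (ω : EllInfty.PredualElt (Bidual B)) :
    Summable fun n => ‖coeff₁ (B := B) (ω.t n) (ω.x n) (ω.y n) (ω.p n)‖ :=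
  Summable.of_nonneg_of_le (fun _ => norm_nonneg _) (fun _ => norm_coeff₁_le _ _ _ _) ω.summable

lemma eval_extHom (x : CStarBidual (KernelAlgebra B)) (ω : EllInfty.PredualElt (Bidual B)) :
    EllInfty.eval (extHom B x) ω = x.ev (coeff ω) := by
  rw [coeff, CStarBidual.ev_tsum x (summable_norm_coeff₁ ω).of_norm]
  exact tsum_congr fun n => pair_inner_extApp x (ω.t n) (ω.x n) (ω.y n) (ω.p n)

lemma coeff_of (ω : EllInfty.PredualElt (Bidual B)) (k : FinKernel B) :
    coeff ω (of k) = EllInfty.eval (rep B k) ω := by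
  have h : ContinuousLinearMap.apply ℂ ℂ (of k) (coeff ω) = ∑' n, ContinuousLinearMap.apply ℂ ℂ
      (of k) (coeff₁ (ω.t n) (ω.x n) (ω.y n) (ω.p n)) :=
    ContinuousLinearMap.map_tsum _ (summable_norm_coeff₁ ω).of_norm
  exact h.trans (tsum_congr fun n => coeff₁_of (ω.t n) (ω.x n) (ω.y n) (ω.p n) k)

end KernelAlgebra

end Extension

/-! ### Injectivity of the extension -/

section Single

variable {G : Type v} [Group G] {B : G → Type u} [∀ t, NormedAddCommGroup (B t)]
  [∀ t, NormedSpace ℂ (B t)]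

namespace FinKernel

open Classical in
/-- The kernel with the only entry `b` at `(v, r)`. -/
def single {v r w : G} (h : v * r⁻¹ = w) (b : B w) : FinKernel B :=
  mk' (Pi.single v (Pi.single r (h ▸ b : B (v * r⁻¹)))) {v, r} fun s t hst => by
    have hs : s = v := by
      by_contra hs
      exact hst (by rw [Pi.single_eq_of_ne hs]; rfl)
    subst hs
    have ht : t = r := by
      by_contra ht
      exact hst (by rw [Pi.single_eq_same, Pi.single_eq_of_ne ht])
    subst ht
    simp

open Classical in
lemma entry_single_same {v r w : G} (h : v * r⁻¹ = w) (b : B w) : (single h b).entry h = b := by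
  subst h
  change (Pi.single v (Pi.single r b) : ∀ s t : G, B (s * t⁻¹)) v r = b
  rw [Pi.single_eq_same, Pi.single_eq_same]

open Classical in
lemma entry_single_left {v r w s t u : G} (h : v * r⁻¹ = w) (b : B w) (h' : s * t⁻¹ = u)
    (hs : s ≠ v) : (single h b).entry h' = 0 := by
  subst h h'
  change (Pi.single v (Pi.single r b) : ∀ s t : G, B (s * t⁻¹)) s t = 0
  rw [Pi.single_eq_of_ne hs]; rfl

open Classical in
lemma entry_single_right {v r w s t u : G} (h : v * r⁻¹ = w) (b : B w) (h' : s * t⁻¹ = u)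
    (ht : t ≠ r) : (single h b).entry h' = 0 := by
  by_cases hs : s = v
  · subst h h' hs
    change (Pi.single s (Pi.single r b) : ∀ s t : G, B (s * t⁻¹)) s t = 0
    rw [Pi.single_eq_same, Pi.single_eq_of_ne ht]
  · exact entry_single_left h b h' hs

lemma eq_single {v r w : G} (h : v * r⁻¹ = w) {k : FinKernel B}
    (hk : ∀ s t : G, s ≠ v ∨ t ≠ r → k.entry (rfl : s * t⁻¹ = _) = 0) : k = single h (k.entry h) :=
  ext' fun s t => by
    by_cases hs : s = v
    · by_cases ht : t = r
      · subst hs ht h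
        rw [entry_single_same]
      · rw [hk s t (.inr ht), entry_single_right h _ _ ht]
    · rw [hk s t (.inl hs), entry_single_left h _ _ hs]

lemma single_add {v r w : G} (h : v * r⁻¹ = w) (b c : B w) :
    single h (b + c) = single h b + single h c := by
  refine ((eq_single h fun s t hst => ?_).trans (congrArg (single h) ?_)).symm
  · rw [entry_add]
    rcases hst with hs | ht
    · rw [entry_single_left _ _ _ hs, entry_single_left _ _ _ hs, add_zero]
    · rw [entry_single_right _ _ _ ht, entry_single_right _ _ _ ht, add_zero]
  · rw [entry_add, entry_single_same, entry_single_same]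

lemma single_smul {v r w : G} (h : v * r⁻¹ = w) (z : ℂ) (b : B w) :
    single h (z • b) = z • single h b := by
  refine ((eq_single h fun s t hst => ?_).trans (congrArg (single h) ?_)).symm
  · rw [entry_smul]
    rcases hst with hs | ht
    · rw [entry_single_left _ _ _ hs, smul_zero]
    · rw [entry_single_right _ _ _ ht, smul_zero]
  · rw [entry_smul, entry_single_same]

lemma norm2_single {v r w : G} (h : v * r⁻¹ = w) (b : B w) : norm2 (single h b) = ‖b‖ := by
  rw [norm2, finsum_eq_single _ (v, r) fun p hp => ?_]
  · rw [← norm_entry (single h b) h, entry_single_same, Real.sqrt_sq (norm_nonneg b)]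
  · have h0 : (single h b).entry (rfl : p.1 * p.2⁻¹ = _) = 0 := by
      by_cases h1 : p.1 = v
      · exact entry_single_right _ _ _ fun h2 => hp (Prod.ext h1 h2)
      · exact entry_single_left _ _ _ h1
    rw [← norm_entry (single h b) (rfl : p.1 * p.2⁻¹ = _), h0]
    simp

lemma eq_sum_single (k : FinKernel B) :
    k = ∑ s ∈ k.supp, ∑ t ∈ k.supp, single rfl (k.entry (rfl : s * t⁻¹ = _)) := by
  have hsum : ∀ {ι : Type v} (F : Finset ι) (f : ι → FinKernel B) {s t u : G} (h : s * t⁻¹ = u),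
      (∑ i ∈ F, f i).entry h = ∑ i ∈ F, (f i).entry h := fun F f s t u h =>
    map_sum (⟨⟨fun l => l.entry h, entry_zero h⟩, fun l l' => entry_add l l' h⟩ :
      FinKernel B →+ B u) f F
  refine ext' fun s t => ?_
  rw [hsum, Finset.sum_eq_single s, hsum, Finset.sum_eq_single t, entry_single_same]
  · exact fun t' _ ht' => entry_single_right _ _ _ (Ne.symm ht')
  · intro ht
    rw [entry_single_same]
    by_contra h
    exact ht (right_mem_supp _ h)
  · intro s' _ hs'
    rw [hsum]
    exact Finset.sum_eq_zero fun t' _ => entry_single_left _ _ _ (Ne.symm hs')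
  · intro hs
    rw [hsum]
    refine Finset.sum_eq_zero fun t' _ => ?_
    rw [entry_left k (rfl : s * t'⁻¹ = _) hs]
    by_cases ht : t = t'
    · subst ht; exact entry_single_same _ _
    · exact entry_single_right _ _ _ ht

variable [FellOps B] [FellBundle B]

lemma entry_mul_single (k : FinKernel B) {v r w : G} (h : v * r⁻¹ = w) (b : B w) {s a u : G}
    (ha : s * v⁻¹ = a) (hu : s * r⁻¹ = u) (hw : a * w = u) :
    (k * single h b).entry hu = mul hw (k.entry ha) b := by
  subst ha h hu
  rw [entry_mul_finsum, finsum_eq_single _ v fun t ht => ?_]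
  · rw [← entry_rfl (single rfl b), entry_single_same, entry_rfl]
  · have h0 := entry_single_left (rfl : v * r⁻¹ = _) b (rfl : t * r⁻¹ = _) ht
    rw [entry_rfl] at h0
    rw [h0, mul_zero']

lemma entry_mul_single_ne (k : FinKernel B) {v r w : G} (h : v * r⁻¹ = w) (b : B w) {s t u : G}
    (hu : s * t⁻¹ = u) (ht : t ≠ r) : (k * single h b).entry hu = 0 := by
  rw [entry_mul_finsum]
  refine (finsum_congr fun x => ?_).trans finsum_zero
  have h0 := entry_single_right h b (rfl : x * t⁻¹ = _) ht
  rw [entry_rfl] at h0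
  rw [h0, mul_zero']

lemma entry_star' (k : FinKernel B) {r s u a : G} (h : r * s⁻¹ = u) (ha : s * r⁻¹ = a)
    (hu : a⁻¹ = u) : (star k).entry h = inv hu (k.entry ha) := by
  subst ha; exact entry_star k h

/-- Compressing by a kernel with one entry `b` at `(v, r)` retains only the diagonal entry `k(v,v)`
and places `b* k(v,v) b` at `(r, r)`. This is what makes compressed functionals coefficients of the
representation. -/
lemma star_single_mul_mul_single (k : FinKernel B) {v r w a : G} (h : v * r⁻¹ = w) (b : B w)
    (ha : v * v⁻¹ = a) (haw : a * w = w) :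
    star (single h b) * (k * single h b) =
      single (mul_inv_cancel r) (mul (inv_mul_cancel w) (inv rfl b) (mul haw (k.entry ha) b)) := by
  -- The involution reduces left multiplication to right multiplication by a one-entry kernel, whose
  -- entries are known.
  have hs : ∀ l : FinKernel B, star (single h b) * l = star (star l * single h b) := fun l => by
    rw [star_mul, star_star]
  rw [hs]
  have e1 : r * v⁻¹ = w⁻¹ := by rw [← h]; group
  have e2 : w⁻¹ * w = 1 := inv_mul_cancel w
  refine (eq_single (mul_inv_cancel r) fun s t hst => ?_).trans (congrArg _ ?_)
  · rw [entry_star' _ rfl rfl (by group)]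
    rcases hst with hs | ht
    · rw [entry_mul_single_ne _ _ _ _ hs, inv_zero']
    · have h1 : (star (k * single h b) * single h b).entry (rfl : t * s⁻¹ = _) = 0 := by
        by_cases hs : s = r
        · subst hs
          rw [entry_mul_single _ h b rfl rfl (by rw [← h]; group), entry_star' _ rfl rfl (by group),
            entry_mul_single_ne _ _ _ _ ht, inv_zero', zero_mul']
        · exact entry_mul_single_ne _ _ _ _ hs
      rw [h1, inv_zero']
  · rw [entry_star' _ (mul_inv_cancel r) (mul_inv_cancel r) inv_one,
      entry_mul_single _ h b e1 (mul_inv_cancel r) e2, entry_star' _ e1 h rfl,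
      entry_mul_single k h b ha h haw, FellBundle.inv_mul e2 (_root_.inv_inv w) rfl inv_one e2,
      FellBundle.inv_inv]

lemma norm_le_norm2 (k : FinKernel B) : ‖k‖ ≤ norm2 k :=
  maxCStarSeminorm_le (norm2_nonneg k) fun _ hp => hp.2.2 k

end FinKernel

variable [FellOps B] [FellBundle B] [WStarFellBundle (Bidual B)]

open FinKernel

namespace KernelAlgebra

/-- The kernels with a single entry, as elements of `𝕜(B)`. -/
def singleL {v r w : G} (h : v * r⁻¹ = w) : B w →L[ℂ] KernelAlgebra B :=
  LinearMap.mkContinuous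
    { toFun := fun b => of (single h b)
      map_add' := fun b c => by rw [single_add, of_add]
      map_smul' := fun z b => by rw [single_smul, of_smul]; rfl } 1 fun b => by
    rw [one_mul, ← norm2_single h b]
    exact (norm_of _).le.trans (norm_le_norm2 _)

lemma dual_ext_single {φ ψ : StrongDual ℂ (KernelAlgebra B)}
    (h : ∀ (v r : G) (b : B (v * r⁻¹)), φ (singleL rfl b) = ψ (singleL rfl b)) : φ = ψ := by
  refine dual_ext fun k => ?_
  change φ (ofL B k) = ψ (ofL B k)
  rw [eq_sum_single k]
  simp only [map_sum]
  exact Finset.sum_congr rfl fun s _ => Finset.sum_congr rfl fun t _ => h s t _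

end KernelAlgebra

end Single

/-! ### Faithfulness on the bidual -/

section Injective

namespace CStarBidual

variable {A : Type*} [NonUnitalCStarAlgebra A]

/-- The canonical inclusion of a C*-algebra into its bidual. -/
def incl (a : A) : CStarBidual A := NormedSpace.inclusionInDoubleDual ℂ A a

lemma ev_zero_right (x : CStarBidual A) : ev x 0 = 0 :=
  map_zero (show StrongDual ℂ (StrongDual ℂ A) from x)

lemma ev_incl (a : A) (φ : StrongDual ℂ A) : ev (incl a) φ = φ a := rfl

lemma star_incl (a : A) : star (incl a) = incl (star a) :=
  ev_ext fun φ => by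
    rw [ev_star, ev_incl, ev_incl, conjDualL_apply, Complex.conj_conj]
    rfl

lemma ev_incl_mul_mul_incl (a b : A) (x : CStarBidual A) {φ ψ : StrongDual ℂ A}
    (h : ∀ c, ψ c = φ (b * (c * a))) : ev (incl b * (x * incl a)) φ = ev x ψ :=
  congrArg (ev x) (ContinuousLinearMap.ext fun c => (h c).symm)

lemma ev_mul_incl (a : A) (x : CStarBidual A) (φ : StrongDual ℂ A) :
    ev (x * incl a) φ = arensAux (ContinuousLinearMap.mul ℂ A).flip x φ a :=
  congrArg (ev x) (ContinuousLinearMap.ext fun _ => rfl)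

lemma ev_mul' (x y : CStarBidual A) (φ : StrongDual ℂ A) :
    ev (x * y) φ = ev y (arensAux (ContinuousLinearMap.mul ℂ A).flip x φ) :=
  isRegular_mul A x y φ

end CStarBidual

variable {G : Type v} [Group G] {B : G → Type u} [∀ t, NormedAddCommGroup (B t)]
  [∀ t, NormedSpace ℂ (B t)]

section

variable {M : G → Type u} [∀ t, NormedAddCommGroup (M t)] [∀ t, NormedSpace ℂ (M t)] [FellOps M]
  [FellBundle M]

open FinKernel

open Classical in
/-- The section with the only value `b` at `w`. -/
def delta (w : G) (b : M w) : Ell2 M :=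
  Ell2.ofFinset (Pi.single w b) {w} fun _ ht => Pi.single_eq_of_ne (by simpa using ht) _

open Classical in
lemma val_delta_same (w : G) (b : M w) : (delta w b).val w = b := Pi.single_eq_same w b

open Classical in
lemma val_delta_ne {w t : G} (b : M w) (h : t ≠ w) : (delta w b).val t = 0 :=
  Pi.single_eq_of_ne h b

lemma act_delta (k : FinKernel M) (w s : G) (b : M w) :
    act k (delta w b).val s = mul (act_aux s w) (k.entry rfl) b := by
  rw [act, finsum_eq_single _ w fun t ht => by rw [val_delta_ne b ht]; exact mul_zero' _ _,
    val_delta_same, entry_rfl]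

lemma inner_delta [FibrePredual M] (w : G) (b : M w) (η : Ell2 M) :
    Ell2.inner (delta w b) η = mul (B := M) (inv_mul_cancel w) (inv rfl b) (η.val w) := by
  rw [Ell2.inner_eq_fip _ _ {w} fun t ht =>
    ip_zero_left _ _ _ (val_delta_ne b (by simpa using ht)), fip, Finset.sum_singleton, ip,
    val_delta_same]

end

variable [FellOps B] [FellBundle B] [WStarFellBundle (Bidual B)]

open FinKernel Bidual

namespace KernelAlgebra

lemma val_rep_delta (k : FinKernel B) (t w s : G) (b : B w) {u : G} (h : s * t⁻¹ * (w * t⁻¹)⁻¹ = u)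
    (h' : u * w = s) :
    ((rep B k).app t (delta w (incl w b))).val s = incl s (mul h' (k.entry h) b) := by
  have e : s * w⁻¹ = u := by rw [← h]; group
  subst e
  change act (FinKernel.shift t⁻¹ (toBidual k)) (delta w (incl w b)).val s = _
  rw [act_delta, entry_shift t⁻¹ _ _ h, entry_toBidual, incl_mul]

/-- At the coordinate `r⁻¹` the translated kernel has the entry `k(v,v)` at `(v r⁻¹, v r⁻¹)`, which
is where the section with the value `b` lives. The coordinate `e` would only reach `r = e`; hence
the need for all translates of `π`. -/
lemma coeff₁_delta (k : FinKernel B) (v r : G) (b : B (v * r⁻¹))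
    (φ : StrongDual ℂ (KernelAlgebra B)) :
    coeff₁ r⁻¹ (delta (v * r⁻¹) (incl _ b)) (delta (v * r⁻¹) (incl _ b))
        (φ.comp (singleL (mul_inv_cancel r)) : StrongDual ℂ (B 1)) (of k) =
      φ (star (of (single rfl b)) * (of k * of (single rfl b))) := by
  have e : v * r⁻¹ * (r⁻¹)⁻¹ = v := by group
  have h : v * r⁻¹ * (r⁻¹)⁻¹ * (v * r⁻¹ * (r⁻¹)⁻¹)⁻¹ = 1 := by group
  rw [coeff₁_of, inner_delta, val_rep_delta k r⁻¹ _ _ b h (one_mul _), ← of_star, ← of_mul,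
    ← of_mul, star_single_mul_mul_single k rfl b (mul_inv_cancel v) (one_mul _), ← incl_inv,
    ← incl_mul, entry_congr k e e h (mul_inv_cancel v)]
  rfl

lemma ev_coeff₁_eq_zero {x : CStarBidual (KernelAlgebra B)} (hx : extHom B x = 0) (t : G)
    (ξ η : Ell2 (Bidual B)) (p : Pre (Bidual B) 1) : x.ev (coeff₁ t ξ η p) = 0 := by
  have h : extApp x t η = 0 := congrArg (fun f : EllNorm B => f.app t η) hx
  rw [← pair_inner_extApp, h, ← zero_smul ℂ (0 : Ell2 (Bidual B)), Ell2.inner_smul_right,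
    pair_smul_left, zero_mul]

/-- `(xa)* (xa) = a* (x* x) a` vanishes at every `φ`, because `φ(a* · a)` is a coefficient
functional and `x* x` is also in the kernel of the extension. -/
lemma mul_incl_single_eq_zero {x : CStarBidual (KernelAlgebra B)} (hx : extHom B x = 0) (v r : G)
    (b : B (v * r⁻¹)) : x * CStarBidual.incl (of (single rfl b)) = 0 := by
  set a : KernelAlgebra B := of (single rfl b)
  have hy : extHom B (star x * x) = 0 := by rw [map_mul, hx, mul_zero]
  rw [← CStarRing.star_mul_self_eq_zero_iff, star_mul, CStarBidual.star_incl,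
    _root_.mul_assoc, ← _root_.mul_assoc (star x)]
  refine CStarBidual.ev_ext fun φ => ?_
  let ψ := coeff₁ r⁻¹ (delta (v * r⁻¹) (incl _ b)) (delta (v * r⁻¹) (incl _ b))
    (φ.comp (singleL (mul_inv_cancel r)) : StrongDual ℂ (B 1))
  have hψ : ∀ c, ψ c = φ (star a * (c * a)) := fun c => by
    induction c using ind with
    | hp => exact isClosed_eq ψ.continuous (φ.continuous.comp (by fun_prop))
    | ih k => exact coeff₁_delta k v r b φ
  rw [CStarBidual.ev_incl_mul_mul_incl a (star a) (star x * x) hψ]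
  exact ev_coeff₁_eq_zero hy _ _ _ _

/-- An `x` in the kernel annihilates all one-entry kernels and so `𝕜(B)`, by density. Regularity of
the product makes `y ↦ xy` weak*-continuous, so that `x` annihilates the bidual, in particular `x*`.
-/
lemma extHom_injective : Function.Injective (extHom B) := by
  rw [injective_iff_map_eq_zero]
  intro x hx
  have h : ∀ φ, arensAux (ContinuousLinearMap.mul ℂ (KernelAlgebra B)).flip x φ = 0 := fun φ =>
    dual_ext_single fun v r b => by
      have := congrArg (fun y => CStarBidual.ev y φ) (mul_incl_single_eq_zero hx v r b)
      exact (CStarBidual.ev_mul_incl (of (single rfl b)) x φ).symm.trans this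
  rw [← CStarRing.mul_star_self_eq_zero_iff]
  refine CStarBidual.ev_ext fun φ => ?_
  rw [CStarBidual.ev_mul', h]
  exact CStarBidual.ev_zero_right _

lemma norm_extHom (x : CStarBidual (KernelAlgebra B)) : ‖extHom B x‖ = ‖x‖ :=
  NonUnitalStarAlgHom.norm_map (extHom B) extHom_injective x

end KernelAlgebra

end Injective

/-! ### Sums of atoms -/

section Atoms

variable {X J : Type*} [NormedAddCommGroup X] [NormedSpace ℂ X] {c : J → X} {w : J → ℝ}

lemma norm_sum_map_le (hc : ∀ j, ‖c j‖ ≤ w j) (l : List J) :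
    ‖(l.map c).sum‖ ≤ (l.map w).sum := by
  induction l with
  | nil => simp
  | cons j l ih =>
    rw [List.map_cons, List.map_cons, List.sum_cons, List.sum_cons]
    exact (norm_add_le _ _).trans (add_le_add (hc j) ih)

lemma exists_list_smul (hs : ∀ (z : ℂ) j, ∃ j', c j' = z • c j ∧ w j' = ‖z‖ * w j) (z : ℂ)
    (l : List J) :
    ∃ l' : List J, (l'.map c).sum = z • (l.map c).sum ∧ (l'.map w).sum = ‖z‖ * (l.map w).sum := by
  choose f hf hf' using hs z
  refine ⟨l.map f, ?_, ?_⟩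
  · rw [List.smul_sum, List.map_map, List.map_map]
    exact congrArg List.sum (List.map_congr_left fun j _ => hf j)
  · rw [← List.sum_map_mul_left, List.map_map]
    exact congrArg List.sum (List.map_congr_left fun j _ => hf' j)

/-- A bipolar argument: a functional separating `φ` from the closed convex set would have norm at
most `u` by `hd`, yet real part greater than `u` at a vector of norm at most one. -/
lemma mem_closure_sums (hs : ∀ (z : ℂ) j, ∃ j', c j' = z • c j ∧ w j' = ‖z‖ * w j)
    (hw : ∀ j, 0 ≤ w j)
    (hd : ∀ (x : StrongDual ℂ X) (u : ℝ), 0 ≤ u → (∀ j, ‖x (c j)‖ ≤ u * w j) → ‖x‖ ≤ u) {φ : X}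
    (hφ : ‖φ‖ ≤ 1) : φ ∈ closure {ψ | ∃ l : List J, (l.map c).sum = ψ ∧ (l.map w).sum ≤ 1} := by
  set K := {ψ | ∃ l : List J, (l.map c).sum = ψ ∧ (l.map w).sum ≤ 1}
  have hK : Convex ℝ K := by
    rintro _ ⟨l₁, rfl, h₁⟩ _ ⟨l₂, rfl, h₂⟩ a b ha hb hab
    obtain ⟨l₁', e₁, f₁⟩ := exists_list_smul hs (a : ℂ) l₁
    obtain ⟨l₂', e₂, f₂⟩ := exists_list_smul hs (b : ℂ) l₂
    refine ⟨l₁' ++ l₂', ?_, ?_⟩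
    · rw [List.map_append, List.sum_append, e₁, e₂, Complex.coe_smul, Complex.coe_smul]
    · rw [List.map_append, List.sum_append, f₁, f₂, Complex.norm_real, Complex.norm_real,
        Real.norm_of_nonneg ha, Real.norm_of_nonneg hb]
      nlinarith
  by_contra hn
  obtain ⟨x, u, hxu, hux⟩ := RCLike.geometric_hahn_banach_closed_point (𝕜 := ℂ) hK.closure
    isClosed_closure hn
  have hu : 0 < u := by
    have := hxu 0 (subset_closure ⟨[], by simp⟩)
    simpa using this
  have hxn : ‖x‖ ≤ u := hd x u hu.le fun j => by
    obtain ⟨z, hz, hz'⟩ := RCLike.exists_norm_eq_mul_self (x (c j))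
    -- The atom is scaled by `r` and rotated so that `x` is real on it. For `w j > 0` the best scale
    -- is `(w j)⁻¹`; for `w j = 0` every scale is allowed, which forces `x (c j) = 0`.
    have key : ∀ r : ℝ, 0 ≤ r → r * w j ≤ 1 → r * ‖x (c j)‖ ≤ u := fun r hr hr1 => by
      obtain ⟨j', e, f⟩ := hs (r * z) j
      have h1 := hxu (c j') (subset_closure ⟨[j'], by simp, by
        rw [List.map_singleton, List.sum_singleton, f, norm_mul, hz, mul_one, Complex.norm_real,
          Real.norm_of_nonneg hr]
        exact hr1⟩)
      have h2 : x (c j') = ((r * ‖x (c j)‖ : ℝ) : ℂ) := by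
        rw [e, map_smul, smul_eq_mul, _root_.mul_assoc, ← hz']
        push_cast
        rfl
      rw [h2] at h1
      exact le_of_lt (by simpa using h1)
    rcases (hw j).eq_or_lt with h0 | h0
    · rw [← h0, mul_zero]
      by_contra! hpos
      have h1 := key ((u + 1) / ‖x (c j)‖) (by positivity) (by rw [← h0]; simp)
      rw [div_mul_cancel₀ _ hpos.ne'] at h1
      linarith
    · have h1 := key (w j)⁻¹ (by positivity) (inv_mul_cancel₀ h0.ne').le
      rwa [inv_mul_le_iff₀ h0, mul_comm] at h1
  have h1 : RCLike.re (x φ) ≤ u := (RCLike.re_le_norm (x φ)).trans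
    ((x.le_opNorm φ).trans (by nlinarith [norm_nonneg x, norm_nonneg φ]))
  exact absurd hux (not_lt.2 h1)

lemma exists_list_approx (hs : ∀ (z : ℂ) j, ∃ j', c j' = z • c j ∧ w j' = ‖z‖ * w j)
    (hw : ∀ j, 0 ≤ w j)
    (hd : ∀ (x : StrongDual ℂ X) (u : ℝ), 0 ≤ u → (∀ j, ‖x (c j)‖ ≤ u * w j) → ‖x‖ ≤ u) (φ : X) :
    ∃ l : List J, (l.map w).sum ≤ ‖φ‖ ∧ ‖φ - (l.map c).sum‖ ≤ ‖φ‖ / 2 := by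
  rcases eq_or_ne φ 0 with rfl | h0
  · exact ⟨[], by simp⟩
  have h0' : 0 < ‖φ‖ := norm_pos_iff.2 h0
  have h1 : ‖((‖φ‖⁻¹ : ℝ) : ℂ) • φ‖ ≤ 1 := by
    rw [norm_smul, Complex.norm_real, Real.norm_of_nonneg (by positivity), inv_mul_cancel₀ h0'.ne']
  obtain ⟨_, ⟨l, rfl, hl⟩, hd'⟩ := Metric.mem_closure_iff.1 (mem_closure_sums hs hw hd h1) (1 / 2)
    (by norm_num)
  obtain ⟨l', e, f⟩ := exists_list_smul hs ((‖φ‖ : ℝ) : ℂ) l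
  rw [Complex.norm_real, Real.norm_of_nonneg h0'.le] at f
  refine ⟨l', by rw [f]; nlinarith, ?_⟩
  have h2 : φ - (l'.map c).sum =
      ((‖φ‖ : ℝ) : ℂ) • (((‖φ‖⁻¹ : ℝ) : ℂ) • φ - (l.map c).sum) := by
    rw [smul_sub, smul_smul, ← Complex.ofReal_mul, mul_inv_cancel₀ h0'.ne', Complex.ofReal_one,
      one_smul, e]
  rw [h2, norm_smul, Complex.norm_real, Real.norm_of_nonneg h0'.le, ← dist_eq_norm]
  nlinarith

/-- If the norm of a functional on a Banach space is determined by its values on atoms, then every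
vector is an absolutely convergent series of atoms. -/
theorem exists_tsum_atoms [CompleteSpace X] [Nonempty J]
    (hs : ∀ (z : ℂ) j, ∃ j', c j' = z • c j ∧ w j' = ‖z‖ * w j) (hc : ∀ j, ‖c j‖ ≤ w j)
    (hd : ∀ (x : StrongDual ℂ X) (u : ℝ), 0 ≤ u → (∀ j, ‖x (c j)‖ ≤ u * w j) → ‖x‖ ≤ u) (φ : X) :
    ∃ j : ℕ → J, Summable (fun n => w (j n)) ∧ ∑' n, w (j n) ≤ 2 * ‖φ‖ ∧ ∑' n, c (j n) = φ := by
  have hw : ∀ j, 0 ≤ w j := fun j => (norm_nonneg _).trans (hc j)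
  choose L hL hL' using exists_list_approx hs hw hd
  -- Successive remainders. Each step halves the norm at a weight of at most the current norm, so
  -- the total weight is at most `‖φ‖ ∑ 2⁻ⁿ = 2 ‖φ‖`.
  let r : ℕ → X := fun n => n.rec φ fun _ ψ => ψ - ((L ψ).map c).sum
  have hr : ∀ n, r (n + 1) = r n - ((L (r n)).map c).sum := fun n => rfl
  have hrn : ∀ n, ‖r n‖ ≤ ‖φ‖ * (1 / 2) ^ n := fun n => by
    induction n with
    | zero => simp [r]
    | succ n ih =>
      rw [hr, pow_succ]
      refine (hL' (r n)).trans ?_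
      linarith
  let f : (Σ n, Fin (L (r n)).length) → J := fun i => (L (r i.1))[i.2.1]
  have hfc : ∀ n, ∑ i, c (f ⟨n, i⟩) = ((L (r n)).map c).sum := fun n => Fin.sum_univ_fun_getElem _ _
  have hfw : ∀ n, ∑ i, w (f ⟨n, i⟩) = ((L (r n)).map w).sum := fun n => Fin.sum_univ_fun_getElem _ _
  have hle : ∀ n, ((L (r n)).map w).sum ≤ ‖φ‖ * (1 / 2) ^ n := fun n => (hL _).trans (hrn n)
  have hnn : ∀ n, 0 ≤ ((L (r n)).map w).sum := fun n => by
    rw [← hfw]; exact Finset.sum_nonneg fun i _ => hw _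
  have hgeom : Summable fun n : ℕ => ‖φ‖ * (1 / 2 : ℝ) ^ n := summable_geometric_two.mul_left _
  have hsum : Summable fun n => ((L (r n)).map w).sum := hgeom.of_nonneg_of_le hnn hle
  have hsw : Summable fun i => w (f i) := by
    rw [summable_sigma_of_nonneg fun i => hw _]
    refine ⟨fun n => Summable.of_finite, ?_⟩
    simpa only [tsum_fintype, hfw] using hsum
  have hsc : Summable fun i => c (f i) := Summable.of_norm_bounded hsw fun i => hc _
  have hw2 : ∑' i, w (f i) ≤ 2 * ‖φ‖ := by
    rw [hsw.tsum_sigma]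
    simp only [tsum_fintype, hfw]
    refine (hsum.tsum_le_tsum hle hgeom).trans ?_
    rw [tsum_mul_left, tsum_geometric_two, mul_comm]
  have hcφ : ∑' i, c (f i) = φ := by
    rw [hsc.tsum_sigma]
    simp only [tsum_fintype, hfc]
    have h1 : Summable fun n => ((L (r n)).map c).sum :=
      Summable.of_norm_bounded hsum fun n => norm_sum_map_le hc _
    refine HasSum.tsum_eq (h1.hasSum_iff_tendsto_nat.2 ?_)
    have h2 : ∀ N, ∑ n ∈ Finset.range N, ((L (r n)).map c).sum = φ - r N := fun N => by
      refine Eq.trans (Finset.sum_congr rfl fun n _ => ?_) (Finset.sum_range_sub' r N)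
      rw [hr, sub_sub_cancel]
    simp only [h2]
    have h3 : Filter.Tendsto r Filter.atTop (𝓝 0) := squeeze_zero_norm hrn
      (by simpa using hgeom.tendsto_atTop_zero)
    simpa using h3.const_sub φ
  obtain ⟨j₀⟩ := ‹Nonempty J›
  -- A zero atom of weight zero fills the indices not used when the countable family of atoms is
  -- spread over `ℕ`.
  obtain ⟨z, hz, hz'⟩ := hs 0 j₀
  rw [zero_smul] at hz
  rw [norm_zero, zero_mul] at hz'
  obtain ⟨e, he⟩ := exists_injective_nat (Σ n, Fin (L (r n)).length)
  have hex : ∀ n ∉ Set.range e, Function.extend e f (fun _ => z) n = z := fun n hn =>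
    Function.extend_apply' _ _ _ hn
  have hin : ∀ i, Function.extend e f (fun _ => z) (e i) = f i := he.extend_apply f _
  refine ⟨Function.extend e f fun _ => z, ?_, ?_, ?_⟩
  · rw [← he.summable_iff fun n hn => by rw [hex n hn, hz']]
    simpa only [Function.comp_def, hin] using hsw
  · rw [← he.tsum_eq (f := fun n => w (Function.extend e f (fun _ => z) n)) fun n hn => by
      by_contra h; exact hn (by simp only [hex n h, hz'])]
    simpa only [hin] using hw2
  · rw [← he.tsum_eq (f := fun n => c (Function.extend e f (fun _ => z) n)) fun n hn => by
      by_contra h; exact hn (by simp only [hex n h, hz])]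
    simpa only [hin] using hcφ

end Atoms

/-! ### Functionals on `𝕜(B)` as series of coefficients -/

section Surjective

variable {G : Type v} [Group G] {B : G → Type u} [∀ t, NormedAddCommGroup (B t)]
  [∀ t, NormedSpace ℂ (B t)] [FellOps B] [FellBundle B] [WStarFellBundle (Bidual B)]

open Bidual

namespace KernelAlgebra

/-- The extension is isometric, and the norm of `x_t η` is detected by testing against `ξ = x_t η`
itself. -/
lemma norm_le_of_coeff₁ (x : CStarBidual (KernelAlgebra B)) {u : ℝ} (hu : 0 ≤ u)
    (h : ∀ (t : G) (ξ η : Ell2 (Bidual B)) (p : Pre (Bidual B) 1),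
      ‖x.ev (coeff₁ t ξ η p)‖ ≤ u * (‖ξ‖ * ‖η‖ * ‖p‖)) : ‖x‖ ≤ u := by
  rw [← norm_extHom]
  refine EllNorm.norm_le fun t => ContinuousLinearMap.opNorm_le_bound _ hu fun η => ?_
  change ‖extApp x t η‖ ≤ _
  have h1 : ‖extApp x t η‖ ^ 2 ≤ u * ‖η‖ * ‖extApp x t η‖ := by
    rw [← norm_inner_self]
    refine norm_le_of_pair _ _ (by positivity) fun p => ?_
    rw [pair_inner_extApp]
    exact (h t _ η p).trans_eq (by ring)
  rcases (norm_nonneg (extApp x t η)).eq_or_lt with h0 | h0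
  · rw [← h0]; positivity
  · rw [sq] at h1
    exact le_of_mul_le_mul_right h1 h0

lemma coeff₁_smul_right (z : ℂ) (t : G) (ξ η : Ell2 (Bidual B)) (p : Pre (Bidual B) 1) :
    coeff₁ (B := B) t ξ η (z • p) = z • coeff₁ t ξ η p := dual_ext fun k => by
  rw [smul_apply, coeff₁_of, coeff₁_of, pair_smul_right]; rfl

/-- `exists_tsum_atoms` in the dual of `𝕜(B)` with coefficients as atoms, whose norming property is
`norm_le_of_coeff₁`. Scalars are absorbed by `p`. -/
lemma exists_coeff_eq (φ : StrongDual ℂ (KernelAlgebra B)) :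
    ∃ ω : EllInfty.PredualElt (Bidual B), coeff ω = φ ∧ cost ω ≤ 2 * ‖φ‖ := by
  let J := G × Ell2 (Bidual B) × Ell2 (Bidual B) × Pre (Bidual B) 1
  obtain ⟨j, h1, h2, h3⟩ := exists_tsum_atoms (J := J)
    (c := fun j => coeff₁ (B := B) j.1 j.2.1 j.2.2.1 j.2.2.2)
    (w := fun j => ‖j.2.1‖ * ‖j.2.2.1‖ * ‖j.2.2.2‖)
    (fun z j => ⟨(j.1, j.2.1, j.2.2.1, z • j.2.2.2), coeff₁_smul_right _ _ _ _ _, by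
      rw [norm_smul]; ring⟩) (fun j => norm_coeff₁_le _ _ _ _)
    (fun x u hu h => norm_le_of_coeff₁ x hu fun t ξ η p => h (t, ξ, η, p)) φ
  exact ⟨⟨fun n => (j n).1, fun n => (j n).2.1, fun n => (j n).2.2.1, fun n => (j n).2.2.2, h1⟩,
    h3, h2⟩

end KernelAlgebra

end Surjective

/-! ### The range of the extension -/

section Range

variable {G : Type v} [Group G]

section

variable {M : G → Type u} [∀ t, NormedAddCommGroup (M t)] [∀ t, NormedSpace ℂ (M t)]

namespace FinKernel

lemma shift_single {v r w : G} (h : v * r⁻¹ = w) (b : M w) (t : G)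
    (h' : v * t * (r * t)⁻¹ = w) : shift t⁻¹ (single h b) = single h' b := by
  refine (eq_single h' fun s s' hs => ?_).trans (congrArg (single h') ?_)
  · rw [entry_shift t⁻¹ _ _ (show s * t⁻¹ * (s' * t⁻¹)⁻¹ = s * s'⁻¹ by group)]
    rcases hs with hs | hs
    · exact entry_single_left _ _ _ fun h => hs (by rw [← h]; group)
    · exact entry_single_right _ _ _ fun h => hs (by rw [← h]; group)
  · have e : ∀ x : G, x * t * t⁻¹ = x := fun x => by group
    rw [entry_shift t⁻¹ _ h' (show v * t * t⁻¹ * (r * t * t⁻¹)⁻¹ = w by rw [e, e, h]),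
      entry_congr _ (e v) (e r) _ h, entry_single_same]

variable [FellOps M] [FellBundle M]

lemma ker_single {v r w : G} (h : v * r⁻¹ = w) (b : M w) (h' : w * r = v) (η : Ell2 M) :
    ker (single h b) η = delta v (mul h' b (η.val r)) := Ell2.ext' fun s => by
  subst h
  rw [val_ker, act, finsum_eq_single _ r fun t ht => by
    have h0 := entry_single_right (rfl : v * r⁻¹ = _) b (rfl : s * t⁻¹ = _) ht
    rw [entry_rfl] at h0
    rw [h0, zero_mul']]
  by_cases hs : s = v
  · subst hs
    rw [val_delta_same, ← entry_rfl, entry_single_same]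
  · rw [val_delta_ne _ hs, ← entry_rfl, entry_single_left _ _ _ hs, zero_mul']

end FinKernel

lemma inner_delta_right [FellOps M] [FellBundle M] [FibrePredual M] (w : G) (b : M w)
    (ξ : Ell2 M) :
    Ell2.inner ξ (delta w b) = mul (B := M) (inv_mul_cancel w) (inv rfl (ξ.val w)) b := by
  rw [Ell2.inner_eq_fip _ _ {w} fun t ht =>
    ip_zero_right _ _ _ (val_delta_ne b (by simpa using ht)), fip, Finset.sum_singleton, ip,
    val_delta_same]

end

variable {B : G → Type u} [∀ t, NormedAddCommGroup (B t)] [∀ t, NormedSpace ℂ (B t)]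

variable [FellOps B] [FellBundle B] [WStarFellBundle (Bidual B)]

open FinKernel Bidual

namespace FinKernel

lemma toBidual_single {v r w : G} (h : v * r⁻¹ = w) (b : B w) :
    toBidual (single h b) = single h (incl w b) := by
  refine (eq_single h fun s s' hs => ?_).trans (congrArg (single h) ?_)
  · rw [entry_toBidual]
    rcases hs with hs | hs
    · rw [entry_single_left _ _ _ hs, map_zero]
    · rw [entry_single_right _ _ _ hs, map_zero]
  · rw [entry_toBidual, entry_single_same]

/-- The image of a one-entry kernel depends weak*-continuously on its entry, since regularity brings
`b` to the outside. -/
lemma exists_pair_inner_single {v r w : G} (h : v * r⁻¹ = w) (t : G) (ξ η : Ell2 (Bidual B))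
    (p : Pre (Bidual B) 1) : ∃ q : StrongDual ℂ (B w), ∀ b : Bidual B w,
      pair (Ell2.inner ξ (EllInfty.app (piBeta (Bidual B) (single h b)) t η)) p = ev b q := by
  have h' : v * t * (r * t)⁻¹ = w := by rw [← h]; group
  have e : w * (r * t) = v * t := by rw [← h']; group
  refine ⟨arensAux (mulL (B := B) e) (η.val (r * t)) (dualCoord ξ.val (v * t) p), fun b => ?_⟩
  have h1 : EllInfty.app (piBeta (Bidual B) (single h b)) t η =
      delta (v * t) (mul (B := Bidual B) e b (η.val (r * t))) := by
    rw [← ker_single h', ← shift_single h b t h']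
    rfl
  rw [h1, inner_delta_right]
  exact isRegular_mulL (inv_mul_cancel (v * t)) (inv (B := Bidual B) rfl (ξ.val (v * t)))
    (mul (B := Bidual B) e b (η.val (r * t))) p

end FinKernel

namespace EllInfty

lemma exists_eval_eq_pair (t : G) (ξ η : Ell2 (Bidual B)) (p : Pre (Bidual B) 1) :
    ∃ ω : PredualElt (Bidual B), ∀ f : EllInfty (Bidual B),
      eval f ω = pair (Ell2.inner ξ (f.app t η)) p := by
  let q : ℕ → Pre (Bidual B) 1 := fun n => if n = 0 then p else 0
  have h0 : ∀ n, n ≠ 0 → q n = 0 := fun n hn => if_neg hn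
  refine ⟨⟨fun _ => t, fun _ => ξ, fun _ => η, q,
    summable_of_ne_finset_zero (s := {0}) fun n hn => ?_⟩, fun f => tsum_eq_single 0 fun n hn => ?_⟩
  · rw [h0 n (by simpa using hn), norm_zero, mul_zero]
  · change pair (Ell2.inner ξ (f.app t η)) (q n) = 0
    rw [h0 n hn, ← zero_smul ℂ (0 : Pre (Bidual B) 1), pair_smul_right, zero_mul]

lemma ext_eval {f g : EllInfty (Bidual B)} (h : ∀ ω, eval f ω = eval g ω) : f = g :=
  ext' fun t η => KernelAlgebra.ext_pair_inner fun ξ p => by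
    obtain ⟨ω, hω⟩ := exists_eval_eq_pair (B := B) t ξ η p
    rw [← hω, ← hω, h]

lemma norm_eval_le (f : EllNorm B) (ω : PredualElt (Bidual B)) :
    ‖eval f ω‖ ≤ ‖f‖ * KernelAlgebra.cost ω := by
  have h : ∀ n, ‖pair (Ell2.inner (ω.x n) (f.app (ω.t n) (ω.y n))) (ω.p n)‖ ≤
      ‖f‖ * (‖ω.x n‖ * ‖ω.y n‖ * ‖ω.p n‖) := fun n => by
    refine (Ell2.norm_pair_inner_le _ _ _).trans ?_
    calc _ ≤ ‖ω.x n‖ * (‖f‖ * ‖ω.y n‖) * ‖ω.p n‖ := by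
          gcongr
          exact (f.app (ω.t n)).le_of_opNorm_le (f.norm_app_le _) _
      _ = _ := by ring
  have hs := ω.summable.mul_left ‖f‖
  exact (tsum_of_norm_bounded hs.hasSum h).trans_eq tsum_mul_left

end EllInfty

namespace KernelAlgebra

variable (B) in
/-- The extension of the representation of `𝕜(B)` to its bidual, as a map into
`ℓ^∞(G, 𝕃(ℓ²_{w*}(B'')))` with the weak* topology. -/
def extW : CStarBidual (KernelAlgebra B) →⋆ₙₐ[ℂ] EllInfty (Bidual B) := extHom B

lemma eval_extW (x : CStarBidual (KernelAlgebra B)) (ω : EllInfty.PredualElt (Bidual B)) :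
    EllInfty.eval (extW B x) ω = x.ev (coeff ω) := eval_extHom x ω

/-- The preimage is `b` under the second adjoint of the inclusion of entries at `(v, r)`. Both sides
are given by evaluating `b` at a functional on `B_w`, and the two functionals agree on `B_w`. -/
lemma piBeta_single_mem_range {v r w : G} (h : v * r⁻¹ = w) (b : Bidual B w) :
    piBeta (Bidual B) (single h b) ∈ NonUnitalStarAlgHom.range (extW B) := by
  let x : StrongDual ℂ (StrongDual ℂ (KernelAlgebra B)) :=
    (show StrongDual ℂ (StrongDual ℂ (B w)) from b).comp
      ((ContinuousLinearMap.compL ℂ (B w) (KernelAlgebra B) ℂ).flip (singleL h))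
  refine ⟨x, EllInfty.ext' fun t η => ext_pair_inner fun ξ p => ?_⟩
  obtain ⟨q, hq⟩ := exists_pair_inner_single h t ξ η p
  rw [hq]
  refine (pair_inner_extApp x t ξ η p).trans (congrArg (ev b) (ContinuousLinearMap.ext fun c => ?_))
  change coeff₁ t ξ η p (of (single h c)) = q c
  have h2 := hq (incl w c)
  rw [← toBidual_single] at h2
  exact (coeff₁_of t ξ η p _).trans h2

lemma piBeta_mem_range (k : FinKernel (Bidual B)) :
    piBeta (Bidual B) k ∈ NonUnitalStarAlgHom.range (extW B) := by
  rw [eq_sum_single k, map_sum]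
  refine sum_mem fun s _ => ?_
  rw [map_sum]
  exact sum_mem fun t _ => piBeta_single_mem_range rfl _

/-- Helly's argument: if no kernel had the prescribed values, a linear form on the
finite-dimensional space of values would give a linear relation between the functionals `coeff ω`,
and `x` would have to respect it. -/
lemma exists_rep_eval_eq (x : CStarBidual (KernelAlgebra B))
    (S : Finset (EllInfty.PredualElt (Bidual B))) :
    ∃ k : FinKernel B, ∀ ω ∈ S, EllInfty.eval (rep B k) ω = EllInfty.eval (extW B x) ω := by
  classical
  let T : FinKernel B →ₗ[ℂ] (S → ℂ) := LinearMap.pi fun ω =>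
    (coeff (ω : EllInfty.PredualElt (Bidual B))).toLinearMap ∘ₗ ofL B
  let z : S → ℂ := fun ω => x.ev (coeff (ω : EllInfty.PredualElt (Bidual B)))
  suffices hz : z ∈ LinearMap.range T by
    obtain ⟨k, hk⟩ := hz
    refine ⟨k, fun ω hω => ?_⟩
    rw [← coeff_of, eval_extW]
    exact congrFun hk ⟨ω, hω⟩
  by_contra hz
  obtain ⟨f, hf, hf'⟩ := Submodule.exists_le_ker_of_notMem hz
  have hf1 : ∀ y : S → ℂ, f y = ∑ ω, y ω * f (Pi.single ω 1) := fun y => by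
    conv_lhs => rw [pi_eq_sum_univ' y, map_sum]
    exact Finset.sum_congr rfl fun ω _ => by rw [map_smul, smul_eq_mul]
  have h0 : ∑ ω : S, f (Pi.single ω 1) • coeff (ω : EllInfty.PredualElt (Bidual B)) = 0 :=
    dual_ext fun k => by
      have h1 : f (T k) = 0 := hf' ⟨k, rfl⟩
      rw [hf1] at h1
      rw [sum_apply, zero_apply, ← h1]
      exact Finset.sum_congr rfl fun ω _ => mul_comm _ _
  refine hf ?_
  rw [hf1]
  have h2 := congrArg x.ev h0
  rw [CStarBidual.ev_zero_right] at h2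
  rw [← h2]
  refine Eq.trans ?_ (map_sum (show StrongDual ℂ (StrongDual ℂ (KernelAlgebra B)) from x) _ _).symm
  refine Finset.sum_congr rfl fun ω _ => ?_
  rw [map_smul, smul_eq_mul, mul_comm]
  rfl

lemma extW_mem (x : CStarBidual (KernelAlgebra B)) : extW B x ∈ WStarKernel (Bidual B) := by
  change extW B x ∈ closure (Set.range (piBeta (Bidual B)))
  have hind : Topology.IsInducing
      (EllInfty.eval : EllInfty (Bidual B) → EllInfty.PredualElt (Bidual B) → ℂ) := ⟨rfl⟩
  rw [hind.closure_eq_preimage_closure_image, Set.mem_preimage, mem_closure_iff_nhds]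
  intro U hU
  rw [nhds_pi, Filter.mem_pi] at hU
  obtain ⟨I, hI, V, hV, hVU⟩ := hU
  obtain ⟨k, hk⟩ := exists_rep_eval_eq x hI.toFinset
  refine ⟨EllInfty.eval (rep B k), hVU fun ω hω => ?_, ⟨rep B k, ⟨toBidualHom B k, rfl⟩, rfl⟩⟩
  rw [hk ω (hI.mem_toFinset.2 hω)]
  exact mem_of_mem_nhds (hV ω)

/-- On the W*-algebra of kernels the value at `ω` depends only on `coeff ω`, and linearly. For
kernels of `B''` this holds because they lie in the range of the extension, and the relation is
weak*-closed in `f`. -/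
lemma eval_linear {f : EllInfty (Bidual B)} (hf : f ∈ WStarKernel (Bidual B)) (z z' : ℂ)
    {ω₁ ω₂ ω₃ : EllInfty.PredualElt (Bidual B)} (h : coeff ω₃ = z • coeff ω₁ + z' • coeff ω₂) :
    EllInfty.eval f ω₃ = z * EllInfty.eval f ω₁ + z' * EllInfty.eval f ω₂ := by
  have hf' : f ∈ closure (Set.range (piBeta (Bidual B))) := hf
  refine closure_minimal ?_ (isClosed_eq (EllInfty.continuous_eval ω₃)
    ((continuous_const.mul (EllInfty.continuous_eval ω₁)).add
      (continuous_const.mul (EllInfty.continuous_eval ω₂)))) hf'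
  rintro _ ⟨k, rfl⟩
  obtain ⟨x, hx⟩ := piBeta_mem_range k
  change EllInfty.eval (piBeta (Bidual B) k) ω₃ = z * EllInfty.eval (piBeta (Bidual B) k) ω₁ +
    z' * EllInfty.eval (piBeta (Bidual B) k) ω₂
  rw [← hx]
  change EllInfty.eval (extW B x) ω₃ = z * EllInfty.eval (extW B x) ω₁ +
    z' * EllInfty.eval (extW B x) ω₂
  rw [eval_extW, eval_extW, eval_extW, h]
  exact (map_add (show StrongDual ℂ (StrongDual ℂ (KernelAlgebra B)) from x) _ _).trans
    (congrArg₂ (· + ·) (map_smul (show StrongDual ℂ (StrongDual ℂ (KernelAlgebra B)) from x) _ _)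
      (map_smul (show StrongDual ℂ (StrongDual ℂ (KernelAlgebra B)) from x) _ _))

lemma exists_extW_eq {f : EllInfty (Bidual B)} (hf : f ∈ WStarKernel (Bidual B)) :
    ∃ x, extW B x = f := by
  choose ω hω hω' using exists_coeff_eq (B := B)
  let f' : EllNorm B := f
  let x : StrongDual ℂ (StrongDual ℂ (KernelAlgebra B)) := LinearMap.mkContinuous
    { toFun := fun φ => EllInfty.eval f (ω φ)
      map_add' := fun φ ψ => by
        rw [eval_linear hf 1 1 (ω₁ := ω φ) (ω₂ := ω ψ) (by simp only [hω, one_smul]), one_mul,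
          one_mul]
      map_smul' := fun z φ => by
        rw [eval_linear hf z 0 (ω₁ := ω φ) (ω₂ := ω φ) (by
          rw [hω, hω]
          exact ((congrArg _ (zero_smul ℂ φ)).trans (add_zero (z • φ))).symm), zero_mul, add_zero]
        rfl }
    -- The factor `2` is the loss in `exists_coeff_eq` when a functional is written as a series of
    -- coefficients.
    (‖f'‖ * 2) fun φ => by
      refine (EllInfty.norm_eval_le f' (ω φ)).trans ?_
      rw [_root_.mul_assoc]
      gcongr
      exact hω' φ
  refine ⟨x, EllInfty.ext_eval fun ω' => (eval_extW x ω').trans ?_⟩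
  change EllInfty.eval f (ω (coeff ω')) = _
  -- With `z = 1` and `z' = 0`: the chosen representative of `coeff ω'` and `ω'` itself give the
  -- same value.
  rw [eval_linear hf 1 0 (ω₁ := ω') (ω₂ := ω') (by
    rw [hω, one_smul]
    exact ((congrArg _ (zero_smul ℂ (coeff ω'))).trans (add_zero (coeff ω'))).symm),
    one_mul, zero_mul, add_zero]

end KernelAlgebra

end Range

/-! ### The isomorphism -/

section Iso

variable {G : Type v} [Group G] {B : G → Type u} [∀ t, NormedAddCommGroup (B t)]
  [∀ t, NormedSpace ℂ (B t)] [FellOps B] [FellBundle B] [WStarFellBundle (Bidual B)]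

open FinKernel

namespace KernelAlgebra

/-- An element of the enveloping W*-algebra as an element of the normed bidual. -/
def toNormed (x : EnvelopingWStar (KernelAlgebra B)) : CStarBidual (KernelAlgebra B) :=
  EnvelopingWStar.toBidual x

variable (B) in
/-- The extension of the representation of `𝕜(B)` to its bidual, with values in the W*-algebra of
kernels. -/
def bidualHom : EnvelopingWStar (KernelAlgebra B) →⋆ₙₐ[ℂ] WStarKernel (Bidual B) where
  toFun x := ⟨extW B (toNormed x), extW_mem _⟩
  map_smul' z x := Subtype.ext (map_smul (extW B) z (toNormed x))
  map_zero' := Subtype.ext (map_zero (extW B))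
  map_add' x y := Subtype.ext (map_add (extW B) (toNormed x) (toNormed y))
  map_mul' x y := Subtype.ext (map_mul (extW B) (toNormed x) (toNormed y))
  map_star' x := Subtype.ext (map_star (extW B) (toNormed x))

lemma eval_bidualHom (x : EnvelopingWStar (KernelAlgebra B))
    (ω : EllInfty.PredualElt (Bidual B)) :
    EllInfty.eval (bidualHom B x).1 ω = EnvelopingWStar.toBidual x (coeff ω) :=
  eval_extW (toNormed x) ω

lemma bidualHom_bijective : Function.Bijective (bidualHom B) :=
  ⟨fun _ _ h => EnvelopingWStar.toBidual.injective (extHom_injective (Subtype.ext_iff.1 h)),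
    fun f => by
      obtain ⟨x, hx⟩ := exists_extW_eq f.2
      exact ⟨EnvelopingWStar.toBidual.symm x, Subtype.ext hx⟩⟩

variable (B) in
/-- The isomorphism `𝕜(B)'' ≅ 𝕜_{w*}(B'')`. -/
def bidualEquiv : EnvelopingWStar (KernelAlgebra B) ≃⋆ₐ[ℂ] WStarKernel (Bidual B) :=
  StarAlgEquiv.ofBijective (bidualHom B) bidualHom_bijective

lemma eval_bidualEquiv (x : EnvelopingWStar (KernelAlgebra B))
    (ω : EllInfty.PredualElt (Bidual B)) :
    EllInfty.eval (bidualEquiv B x).1 ω = EnvelopingWStar.toBidual x (coeff ω) :=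
  eval_bidualHom x ω

lemma continuous_bidualEquiv : Continuous (bidualEquiv B) :=
  continuous_induced_rng.2 (EllInfty.continuous_of_eval fun ω => by
    simp only [Function.comp_apply]
    refine (WeakDual.eval_continuous (coeff ω)).congr fun x => ?_
    exact (eval_bidualEquiv x ω).symm)

/-- Every functional on `𝕜(B)` is some `coeff ω`, so each evaluation on the bidual is one of the
evaluations that define the topology of `ℓ^∞`. -/
lemma continuous_bidualEquiv_symm : Continuous (bidualEquiv B).symm := by
  refine WeakDual.continuous_of_continuous_eval fun φ => ?_
  obtain ⟨ω, rfl, -⟩ := exists_coeff_eq φ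
  refine ((EllInfty.continuous_eval ω).comp continuous_subtype_val).congr fun f => ?_
  have h := eval_bidualEquiv ((bidualEquiv B).symm f) ω
  rw [StarAlgEquiv.apply_symm_apply] at h
  exact h

/-- The representation intertwines `β` with translation, so `β_s` acts on coefficient data by moving
the coordinates `t` to `s⁻¹ t`. -/
lemma coeff_comp_shift (s : G) (ω : EllInfty.PredualElt (Bidual B)) :
    (coeff ω).comp (EnvelopingWStar.homCLM (canonicalAction B s)) =
      coeff ⟨fun n => s⁻¹ * ω.t n, ω.x, ω.y, ω.p, ω.summable⟩ := dual_ext fun k => by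
  change coeff ω (shift s (of k)) = _
  rw [shift_of, coeff_of, coeff_of, rep_apply, toBidualHom_shiftHom, ← translate_piBeta]
  rfl

lemma eval_wstarAction (s : G) (f : WStarKernel (Bidual B)) (ω : EllInfty.PredualElt (Bidual B)) :
    EllInfty.eval (wstarAction (Bidual B) s f).1 ω =
      EllInfty.eval f.1 ⟨fun n => s⁻¹ * ω.t n, ω.x, ω.y, ω.p, ω.summable⟩ := rfl

lemma bidualEquiv_bidualAction (s : G) (x : EnvelopingWStar (KernelAlgebra B)) :
    bidualEquiv B (EnvelopingWStar.bidualAction (canonicalAction B) s x) =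
      wstarAction (Bidual B) s (bidualEquiv B x) :=
  Subtype.ext (EllInfty.ext_eval fun ω => by
    let ω' : EllInfty.PredualElt (Bidual B) := ⟨fun n => s⁻¹ * ω.t n, ω.x, ω.y, ω.p, ω.summable⟩
    have h1 : EllInfty.eval (wstarAction (Bidual B) s (bidualEquiv B x)).1 ω =
        EllInfty.eval (bidualEquiv B x).1 ω' := eval_wstarAction s _ ω
    have h2 : EnvelopingWStar.toBidual
        (EnvelopingWStar.bidualAction (canonicalAction B) s x) (coeff ω) =
        EnvelopingWStar.toBidual x (coeff ω') :=
      (EnvelopingWStar.map_apply (canonicalAction B s) x (coeff ω)).trans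
        (congrArg (EnvelopingWStar.toBidual x) (coeff_comp_shift s ω))
    exact (eval_bidualEquiv _ ω).trans (h2.trans ((eval_bidualEquiv x ω').symm.trans h1.symm)))

end KernelAlgebra

end Iso

end Fell

end

theorem mainTheorem10 {G : Type*} [Group G] (B : G → Type*) [∀ t, NormedAddCommGroup (B t)]
    [∀ t, NormedSpace ℂ (B t)] [Fell.FellOps B] [Fell.FellBundle B] :
    ∃ _h : Fell.WStarFellBundle (Fell.Bidual B),
      ∃ Φ : Fell.EnvelopingWStar (Fell.KernelAlgebra B) ≃⋆ₐ[ℂ] Fell.WStarKernel (Fell.Bidual B),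
        Continuous Φ ∧ Continuous Φ.symm ∧
          ∀ s x, Φ (Fell.EnvelopingWStar.bidualAction (Fell.KernelAlgebra.canonicalAction B) s x) =
            Fell.wstarAction (Fell.Bidual B) s (Φ x) := by
  have h := Fell.wStarFellBundle_bidual B
  exact ⟨h, Fell.KernelAlgebra.bidualEquiv B, Fell.KernelAlgebra.continuous_bidualEquiv,
    Fell.KernelAlgebra.continuous_bidualEquiv_symm, Fell.KernelAlgebra.bidualEquiv_bidualAction⟩
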